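/- An instance of Multistage 2-SAT consists of a set $X$ of $n$ variables, a sequence $\Phi=(\mathcal C_1,\dots,\mathcal C_\tau)$, $\tau\ge 1$, of 2-CNF formulas over $X$ (conjunctions of clauses, each clause a disjunction of at most two literals), and an integer $d\ge 0$. It is a yes-instance if there are truth assignments $f_1,\dots,f_\tau\colon X\to\{\bot,\top\}$ such that $f_i$ satisfies $\mathcal C_i$ for each $i\in\{1,\dots,\tau\}$ and $|\{x\in X: f_i(x)\ne f_{i+1}(x)\}|\le d$ for each $i\in\{1,\dots,\tau-1\}$. Let $m$ denote the maximum number of clauses in any of the formulas $\mathcal C_1,\dots,\mathcal C_\tau$. Theorem. Multistage 2-SAT is solvable in $O\bigl(n^{2\tau d}\cdot 2^{\tau d+1}\cdot \tau\,(n+m)\bigr)$ time. That is, there are a single program for the unit-cost word RAM (with words of $O(\log(n+m+\tau+d+2))$ bits) and an absolute constant $C$ such that the program, on every instance with $n\ge 1$, halts after at most $C\cdot n^{2\tau d}\cdot 2^{\tau d+1}\cdot\tau\,(n+m)$ steps and correctly reports whether the instance is a yes-instance. -/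

import Mathlib

/-! ### Multistage satisfiability -/

/-- A literal over `X`: `(x, true)` is the positive literal, `(x, false)` the negated one. -/
abbrev Literal (X : Type*) := X × Bool

/-- A clause: a disjunction of literals. -/
abbrev Clause (X : Type*) := List (Literal X)

/-- A formula in conjunctive normal form: a conjunction of clauses. -/
abbrev CNF (X : Type*) := List (Clause X)

/-- The truth assignment `f` satisfies every clause, i.e. each clause has a literal that `f`
evaluates to true. -/
def Satisfies {X : Type*} (f : X → Bool) (φ : CNF X) : Prop :=
  ∀ C ∈ φ, ∃ l ∈ C, f l.1 = l.2

/-- An instance of Multistage `q`-SAT. The variables are numbered `0, …, n - 1`. -/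
structure MultistageSAT (q : ℕ) where
  /-- number of variables -/
  n : ℕ
  /-- number of stages -/
  τ : ℕ
  /-- maximum number of changes between consecutive stages -/
  d : ℕ
  /-- the formula of each stage -/
  formula : Fin τ → CNF (Fin n)
  τ_pos : 1 ≤ τ
  width_le : ∀ i, ∀ C ∈ formula i, C.length ≤ q

namespace MultistageSAT

variable {q : ℕ}

/-- The maximum number of clauses in a stage. -/
def m (I : MultistageSAT q) : ℕ :=
  Finset.univ.sup fun i => (I.formula i).length

/-- `I` is a yes-instance: there are satisfying assignments for the stages such that any two
consecutive ones differ on at most `d` variables. -/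
def IsYes (I : MultistageSAT q) : Prop :=
  ∃ f : Fin I.τ → Fin I.n → Bool,
    (∀ i, Satisfies (f i) (I.formula i)) ∧
    ∀ i j : Fin I.τ, (j : ℕ) = i + 1 →
      (Finset.univ.filter fun x => f i x ≠ f j x).card ≤ I.d

end MultistageSAT

/-! ### Encoding of instances as sequences of numbers -/

/-- The positive literal of variable `v` is written `2 v + 1`, the negated one `2 v`. -/
def encodeLiteral {n : ℕ} (l : Literal (Fin n)) : ℕ := 2 * (l.1 : ℕ) + l.2.toNat

/-- The number of literals of the clause, followed by the literals. -/
def encodeClause {n : ℕ} (C : Clause (Fin n)) : List ℕ := C.length :: C.map encodeLiteral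

/-- The number of clauses of the formula, followed by the clauses. -/
def encodeCNF {n : ℕ} (φ : CNF (Fin n)) : List ℕ := φ.length :: φ.flatMap encodeClause

/-- The numbers `n`, `τ`, `d`, followed by the formulas of the stages in order. -/
def MultistageSAT.encode {q : ℕ} (I : MultistageSAT q) : List ℕ :=
  [I.n, I.τ, I.d] ++ (List.ofFn I.formula).flatMap encodeCNF

/-! ### Word RAM

A random access machine with registers and a memory that is addressed indirectly through the
registers. Programs are written in structured form (sequence, branch, loop). A step is one
instruction or one evaluation of a branch or loop test. A machine word holds the numbers
`0, …, B`; an instruction whose result would not fit into a word cannot be executed, so a run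
as defined below is a run in which no overflow ever occurs. -/

namespace WordRAM

/-- Contents of the registers and of the memory. -/
structure Store where
  reg : ℕ → ℕ
  mem : ℕ → ℕ

/-- `x`, `y`, `z` are names of registers. -/
inductive Instr
  /-- `x := k` -/
  | const (x k : ℕ)
  /-- `x := y` -/
  | move (x y : ℕ)
  /-- `x := y + z` -/
  | add (x y z : ℕ)
  /-- `x := max (y - z) 0` -/
  | sub (x y z : ℕ)
  /-- `x := y * z` -/
  | mul (x y z : ℕ)
  /-- `x := mem[y]` -/
  | load (x y : ℕ)
  /-- `mem[x] := y` -/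
  | store (x y : ℕ)

/-- Comparison of two registers. -/
inductive Test
  /-- `x < y` -/
  | lt (x y : ℕ)
  /-- `x = y` -/
  | eq (x y : ℕ)

inductive Program
  | instr (i : Instr)
  | seq (P Q : Program)
  | ite (b : Test) (P Q : Program)
  | while (b : Test) (P : Program)

/-- Write `v` into register `x`. -/
def Store.setReg (s : Store) (x v : ℕ) : Store := { s with reg := Function.update s.reg x v }

/-- Write `v` into the memory cell with address `a`. -/
def Store.setMem (s : Store) (a v : ℕ) : Store := { s with mem := Function.update s.mem a v }

/-- The number that an instruction computes (and then writes). -/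
def Instr.value (s : Store) : Instr → ℕ
  | const _ k => k
  | move _ y => s.reg y
  | add _ y z => s.reg y + s.reg z
  | sub _ y z => s.reg y - s.reg z
  | mul _ y z => s.reg y * s.reg z
  | load _ y => s.mem (s.reg y)
  | store _ y => s.reg y

/-- The effect of an instruction. -/
def Instr.apply (s : Store) (i : Instr) : Store :=
  match i with
  | const x _ | move x _ | add x _ _ | sub x _ _ | mul x _ _ | load x _ =>
      s.setReg x (i.value s)
  | store x _ => s.setMem (s.reg x) (i.value s)

/-- Truth of a test. -/
def Test.Holds (s : Store) : Test → Prop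
  | lt x y => s.reg x < s.reg y
  | eq x y => s.reg x = s.reg y

/-- `Exec B P s t s'`: on a machine whose words hold the numbers up to `B`, the program `P`,
started in `s`, halts in `s'` after exactly `t` steps. -/
inductive Exec (B : ℕ) : Program → Store → ℕ → Store → Prop
  | instr {i : Instr} {s : Store} (h : i.value s ≤ B) : Exec B (.instr i) s 1 (i.apply s)
  | seq {P Q : Program} {s s' s'' : Store} {t t' : ℕ} (hP : Exec B P s t s')
      (hQ : Exec B Q s' t' s'') : Exec B (.seq P Q) s (t + t') s''
  | ite_true {b : Test} {P Q : Program} {s s' : Store} {t : ℕ} (hb : b.Holds s)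
      (hP : Exec B P s t s') : Exec B (.ite b P Q) s (t + 1) s'
  | ite_false {b : Test} {P Q : Program} {s s' : Store} {t : ℕ} (hb : ¬ b.Holds s)
      (hQ : Exec B Q s t s') : Exec B (.ite b P Q) s (t + 1) s'
  | while_true {b : Test} {P : Program} {s s' s'' : Store} {t t' : ℕ} (hb : b.Holds s)
      (hP : Exec B P s t s') (hW : Exec B (.while b P) s' t' s'') :
      Exec B (.while b P) s (t + t' + 1) s''
  | while_false {b : Test} {P : Program} {s : Store} (hb : ¬ b.Holds s) :
      Exec B (.while b P) s 1 s

/-- The input is written into the memory cells `0, 1, 2, …`; all other cells and all registers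
are `0`. -/
def initial (input : List ℕ) : Store where
  reg := fun _ => 0
  mem := fun a => input.getD a 0

end WordRAM

/-- On the instance `I`, the program `P` halts within `T` steps on a machine whose words hold
the numbers up to `B`, and register `0` finally contains the correct answer (`1` for yes and `0`
for no). -/
def DecidesWithin {q : ℕ} (P : WordRAM.Program) (I : MultistageSAT q) (B T : ℕ) : Prop :=
  ∃ (t : ℕ) (s : WordRAM.Store), t ≤ T ∧ WordRAM.Exec B P (WordRAM.initial I.encode) t s ∧
    (I.IsYes → s.reg 0 = 1) ∧ (¬ I.IsYes → s.reg 0 = 0)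

/-! Fix the first assignment and, for each later stage, guess the at most `d` variables that change.
Stage `j` then uses the first assignment with a variable negated iff it has changed an odd number of
times so far. Negating the literals of stage `j` accordingly turns all stages into statements about
one unknown assignment (`litTrue_flipl`), so every guess leaves a single 2-CNF formula with at most
`n` variables and `τ m` clauses.

A guess is a word of `τ d` digits in `{0, …, n}`, where the digit `n` stands for "no change". Since
no more than `n` variables can change, `d` may be replaced by `min d n`. `Raw.Ok.yes_iff` says that
the instance is a yes-instance iff some guess gives a satisfiable formula. There are `(n+1)^(τ min d
n) ≤ (2n)^(τ d)` guesses, which lies below `n^(2τd) 2^(τd+1)`, and each costs `O(τ (n+m))`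
(`solver_time_le`).

Each formula is solved in linear time by limited backtracking on its implication graph. For an
unassigned variable, unit propagations from both of its literals run in lockstep until one completes
without contradiction or both fail. A completed propagation may be kept for good: any solution stays
a solution when overwritten by it (`Running.partial_extend`). The loser has done only as many rounds
as the winner, and these are paid for by the weight of the literals that become assigned
(`Running.weight_extend`). If both fail, there is no solution (`Search.Partial.not_respects`).

The algorithm is written in a small language with registers and arrays whose cost semantics counts
machine steps exactly. `Cmd.Run.exec_compile` transfers runs to the word RAM, and a
weakest-precondition calculus with frame conditions proves correctness and running time together. -/

open WordRAM

/-! ### A small imperative language over the word RAM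

Registers and arrays have names; the arrays are interleaved in the memory cells that follow the
input. -/

namespace ArrayRAM

/-- Names of registers. -/
inductive Var
  | ans | n | tau | d | K | go | cur | i | k | dp | cnt | len | a | b | x | y | e | v | s | sat
  | st (w : Bool) | h (w : Bool) | q (w : Bool) | ep (w : Bool)
  deriving DecidableEq

/-- Names of arrays. -/
inductive Arr
  | tr | neg | head | next | tgt | dig | val | mark (w : Bool) | queue (w : Bool)
  deriving DecidableEq

/-- The machine register that holds a named register. -/
def Var.idx : Var → ℕ
  | ans => 0 | n => 1 | tau => 2 | d => 3 | K => 4 | go => 5 | cur => 6 | i => 7 | k => 8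
  | dp => 9 | cnt => 10 | len => 11 | a => 12 | b => 13 | x => 14 | y => 15 | e => 16 | v => 17
  | s => 18 | sat => 19
  | st false => 20 | h false => 21 | q false => 22 | ep false => 23
  | st true => 24 | h true => 25 | q true => 26 | ep true => 27

/-- The residue modulo `16` of the memory cells of an array. -/
def Arr.idx : Arr → ℕ
  | tr => 0 | neg => 1 | head => 2 | next => 3 | tgt => 4 | dig => 5 | val => 6
  | mark false => 7 | mark true => 8 | queue false => 9 | queue true => 10

theorem Var.idx_lt (r : Var) : r.idx < 40 := by
  rcases r with _ | _ | _ | _ | _ | _ | _ | _ | _ | _ | _ | _ | _ | _ | _ | _ | _ | _ | _ | _ |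
    w | w | w | w <;> (try rcases w with _ | _) <;> simp [Var.idx]

theorem Arr.idx_lt (j : Arr) : j.idx < 16 := by
  rcases j with _ | _ | _ | _ | _ | _ | _ | w | w <;> (try rcases w with _ | _) <;> simp [Arr.idx]

/-- A left inverse of `Var.idx`. -/
def Var.ofIdx : ℕ → Var
  | 0 => ans | 1 => n | 2 => tau | 3 => d | 4 => K | 5 => go | 6 => cur | 7 => i | 8 => k
  | 9 => dp | 10 => cnt | 11 => len | 12 => a | 13 => b | 14 => x | 15 => y | 16 => e | 17 => v
  | 18 => s | 19 => sat
  | 20 => st false | 21 => h false | 22 => q false | 23 => ep false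
  | 24 => st true | 25 => h true | 26 => q true | _ => ep true

/-- A left inverse of `Arr.idx`. -/
def Arr.ofIdx : ℕ → Arr
  | 0 => tr | 1 => neg | 2 => head | 3 => next | 4 => tgt | 5 => dig | 6 => val
  | 7 => mark false | 8 => mark true | 9 => queue false | _ => queue true

theorem Var.idx_injective : Function.Injective Var.idx :=
  Function.LeftInverse.injective (g := Var.ofIdx) fun r => by
    rcases r with _ | _ | _ | _ | _ | _ | _ | _ | _ | _ | _ | _ | _ | _ | _ | _ | _ | _ | _ | _ |
      w | w | w | w <;> (try rcases w with _ | _) <;> rfl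

theorem Arr.idx_injective : Function.Injective Arr.idx :=
  Function.LeftInverse.injective (g := Arr.ofIdx) fun r => by
    rcases r with _ | _ | _ | _ | _ | _ | _ | w | w <;> (try rcases w with _ | _) <;> rfl

/-- Contents of the named registers and arrays. -/
structure St where
  reg : Var → ℕ
  arr : Arr → ℕ → ℕ

/-- Write `v` into register `r`. -/
def St.set (σ : St) (r : Var) (v : ℕ) : St :=
  { σ with reg := fun r' => if r' = r then v else σ.reg r' }

/-- Write `v` into cell `i` of array `j`. -/
def St.put (σ : St) (j : Arr) (i v : ℕ) : St :=
  { σ with arr := fun j' => if j' = j then Function.update (σ.arr j) i v else σ.arr j' }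

@[simp] theorem St.reg_set (σ : St) (r r' : Var) (v : ℕ) :
    (σ.set r v).reg r' = if r' = r then v else σ.reg r' := rfl

@[simp] theorem St.arr_set (σ : St) (r : Var) (v : ℕ) : (σ.set r v).arr = σ.arr := rfl

@[simp] theorem St.reg_put (σ : St) (j : Arr) (i v : ℕ) : (σ.put j i v).reg = σ.reg := rfl

@[simp] theorem St.arr_put (σ : St) (j j' : Arr) (i v : ℕ) :
    (σ.put j i v).arr j' = if j' = j then Function.update (σ.arr j) i v else σ.arr j' := rfl

/-- The surroundings of a run: the input and its length, a bound for computed numbers, and the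
length of the arrays. -/
structure Env where
  inp : ℕ → ℕ
  len : ℕ
  bound : ℕ
  size : ℕ

/-- Arithmetic expressions. -/
inductive Ex
  | lit (k : ℕ)
  | var (r : Var)
  | add (e f : Ex)
  | sub (e f : Ex)
  | mul (e f : Ex)
  | inp (e : Ex)
  | arr (j : Arr) (e : Ex)

instance : Coe Var Ex := ⟨Ex.var⟩
instance (k : ℕ) : OfNat Ex k := ⟨Ex.lit k⟩
instance : Add Ex := ⟨Ex.add⟩
instance : Sub Ex := ⟨Ex.sub⟩
instance : Mul Ex := ⟨Ex.mul⟩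

/-- The value of an expression. -/
def Ex.eval (E : Env) (σ : St) : Ex → ℕ
  | lit k => k
  | var r => σ.reg r
  | add e f => e.eval E σ + f.eval E σ
  | sub e f => e.eval E σ - f.eval E σ
  | mul e f => e.eval E σ * f.eval E σ
  | inp e => E.inp (e.eval E σ)
  | arr j e => σ.arr j (e.eval E σ)

/-- The evaluation of an expression stays within the bounds. -/
def Ex.Ok (E : Env) (σ : St) : Ex → Prop
  | lit k => k ≤ E.bound
  | var _ => True
  | add e f => e.Ok E σ ∧ f.Ok E σ ∧ e.eval E σ + f.eval E σ ≤ E.bound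
  | sub e f => e.Ok E σ ∧ f.Ok E σ
  | mul e f => e.Ok E σ ∧ f.Ok E σ ∧ e.eval E σ * f.eval E σ ≤ E.bound
  | inp e => e.Ok E σ ∧ e.eval E σ < E.len
  | arr _ e => e.Ok E σ ∧ e.eval E σ < E.size

/-- The number of machine steps that the evaluation of an expression takes. -/
def Ex.cost : Ex → ℕ
  | lit _ => 1
  | var _ => 1
  | add e f => e.cost + f.cost + 1
  | sub e f => e.cost + f.cost + 1
  | mul e f => e.cost + f.cost + 1
  | inp e => e.cost + 1
  | arr _ e => e.cost + 6

section simp_lemmas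

variable (E : Env) (σ : St) (e f : Ex) (j : Arr) (r : Var) (k : ℕ)

@[simp] theorem Ex.eval_lit : (no_index (OfNat.ofNat k) : Ex).eval E σ = k := rfl
@[simp] theorem Ex.eval_var : (Ex.var r).eval E σ = σ.reg r := rfl
@[simp] theorem Ex.eval_add : (e + f).eval E σ = e.eval E σ + f.eval E σ := rfl
@[simp] theorem Ex.eval_sub : (e - f).eval E σ = e.eval E σ - f.eval E σ := rfl
@[simp] theorem Ex.eval_mul : (e * f).eval E σ = e.eval E σ * f.eval E σ := rfl
@[simp] theorem Ex.eval_inp : (Ex.inp e).eval E σ = E.inp (e.eval E σ) := rfl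
@[simp] theorem Ex.eval_arr : (Ex.arr j e).eval E σ = σ.arr j (e.eval E σ) := rfl
@[simp] theorem Ex.ok_lit : (no_index (OfNat.ofNat k) : Ex).Ok E σ ↔ k ≤ E.bound := Iff.rfl
@[simp] theorem Ex.ok_var : (Ex.var r).Ok E σ ↔ True := Iff.rfl
@[simp] theorem Ex.ok_add :
    (e + f).Ok E σ ↔ e.Ok E σ ∧ f.Ok E σ ∧ e.eval E σ + f.eval E σ ≤ E.bound := Iff.rfl
@[simp] theorem Ex.ok_sub : (e - f).Ok E σ ↔ e.Ok E σ ∧ f.Ok E σ := Iff.rfl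
@[simp] theorem Ex.ok_mul :
    (e * f).Ok E σ ↔ e.Ok E σ ∧ f.Ok E σ ∧ e.eval E σ * f.eval E σ ≤ E.bound := Iff.rfl
@[simp] theorem Ex.ok_inp : (Ex.inp e).Ok E σ ↔ e.Ok E σ ∧ e.eval E σ < E.len := Iff.rfl
@[simp] theorem Ex.ok_arr : (Ex.arr j e).Ok E σ ↔ e.Ok E σ ∧ e.eval E σ < E.size := Iff.rfl
@[simp] theorem Ex.cost_lit : (no_index (OfNat.ofNat k) : Ex).cost = 1 := rfl
@[simp] theorem Ex.cost_var : (Ex.var r).cost = 1 := rfl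
@[simp] theorem Ex.cost_add : (e + f).cost = e.cost + f.cost + 1 := rfl
@[simp] theorem Ex.cost_sub : (e - f).cost = e.cost + f.cost + 1 := rfl
@[simp] theorem Ex.cost_mul : (e * f).cost = e.cost + f.cost + 1 := rfl
@[simp] theorem Ex.cost_inp : (Ex.inp e).cost = e.cost + 1 := rfl
@[simp] theorem Ex.cost_arr : (Ex.arr j e).cost = e.cost + 6 := rfl

end simp_lemmas

/-- Comparisons of expressions. -/
inductive Cond
  | lt (e f : Ex)
  | eq (e f : Ex)

/-- Truth of a comparison. -/
def Cond.Holds (E : Env) (σ : St) : Cond → Prop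
  | lt e f => e.eval E σ < f.eval E σ
  | eq e f => e.eval E σ = f.eval E σ

/-- The evaluation of a comparison stays within the bounds. -/
def Cond.Ok (E : Env) (σ : St) : Cond → Prop
  | lt e f => e.Ok E σ ∧ f.Ok E σ
  | eq e f => e.Ok E σ ∧ f.Ok E σ

/-- The number of machine steps that the evaluation of a comparison takes. -/
def Cond.cost : Cond → ℕ
  | lt e f => e.cost + f.cost
  | eq e f => e.cost + f.cost

/-- Commands. -/
inductive Cmd
  | set (r : Var) (e : Ex)
  | put (j : Arr) (e f : Ex)
  | seq (P Q : Cmd)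
  | ite (c : Cond) (P Q : Cmd)
  | skip
  | loop (c : Cond) (P : Cmd)

infixr:30 " ;; " => Cmd.seq
infix:40 " ::= " => Cmd.set

/-- Big-step semantics with exact costs in machine steps. -/
inductive Cmd.Run (E : Env) : Cmd → St → ℕ → St → Prop
  | set {r e σ} (h : e.Ok E σ) : Run E (.set r e) σ (e.cost + 1) (σ.set r (e.eval E σ))
  | put {j e f σ} (he : e.Ok E σ) (hf : f.Ok E σ) (hs : e.eval E σ < E.size) :
      Run E (.put j e f) σ (e.cost + f.cost + 6) (σ.put j (e.eval E σ) (f.eval E σ))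
  | seq {P Q σ σ' σ'' t t'} (hP : Run E P σ t σ') (hQ : Run E Q σ' t' σ'') :
      Run E (.seq P Q) σ (t + t') σ''
  | ite_true {c P Q σ σ' t} (hc : c.Ok E σ) (h : c.Holds E σ) (hP : Run E P σ t σ') :
      Run E (.ite c P Q) σ (c.cost + 1 + t) σ'
  | ite_false {c P Q σ σ' t} (hc : c.Ok E σ) (h : ¬ c.Holds E σ) (hQ : Run E Q σ t σ') :
      Run E (.ite c P Q) σ (c.cost + 1 + t) σ'
  | skip {σ} : Run E .skip σ 1 σ
  | loop_true {c P σ σ' σ'' t t'} (hc : c.Ok E σ) (h : c.Holds E σ) (hP : Run E P σ t σ')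
      (hW : Run E (.loop c P) σ' t' σ'') : Run E (.loop c P) σ (c.cost + 1 + t + t') σ''
  | loop_false {c P σ} (hc : c.Ok E σ) (h : ¬ c.Holds E σ) :
      Run E (.loop c P) σ (c.cost + 1) σ

/-! #### Compilation -/

/-- Code that turns an index in register `T` into the address of a cell of array `j`. -/
def Ex.address (j : Arr) (T : ℕ) : Program :=
  .seq (.instr (.const (T + 1) 16)) (.seq (.instr (.mul T T (T + 1)))
    (.seq (.instr (.add T T 40)) (.seq (.instr (.const (T + 1) j.idx))
    (.instr (.add T T (T + 1))))))

/-- Code that computes an expression into register `T`, using the registers from `T` on. -/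
def Ex.compile : Ex → ℕ → Program
  | lit k, T => .instr (.const T k)
  | var r, T => .instr (.move T r.idx)
  | add e f, T => .seq (.seq (e.compile T) (f.compile (T + 1))) (.instr (.add T T (T + 1)))
  | sub e f, T => .seq (.seq (e.compile T) (f.compile (T + 1))) (.instr (.sub T T (T + 1)))
  | mul e f, T => .seq (.seq (e.compile T) (f.compile (T + 1))) (.instr (.mul T T (T + 1)))
  | inp e, T => .seq (e.compile T) (.instr (.load T T))
  | arr j e, T => .seq (e.compile T) (.seq (address j T) (.instr (.load T T)))

/-- Code that computes both sides of a comparison. -/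
def Cond.compile : Cond → Program
  | lt e f => .seq (e.compile 50) (f.compile 51)
  | eq e f => .seq (e.compile 50) (f.compile 51)

/-- The test that follows the code `Cond.compile`. -/
def Cond.test : Cond → Test
  | lt _ _ => .lt 50 51
  | eq _ _ => .eq 50 51

/-- The machine program of a command. -/
def Cmd.compile : Cmd → Program
  | set r e => .seq (e.compile 50) (.instr (.move r.idx 50))
  | put j e f => .seq (.seq (e.compile 50) (Ex.address j 50))
      (.seq (f.compile 51) (.instr (.store 50 51)))
  | seq P Q => .seq P.compile Q.compile
  | ite c P Q => .seq c.compile (.ite c.test P.compile Q.compile)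
  | skip => .instr (.const 50 0)
  | loop c P => .seq c.compile (.while c.test (.seq P.compile c.compile))

/-- The machine store `s` represents the state `σ`. -/
structure Rel (E : Env) (B : ℕ) (σ : St) (s : Store) : Prop where
  reg_le : ∀ r, s.reg r ≤ B
  mem_le : ∀ a, s.mem a ≤ B
  reg : ∀ r : Var, s.reg r.idx = σ.reg r
  base : 0 < E.size → s.reg 40 = E.len
  inp : ∀ a < E.len, s.mem a = E.inp a
  arr : ∀ (j : Arr) i, s.mem (E.len + 16 * i + j.idx) = σ.arr j i

/-- The word size suffices for the computed numbers and for the addresses of array cells. -/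
structure Env.Fits (E : Env) (B : ℕ) : Prop where
  bound : E.bound ≤ B
  size : E.len + 16 * E.size + 16 ≤ B

variable {E : Env} {B : ℕ}

/-- Named registers lie below 40 and the base address sits in register 40, so registers from 50 on
are free scratch space. -/
theorem Rel.setTemp {σ : St} {s : Store} (h : Rel E B σ s) {T v : ℕ} (hT : 50 ≤ T) (hv : v ≤ B) :
    Rel E B σ (s.setReg T v) where
  reg_le r := by
    simp only [Store.setReg, Function.update_apply]
    split_ifs
    exacts [hv, h.reg_le r]
  mem_le := h.mem_le
  reg r := by
    have := r.idx_lt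
    simp only [Store.setReg]
    rw [Function.update_of_ne (by omega), h.reg]
  base h0 := by
    simp only [Store.setReg]
    rw [Function.update_of_ne (by omega), h.base h0]
  inp := h.inp
  arr := h.arr

theorem Rel.setVar {σ : St} {s : Store} (h : Rel E B σ s) (r : Var) {v : ℕ} (hv : v ≤ B) :
    Rel E B (σ.set r v) (s.setReg r.idx v) where
  reg_le r := by
    simp only [Store.setReg, Function.update_apply]
    split_ifs
    exacts [hv, h.reg_le r]
  mem_le := h.mem_le
  reg r' := by
    by_cases hr : r' = r
    · simp [Store.setReg, hr]
    · simp only [Store.setReg, St.reg_set, if_neg hr]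
      rw [Function.update_of_ne (Var.idx_injective.ne hr), h.reg]
  base h0 := by
    have := r.idx_lt
    simp only [Store.setReg]
    rw [Function.update_of_ne (by omega), h.base h0]
  inp := h.inp
  arr := h.arr

theorem Rel.setArr {σ : St} {s : Store} (h : Rel E B σ s) (j : Arr) (i : ℕ) {v : ℕ} (hv : v ≤ B) :
    Rel E B (σ.put j i v) (s.setMem (E.len + 16 * i + j.idx) v) where
  reg_le := h.reg_le
  mem_le a := by
    simp only [Store.setMem, Function.update_apply]
    split_ifs
    exacts [hv, h.mem_le a]
  reg := h.reg
  base := h.base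
  inp a ha := by
    simp only [Store.setMem]
    rw [Function.update_of_ne (by omega), h.inp a ha]
  arr j' i' := by
    have h1 := j.idx_lt
    have h2 := j'.idx_lt
    simp only [Store.setMem, St.arr_put]
    by_cases hj : j' = j
    · subst hj
      by_cases hi : i' = i
      · simp [hi]
      · rw [Function.update_of_ne (by omega), h.arr, if_pos rfl, Function.update_of_ne hi]
    · have : j'.idx ≠ j.idx := Arr.idx_injective.ne hj
      rw [Function.update_of_ne (by omega), h.arr, if_neg hj]

theorem exec_instr_of_eq {i : Instr} {s s' : Store} (h : i.value s ≤ B) (hs : i.apply s = s') :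
    Exec B (.instr i) s 1 s' := hs ▸ Exec.instr h

/-- Register `T + 1` may be destroyed: only the registers below `T` can hold pending operands. -/
theorem Ex.exec_address (hB : E.Fits B) {σ : St} {s : Store} (h : Rel E B σ s) (j : Arr)
    {T : ℕ} (hT : 50 ≤ T) (hs : s.reg T < E.size) :
    ∃ s', Exec B (address j T) s 5 s' ∧ Rel E B σ s' ∧
      s'.reg T = E.len + 16 * s.reg T + j.idx ∧ (∀ r < T, s'.reg r = s.reg r) := by
  have hj := j.idx_lt
  have hb := hB.size
  have h0 := h.base (by omega)
  have h1 := h.setTemp (T := T + 1) (v := 16) (by omega) (by omega)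
  have h2 := h1.setTemp (T := T) (v := s.reg T * 16) (by omega) (by omega)
  have h3 := h2.setTemp (T := T) (v := s.reg T * 16 + E.len) (by omega) (by omega)
  have h4 := h3.setTemp (T := T + 1) (v := j.idx) (by omega) (by omega)
  have h5 := h4.setTemp (T := T) (v := s.reg T * 16 + E.len + j.idx) (by omega) (by omega)
  have hT' : (40 : ℕ) ≠ T := by omega
  have hT1 : (40 : ℕ) ≠ T + 1 := by omega
  refine ⟨_, .seq (t := 1) (t' := 4) (exec_instr_of_eq (by simp [Instr.value]; omega) rfl)
    (.seq (t := 1) (t' := 3) (exec_instr_of_eq (by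
      simp [Instr.value, Instr.apply, Store.setReg]; omega) rfl)
    (.seq (t := 1) (t' := 2) (exec_instr_of_eq (by
      simp [Instr.value, Instr.apply, Store.setReg, hT', h0, hT1]; omega) rfl)
    (.seq (t := 1) (t' := 1) (exec_instr_of_eq (by simp [Instr.value]; omega) rfl)
    (exec_instr_of_eq (s' := (((((s.setReg (T + 1) 16).setReg T (s.reg T * 16)).setReg T
      (s.reg T * 16 + E.len)).setReg (T + 1) j.idx).setReg T (s.reg T * 16 + E.len + j.idx)))
      (by simp [Instr.value, Instr.apply, Store.setReg, hT', h0, hT1]; omega)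
      (by simp [Instr.value, Instr.apply, Store.setReg, hT', h0, hT1]))))), h5, ?_, ?_⟩
  · simp [Store.setReg]; ring
  · intro r hr
    simp [Store.setReg, show r ≠ T by omega, show r ≠ T + 1 by omega]

/-- The registers from `T` on act as an evaluation stack. The last conjunct makes the induction
work: the value of the left operand in `T` survives while the right one is computed from `T + 1` on.
-/
theorem Ex.exec_compile (hB : E.Fits B) {σ : St} (e : Ex) : ∀ {T : ℕ} {s : Store}, 50 ≤ T →
    e.Ok E σ → Rel E B σ s → ∃ s', Exec B (e.compile T) s e.cost s' ∧ Rel E B σ s' ∧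
      s'.reg T = e.eval E σ ∧ (∀ r < T, s'.reg r = s.reg r) := by
  have hbd := hB.bound
  induction e with
  | lit k =>
    intro T s hT hok h
    refine ⟨_, exec_instr_of_eq (le_trans hok hbd) rfl, h.setTemp hT (le_trans hok hbd), ?_, ?_⟩
    · simp [Instr.apply, Store.setReg, Instr.value, Ex.eval]
    · intro r hr
      simp [Instr.apply, Store.setReg, hr.ne]
  | var r =>
    intro T s hT hok h
    refine ⟨_, exec_instr_of_eq (h.reg_le _) rfl, h.setTemp hT (h.reg_le _), ?_, ?_⟩
    · simp [Instr.apply, Store.setReg, Instr.value, Ex.eval, h.reg]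
    · intro r hr
      simp [Instr.apply, Store.setReg, hr.ne]
  | add e f ihe ihf =>
    intro T s hT hok h
    obtain ⟨he, hf, hle⟩ := hok
    obtain ⟨s₁, x₁, r₁, v₁, f₁⟩ := ihe hT he h
    obtain ⟨s₂, x₂, r₂, v₂, f₂⟩ := ihf (T := T + 1) (by omega) hf r₁
    have hv : (Instr.add T T (T + 1)).value s₂ = e.eval E σ + f.eval E σ := by
      simp [Instr.value, f₂ T (by omega), v₁, v₂]
    refine ⟨_, .seq (.seq x₁ x₂) (exec_instr_of_eq (hv ▸ hle.trans hbd) rfl),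
      r₂.setTemp hT (hv ▸ hle.trans hbd), ?_, ?_⟩
    · simp [Instr.apply, Store.setReg, hv, Ex.eval]
    · intro r hr
      simp [Instr.apply, Store.setReg, hr.ne, f₂ r (by omega), f₁ r hr]
  | sub e f ihe ihf =>
    intro T s hT hok h
    obtain ⟨he, hf⟩ := hok
    obtain ⟨s₁, x₁, r₁, v₁, f₁⟩ := ihe hT he h
    obtain ⟨s₂, x₂, r₂, v₂, f₂⟩ := ihf (T := T + 1) (by omega) hf r₁
    have hv : (Instr.sub T T (T + 1)).value s₂ = e.eval E σ - f.eval E σ := by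
      simp [Instr.value, f₂ T (by omega), v₁, v₂]
    have hle : (Instr.sub T T (T + 1)).value s₂ ≤ B := le_trans (Nat.sub_le _ _) (r₂.reg_le T)
    refine ⟨_, .seq (.seq x₁ x₂) (exec_instr_of_eq hle rfl), r₂.setTemp hT hle, ?_, ?_⟩
    · simp [Instr.apply, Store.setReg, hv, Ex.eval]
    · intro r hr
      simp [Instr.apply, Store.setReg, hr.ne, f₂ r (by omega), f₁ r hr]
  | mul e f ihe ihf =>
    intro T s hT hok h
    obtain ⟨he, hf, hle⟩ := hok
    obtain ⟨s₁, x₁, r₁, v₁, f₁⟩ := ihe hT he h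
    obtain ⟨s₂, x₂, r₂, v₂, f₂⟩ := ihf (T := T + 1) (by omega) hf r₁
    have hv : (Instr.mul T T (T + 1)).value s₂ = e.eval E σ * f.eval E σ := by
      simp [Instr.value, f₂ T (by omega), v₁, v₂]
    refine ⟨_, .seq (.seq x₁ x₂) (exec_instr_of_eq (hv ▸ hle.trans hbd) rfl),
      r₂.setTemp hT (hv ▸ hle.trans hbd), ?_, ?_⟩
    · simp [Instr.apply, Store.setReg, hv, Ex.eval]
    · intro r hr
      simp [Instr.apply, Store.setReg, hr.ne, f₂ r (by omega), f₁ r hr]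
  | inp e ihe =>
    intro T s hT hok h
    obtain ⟨he, hlt⟩ := hok
    obtain ⟨s₁, x₁, r₁, v₁, f₁⟩ := ihe hT he h
    refine ⟨_, .seq x₁ (exec_instr_of_eq (r₁.mem_le _) rfl), r₁.setTemp hT (r₁.mem_le _), ?_, ?_⟩
    · simp [Instr.apply, Store.setReg, Instr.value, v₁, r₁.inp _ hlt, Ex.eval]
    · intro r hr
      simp [Instr.apply, Store.setReg, hr.ne, f₁ r hr]
  | arr j e ihe =>
    intro T s hT hok h
    obtain ⟨he, hlt⟩ := hok
    obtain ⟨s₁, x₁, r₁, v₁, f₁⟩ := ihe hT he h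
    obtain ⟨s₂, x₂, r₂, v₂, f₂⟩ := exec_address hB r₁ j hT (v₁ ▸ hlt)
    refine ⟨_, .seq x₁ (.seq x₂ (exec_instr_of_eq (i := .load T T) (r₂.mem_le _) rfl)),
      r₂.setTemp hT (r₂.mem_le _), ?_, ?_⟩
    · simp [Instr.apply, Store.setReg, Instr.value, v₂, v₁, r₂.arr, Ex.eval]
    · intro r hr
      simp [Instr.apply, Store.setReg, hr.ne, f₂ r hr, f₁ r hr]

theorem Cond.exec_compile (hB : E.Fits B) {σ : St} (c : Cond) {s : Store} (hc : c.Ok E σ)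
    (h : Rel E B σ s) : ∃ s', Exec B c.compile s c.cost s' ∧ Rel E B σ s' ∧
      (c.test.Holds s' ↔ c.Holds E σ) := by
  rcases c with ⟨e, f⟩ | ⟨e, f⟩
  all_goals
    obtain ⟨he, hf⟩ := hc
    obtain ⟨s₁, x₁, r₁, v₁, f₁⟩ := e.exec_compile hB (T := 50) le_rfl he h
    obtain ⟨s₂, x₂, r₂, v₂, f₂⟩ := f.exec_compile hB (T := 51) (by omega) hf r₁
    exact ⟨_, .seq x₁ x₂, r₂, by
      simp [Cond.test, Test.Holds, Cond.Holds, v₂, f₂ 50 (by omega), v₁]⟩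

/-- The machine program of a command does what the command does, in the same time. -/
theorem Cmd.Run.exec_compile (hB : E.Fits B) {P : Cmd} {σ σ' : St} {t : ℕ} (hP : P.Run E σ t σ') :
    ∀ {s : Store}, Rel E B σ s → ∃ s', Exec B P.compile s t s' ∧ Rel E B σ' s' := by
  induction hP with
  | @set r e σ he =>
    intro s h
    obtain ⟨s₁, x₁, r₁, v₁, -⟩ := e.exec_compile hB (T := 50) le_rfl he h
    refine ⟨_, .seq x₁ (exec_instr_of_eq (r₁.reg_le _) rfl), ?_⟩
    have := r₁.setVar r (r₁.reg_le 50)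
    rw [v₁] at this
    simpa only [Instr.apply, Instr.value, v₁] using this
  | @put j e f σ he hf hlt =>
    intro s h
    obtain ⟨s₁, x₁, r₁, v₁, -⟩ := e.exec_compile hB (T := 50) le_rfl he h
    obtain ⟨s₂, x₂, r₂, v₂, -⟩ := Ex.exec_address hB r₁ j (T := 50) le_rfl (v₁ ▸ hlt)
    obtain ⟨s₃, x₃, r₃, v₃, f₃⟩ := f.exec_compile hB (T := 51) (by omega) hf r₂
    have hx := Exec.seq (.seq x₁ x₂) (.seq x₃ (exec_instr_of_eq (i := .store 50 51)
      (r₃.reg_le _) rfl))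
    refine ⟨_, ?_, r₃.setArr j (e.eval E σ) (v := f.eval E σ) (v₃ ▸ r₃.reg_le _)⟩
    rw [show e.cost + f.cost + 6 = e.cost + 5 + (f.cost + 1) by omega]
    simp only [Instr.apply, Instr.value, f₃ 50 (by omega), v₂, v₁, v₃] at hx
    exact hx
  | seq _ _ ih₁ ih₂ =>
    intro s h
    obtain ⟨s₁, x₁, r₁⟩ := ih₁ h
    obtain ⟨s₂, x₂, r₂⟩ := ih₂ r₁
    exact ⟨s₂, .seq x₁ x₂, r₂⟩
  | @ite_true c P Q σ σ' t hc hh _ ih =>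
    intro s h
    obtain ⟨s₁, x₁, r₁, t₁⟩ := c.exec_compile hB hc h
    obtain ⟨s₂, x₂, r₂⟩ := ih r₁
    refine ⟨s₂, ?_, r₂⟩
    rw [show c.cost + 1 + t = c.cost + (t + 1) by omega]
    exact .seq x₁ (.ite_true (t₁.2 hh) x₂)
  | @ite_false c P Q σ σ' t hc hh _ ih =>
    intro s h
    obtain ⟨s₁, x₁, r₁, t₁⟩ := c.exec_compile hB hc h
    obtain ⟨s₂, x₂, r₂⟩ := ih r₁
    refine ⟨s₂, ?_, r₂⟩
    rw [show c.cost + 1 + t = c.cost + (t + 1) by omega]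
    exact .seq x₁ (.ite_false (t₁.not.2 hh) x₂)
  | skip =>
    intro s h
    exact ⟨_, .instr (Nat.zero_le _), h.setTemp le_rfl (Nat.zero_le _)⟩
  | @loop_true c P σ σ' σ'' t t' hc hh _ _ ih₁ ih₂ =>
    intro s h
    obtain ⟨s₁, x₁, r₁, t₁⟩ := c.exec_compile hB hc h
    obtain ⟨s₂, x₂, r₂⟩ := ih₁ r₁
    obtain ⟨s₃, x₃, r₃⟩ := ih₂ r₂
    refine ⟨s₃, ?_, r₃⟩
    -- The machine reevaluates the condition at the end of the loop body, whereas the remaining loop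
    -- of the source starts with it. The run is therefore split and its first piece moved into the
    -- body.
    cases x₃ with
    | @seq _ _ _ s₄ _ u u' y₁ y₂ =>
      rw [show c.cost + 1 + t + (u + u') = c.cost + (t + u + u' + 1) by omega]
      exact .seq x₁ (.while_true (t₁.2 hh) (.seq x₂ y₁) y₂)
  | @loop_false c P σ hc hh =>
    intro s h
    obtain ⟨s₁, x₁, r₁, t₁⟩ := c.exec_compile hB hc h
    exact ⟨s₁, .seq x₁ (.while_false (t₁.not.2 hh)), r₁⟩

/-! #### Weakest preconditions -/

/-- The command `P`, started at time `t` in `σ`, halts at a time and in a state with `Q`. -/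
def WP (E : Env) (P : Cmd) (Q : ℕ → St → Prop) (t : ℕ) (σ : St) : Prop :=
  ∃ t' σ', P.Run E σ t' σ' ∧ Q (t + t') σ'

variable {Q : ℕ → St → Prop} {t : ℕ} {σ : St}

/-- This and the next rules are equivalences so that rewriting with them executes a program
symbolically, with the elapsed time as part of the state. -/
theorem wp_set {r : Var} {e : Ex} :
    WP E (r ::= e) Q t σ ↔ e.Ok E σ ∧ Q (t + (e.cost + 1)) (σ.set r (e.eval E σ)) := by
  constructor
  · rintro ⟨_, _, ⟨h⟩, hQ⟩
    exact ⟨h, hQ⟩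
  · rintro ⟨h, hQ⟩
    exact ⟨_, _, .set h, hQ⟩

theorem wp_put {j : Arr} {e f : Ex} :
    WP E (.put j e f) Q t σ ↔ (e.Ok E σ ∧ f.Ok E σ ∧ e.eval E σ < E.size) ∧
      Q (t + (e.cost + f.cost + 6)) (σ.put j (e.eval E σ) (f.eval E σ)) := by
  constructor
  · rintro ⟨_, _, h, hQ⟩
    cases h with
    | put h₁ h₂ h₃ => exact ⟨⟨h₁, h₂, h₃⟩, hQ⟩
  · rintro ⟨⟨h₁, h₂, h₃⟩, hQ⟩
    exact ⟨_, _, .put h₁ h₂ h₃, hQ⟩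

theorem wp_skip : WP E .skip Q t σ ↔ Q (t + 1) σ := by
  constructor
  · rintro ⟨_, _, ⟨⟩, hQ⟩
    exact hQ
  · intro hQ
    exact ⟨_, _, .skip, hQ⟩

theorem wp_seq {P P' : Cmd} : WP E (P ;; P') Q t σ ↔ WP E P (WP E P' Q) t σ := by
  constructor
  · rintro ⟨_, _, h, hQ⟩
    cases h with
    | seq h₁ h₂ => exact ⟨_, _, h₁, _, _, h₂, by rwa [add_assoc]⟩
  · rintro ⟨_, _, h₁, _, _, h₂, hQ⟩
    exact ⟨_, _, .seq h₁ h₂, by rwa [← add_assoc]⟩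

theorem wp_ite {c : Cond} {P P' : Cmd} : WP E (.ite c P P') Q t σ ↔
    c.Ok E σ ∧ (c.Holds E σ → WP E P Q (t + (c.cost + 1)) σ) ∧
      (¬ c.Holds E σ → WP E P' Q (t + (c.cost + 1)) σ) := by
  constructor
  · rintro ⟨_, _, h, hQ⟩
    cases h with
    | ite_true hc h hP =>
      exact ⟨hc, fun _ => ⟨_, _, hP, by rwa [add_assoc]⟩, fun h' => (h' h).elim⟩
    | ite_false hc h hP =>
      exact ⟨hc, fun h' => (h h').elim, fun _ => ⟨_, _, hP, by rwa [add_assoc]⟩⟩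
  · rintro ⟨hc, h₁, h₂⟩
    by_cases h : c.Holds E σ
    · obtain ⟨_, _, hP, hQ⟩ := h₁ h
      exact ⟨_, _, .ite_true hc h hP, by rwa [← add_assoc]⟩
    · obtain ⟨_, _, hP, hQ⟩ := h₂ h
      exact ⟨_, _, .ite_false hc h hP, by rwa [← add_assoc]⟩

theorem WP.mono {P : Cmd} {Q' : ℕ → St → Prop} (h : WP E P Q t σ)
    (hQ : ∀ t' σ', Q t' σ' → Q' t' σ') : WP E P Q' t σ := by
  obtain ⟨t', σ', hP, h'⟩ := h
  exact ⟨t', σ', hP, hQ _ _ h'⟩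

/-! ### Frame conditions read off the syntax -/

/-- The command can write the register. -/
def Cmd.WritesReg : Cmd → Var → Bool
  | set r _, r' => decide (r' = r)
  | put _ _ _, _ => false
  | seq P Q, r => P.WritesReg r || Q.WritesReg r
  | ite _ P Q, r => P.WritesReg r || Q.WritesReg r
  | skip, _ => false
  | loop _ P, r => P.WritesReg r

/-- The command can write the array. -/
def Cmd.WritesArr : Cmd → Arr → Bool
  | set _ _, _ => false
  | put j _ _, j' => decide (j' = j)
  | seq P Q, r => P.WritesArr r || Q.WritesArr r
  | ite _ P Q, r => P.WritesArr r || Q.WritesArr r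
  | skip, _ => false
  | loop _ P, r => P.WritesArr r

/-- `σ` and `σ'` agree on everything that `P` does not write. -/
structure Frame (P : Cmd) (σ σ' : St) : Prop where
  reg : ∀ r, P.WritesReg r = false → σ'.reg r = σ.reg r
  arr : ∀ j, P.WritesArr j = false → σ'.arr j = σ.arr j

theorem Frame.refl (P : Cmd) (σ : St) : Frame P σ σ := ⟨fun _ _ => rfl, fun _ _ => rfl⟩

theorem Frame.trans {P : Cmd} {σ σ' σ'' : St} (h : Frame P σ σ') (h' : Frame P σ' σ'') :
    Frame P σ σ'' :=
  ⟨fun r hr => (h'.reg r hr).trans (h.reg r hr), fun r hr => (h'.arr r hr).trans (h.arr r hr)⟩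

theorem Cmd.Run.frame {P : Cmd} {σ σ' : St} {t : ℕ} (h : P.Run E σ t σ') : Frame P σ σ' := by
  induction h with
  | set _ => exact ⟨fun r hr => by simp_all [WritesReg], fun _ _ => rfl⟩
  | put _ _ _ => exact ⟨fun _ _ => rfl, fun r hr => by simp_all [WritesArr]⟩
  | seq _ _ h₁ h₂ =>
    constructor
    · intro r hr
      simp only [WritesReg, Bool.or_eq_false_iff] at hr
      rw [h₂.reg r hr.2, h₁.reg r hr.1]
    · intro r hr
      simp only [WritesArr, Bool.or_eq_false_iff] at hr
      rw [h₂.arr r hr.2, h₁.arr r hr.1]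
  | ite_true _ _ _ h =>
    constructor
    · intro r hr
      simp only [WritesReg, Bool.or_eq_false_iff] at hr
      exact h.reg r hr.1
    · intro r hr
      simp only [WritesArr, Bool.or_eq_false_iff] at hr
      exact h.arr r hr.1
  | ite_false _ _ _ h =>
    constructor
    · intro r hr
      simp only [WritesReg, Bool.or_eq_false_iff] at hr
      exact h.reg r hr.2
    · intro r hr
      simp only [WritesArr, Bool.or_eq_false_iff] at hr
      exact h.arr r hr.2
  | skip => exact .refl _ _
  | loop_true _ _ _ _ h₁ h₂ =>
    exact ⟨fun r hr => (h₂.reg r hr).trans (h₁.reg r hr),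
      fun r hr => (h₂.arr r hr).trans (h₁.arr r hr)⟩
  | loop_false _ _ => exact .refl _ _

/-- Specifications need to mention only what a command changes. Since the written names are computed
from the syntax, preservation of any other register or array is proved by `rfl`. -/
theorem WP.frame {P : Cmd} (h : WP E P Q t σ) :
    WP E P (fun t' σ' => Q t' σ' ∧ Frame P σ σ') t σ := by
  obtain ⟨t', σ', hP, h'⟩ := h
  exact ⟨t', σ', hP, h', hP.frame⟩

/-- The rule for loops: an invariant `I`, indexed by a number that every round decreases. -/
theorem wp_loop {c : Cond} {P : Cmd} (I : ℕ → ℕ → St → Prop) (fuel : ℕ) (h₀ : I fuel t σ)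
    (step : ∀ f t' σ', Frame P σ σ' → I f t' σ' → c.Ok E σ' ∧
      (c.Holds E σ' → WP E P (fun t'' σ'' => ∃ f' < f, I f' t'' σ'') (t' + (c.cost + 1)) σ') ∧
      (¬ c.Holds E σ' → Q (t' + (c.cost + 1)) σ')) :
    WP E (.loop c P) Q t σ := by
  suffices H : ∀ f t' σ', Frame P σ σ' → I f t' σ' → WP E (.loop c P) Q t' σ' from
    H fuel t σ (.refl _ _) h₀
  intro f
  induction f using Nat.strong_induction_on with
  | _ f ih =>
    intro t' σ' hf hI
    obtain ⟨hc, h₁, h₂⟩ := step f t' σ' hf hI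
    by_cases h : c.Holds E σ'
    · obtain ⟨u, σ₁, hP, f', hf', hI'⟩ := h₁ h
      obtain ⟨u', σ₂, hW, hQ⟩ := ih f' hf' _ _ (hf.trans hP.frame) hI'
      exact ⟨_, _, .loop_true hc h hP hW, by simpa only [add_assoc] using hQ⟩
    · exact ⟨_, _, .loop_false hc h, h₂ h⟩

@[simp] theorem Cond.holds_lt {e f : Ex} :
    (Cond.lt e f).Holds E σ ↔ e.eval E σ < f.eval E σ := Iff.rfl
@[simp] theorem Cond.holds_eq {e f : Ex} :
    (Cond.eq e f).Holds E σ ↔ e.eval E σ = f.eval E σ := Iff.rfl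
@[simp] theorem Cond.ok_lt {e f : Ex} : (Cond.lt e f).Ok E σ ↔ e.Ok E σ ∧ f.Ok E σ := Iff.rfl
@[simp] theorem Cond.ok_eq {e f : Ex} : (Cond.eq e f).Ok E σ ↔ e.Ok E σ ∧ f.Ok E σ := Iff.rfl
@[simp] theorem Cond.cost_lt {e f : Ex} : (Cond.lt e f).cost = e.cost + f.cost := rfl
@[simp] theorem Cond.cost_eq {e f : Ex} : (Cond.eq e f).cost = e.cost + f.cost := rfl

/-! ### Implication graphs -/

/-- The negation of a literal. -/
def negl (l : ℕ) : ℕ := l + 1 - 2 * (l % 2)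

theorem negl_negl (l : ℕ) : negl (negl l) = l := by unfold negl; omega

theorem negl_ne (l : ℕ) : negl l ≠ l := by unfold negl; omega

theorem negl_lt {l n : ℕ} (h : l < 2 * n) : negl l < 2 * n := by unfold negl; omega

/-- An implication graph on the literals of `n` variables, closed under contraposition. -/
structure IsImplicationGraph (n : ℕ) (adj : ℕ → List ℕ) : Prop where
  lt : ∀ l < 2 * n, ∀ x ∈ adj l, x < 2 * n
  symm : ∀ l < 2 * n, ∀ x ∈ adj l, negl l ∈ adj (negl x)

/-- The set `f` of true literals is given by a truth assignment and respects all implications. -/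
structure Respects (n : ℕ) (adj : ℕ → List ℕ) (f : ℕ → Prop) : Prop where
  neg : ∀ l < 2 * n, (f (negl l) ↔ ¬ f l)
  adj : ∀ l < 2 * n, f l → ∀ x ∈ adj l, f x

/-- The linked list that starts at `p` holds the entries `l`. -/
def Chain (next tgt : ℕ → ℕ) (e : ℕ) : ℕ → List ℕ → Prop
  | p, [] => p = 0
  | p, x :: l => p ≠ 0 ∧ p ≤ e ∧ tgt p = x ∧ Chain next tgt e (next p) l

/-- A partial assignment `V` together with the stamp `s` of the current propagations. -/
structure Search where
  n : ℕ
  adj : ℕ → List ℕ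
  next : ℕ → ℕ
  tgt : ℕ → ℕ
  e : ℕ
  V : ℕ → Prop
  s : ℕ

/-- The implications form a graph in which `V` is closed. -/
structure Search.Valid (S : Search) : Prop where
  graph : IsImplicationGraph S.n S.adj
  closed : ∀ l < 2 * S.n, S.V l → ∀ x ∈ S.adj l, S.V x

/-- No assignment that extends `V` makes `root` true. -/
def Search.Refuted (S : Search) (root : ℕ) : Prop :=
  ∀ f, Respects S.n S.adj f → (∀ l < 2 * S.n, S.V l → f l) → ¬ f root

/-- The weight of a literal. -/
def Search.wt (S : Search) (l : ℕ) : ℕ := (S.adj l).length + 1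

/-- A propagation from `root` after `k` rounds: `ql` is the list of the literals reached, the
first `h` of them have been expanded, up to the edges to `rem`. -/
structure Running (S : Search) (root k : ℕ) (ql rem : List ℕ) (h q ep : ℕ) (mk qu : ℕ → ℕ) :
    Prop where
  q_eq : q = ql.length
  h_le : h ≤ ql.length
  queue : ∀ i (hi : i < ql.length), qu i = ql[i]
  nodup : ql.Nodup
  lt : ∀ l ∈ ql, l < 2 * S.n
  new : ∀ l ∈ ql, ¬ S.V l ∧ ¬ S.V (negl l)
  mark : ∀ l < 2 * S.n, mk l = S.s ↔ l ∈ ql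
  consistent : ∀ l ∈ ql, negl l ∉ ql
  chain : Chain S.next S.tgt S.e ep rem
  rem_adj : ∀ x ∈ rem, ∃ l ∈ ql, x ∈ S.adj l
  closed : ∀ l ∈ ql.take h, ∀ x ∈ S.adj l, S.V x ∨ x ∈ ql ∨ x ∈ rem
  forced : ∀ f, Respects S.n S.adj f → (∀ l < 2 * S.n, S.V l → f l) → f root → ∀ l ∈ ql, f l
  work : k + rem.length = ((ql.take h).map S.wt).sum
  root_mem : root ∈ ql

section
variable {S : Search} {root k : ℕ} {ql rem : List ℕ} {h q ep : ℕ} {mk qu : ℕ → ℕ}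

/-- Expanding a literal takes one round and puts its out-edges on the agenda, which together is
exactly its weight. This keeps the equation `work` exact. -/
theorem Running.expand (hR : Running S root k ql [] h q ep mk qu)
    (hh : h < ql.length) {ep' : ℕ} (hc : Chain S.next S.tgt S.e ep' (S.adj ql[h])) :
    Running S root (k + 1) ql (S.adj ql[h]) (h + 1) q ep' mk qu :=
  { hR with
    h_le := hh
    chain := hc
    rem_adj := fun x hx => ⟨_, List.getElem_mem hh, hx⟩
    closed := by
      intro l hl x hx
      rw [List.take_add_one, List.getElem?_eq_getElem hh] at hl
      simp only [Option.toList_some, List.mem_append, List.mem_singleton] at hl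
      rcases hl with hl | rfl
      · have := hR.closed l hl x hx
        simp only [List.not_mem_nil, or_false] at this
        tauto
      · exact .inr (.inr hx)
    work := by
      have := hR.work
      rw [List.take_add_one, List.getElem?_eq_getElem hh]
      simp only [List.length_nil, Option.toList_some, List.map_append, List.map_cons, List.map_nil,
        List.sum_append, List.sum_cons, List.sum_nil, Search.wt] at this ⊢
      omega }

theorem Running.skip {x : ℕ} (hR : Running S root k ql (x :: rem) h q ep mk qu)
    (hx : S.V x ∨ x ∈ ql) : Running S root (k + 1) ql rem h q (S.next ep) mk qu :=
  { hR with
    chain := hR.chain.2.2.2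
    rem_adj := fun y hy => hR.rem_adj y (List.mem_cons_of_mem _ hy)
    closed := by
      intro l hl y hy
      rcases hR.closed l hl y hy with h | h | h
      · exact .inl h
      · exact .inr (.inl h)
      · rcases List.mem_cons.1 h with rfl | h
        · tauto
        · exact .inr (.inr h)
    work := by
      have := hR.work
      simp only [List.length_cons] at this
      omega }

theorem Running.push (hS : S.Valid) {x : ℕ} (hR : Running S root k ql (x :: rem) h q ep mk qu)
    (hV : ¬ S.V x) (hn : negl x ∉ ql) (hx : x ∉ ql) :
    Running S root (k + 1) (ql ++ [x]) rem h (q + 1) (S.next ep) (Function.update mk x S.s)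
      (Function.update qu q x) := by
  obtain ⟨l₀, hl₀, hxl₀⟩ := hR.rem_adj x (by simp)
  have hx2 : x < 2 * S.n := hS.graph.lt l₀ (hR.lt _ hl₀) x hxl₀
  have htake : (ql ++ [x]).take h = ql.take h := List.take_append_of_le_length hR.h_le
  exact {
    q_eq := by simp [hR.q_eq]
    h_le := by have := hR.h_le; simp; omega
    queue := by
      intro i hi
      rw [List.getElem_append]
      split_ifs with h'
      · rw [Function.update_of_ne (by have := hR.q_eq; omega), hR.queue i h']
      · have : i = q := by
          have := hR.q_eq
          simp at hi
          omega
        simp [this]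
    nodup := by
      rw [List.nodup_append]
      exact ⟨hR.nodup, by simp, by rintro a ha b hb rfl; simp at hb; exact hx (hb ▸ ha)⟩
    lt := by
      intro l hl
      rcases List.mem_append.1 hl with hl | hl
      · exact hR.lt l hl
      · rw [List.mem_singleton.1 hl]; exact hx2
    new := by
      intro l hl
      rcases List.mem_append.1 hl with hl | hl
      · exact hR.new l hl
      · rw [List.mem_singleton.1 hl]
        -- Contraposition of the edge from `l₀` to `x`: if the negation of `x` were already true,
        -- closedness of `V` would make the negation of `l₀` true. Hence the program never has to
        -- test this.
        refine ⟨hV, fun hVn => (hR.new l₀ hl₀).2 ?_⟩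
        exact hS.closed _ (negl_lt hx2) hVn _ (hS.graph.symm _ (hR.lt _ hl₀) _ hxl₀)
    mark := by
      intro l hl
      by_cases hlx : l = x
      · simp [hlx]
      · rw [Function.update_of_ne hlx, hR.mark l hl]
        simp [hlx]
    consistent := by
      intro l hl hn'
      rcases List.mem_append.1 hl with hl | hl <;> rcases List.mem_append.1 hn' with hn' | hn'
      · exact hR.consistent l hl hn'
      · rw [← List.mem_singleton.1 hn', negl_negl] at hn
        exact hn hl
      · rw [List.mem_singleton.1 hl] at hn'
        exact hn hn'
      · rw [List.mem_singleton.1 hl] at hn'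
        exact negl_ne x (List.mem_singleton.1 hn')
    chain := hR.chain.2.2.2
    rem_adj := by
      intro y hy
      obtain ⟨l, hl, hyl⟩ := hR.rem_adj y (List.mem_cons_of_mem _ hy)
      exact ⟨l, List.mem_append_left _ hl, hyl⟩
    closed := by
      intro l hl y hy
      rw [htake] at hl
      rcases hR.closed l hl y hy with h | h | h
      · exact .inl h
      · exact .inr (.inl (List.mem_append_left _ h))
      · rcases List.mem_cons.1 h with rfl | h
        · simp
        · exact .inr (.inr h)
    forced := by
      intro f hf hfV hr l hl
      rcases List.mem_append.1 hl with hl | hl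
      · exact hR.forced f hf hfV hr l hl
      · rw [List.mem_singleton.1 hl]
        exact hf.adj l₀ (hR.lt _ hl₀) (hR.forced f hf hfV hr _ hl₀) x hxl₀
    work := by
      have := hR.work
      simp only [List.length_cons] at this
      rw [htake]
      omega
    root_mem := List.mem_append_left _ hR.root_mem }

/-- Every reached literal and every target of a pending edge is forced by `root`, so here a literal
and its negation are both forced. -/
theorem Running.refuted (hS : S.Valid) {x : ℕ} (hR : Running S root k ql (x :: rem) h q ep mk qu)
    (hn : negl x ∈ ql) : S.Refuted root := by
  intro f hf hfV hr
  obtain ⟨l₀, hl₀, hxl₀⟩ := hR.rem_adj x (by simp)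
  have hx2 : x < 2 * S.n := hS.graph.lt l₀ (hR.lt _ hl₀) x hxl₀
  have h1 := hf.adj l₀ (hR.lt _ hl₀) (hR.forced f hf hfV hr _ hl₀) x hxl₀
  exact (hf.neg x hx2).1 (hR.forced f hf hfV hr _ hn) h1

theorem Running.length_le (hR : Running S root k ql rem h q ep mk qu) : ql.length ≤ 2 * S.n := by
  have h1 : ql.toFinset ⊆ Finset.range (2 * S.n) := by
    intro l hl
    simpa using hR.lt l (by simpa using hl)
  have h2 := Finset.card_le_card h1
  rwa [List.toFinset_card_of_nodup hR.nodup, Finset.card_range] at h2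

end

/-! ### Unit propagation, one edge at a time -/

/-- A propagation after `k` rounds: it is running, or has met a contradiction, or is complete. -/
def Proc (S : Search) (root k : ℕ) (w : Bool) (σ : St) : Prop :=
  (∀ l < 2 * S.n, σ.arr (.mark w) l ≤ S.s) ∧
  ((σ.reg (.st w) = 0 ∧ ∃ ql rem, Running S root k ql rem (σ.reg (.h w)) (σ.reg (.q w))
    (σ.reg (.ep w)) (σ.arr (.mark w)) (σ.arr (.queue w))) ∨
  (σ.reg (.st w) = 1 ∧ S.Refuted root) ∨
  (σ.reg (.st w) = 2 ∧ ∃ ql k', k = k' + 1 ∧ Running S root k' ql [] ql.length (σ.reg (.q w))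
    (σ.reg (.ep w)) (σ.arr (.mark w)) (σ.arr (.queue w))))

/-- One round of the propagation `w`. -/
def probe (w : Bool) : Cmd :=
  .ite (.eq (Var.st w) 0)
    (.ite (.eq (Var.ep w) 0)
      (.ite (.lt (Var.h w) (Var.q w))
        (.ep w ::= .arr .head (.arr (.queue w) (Var.h w)) ;;
          .h w ::= Var.h w + 1)
        (.st w ::= 2))
      (.x ::= .arr .tgt (Var.ep w) ;;
        .ep w ::= .arr .next (Var.ep w) ;;
        .ite (.eq (.arr .val Var.x) 0)
          (.ite (.eq (.arr (.mark w) (.arr .neg Var.x)) Var.s)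
            (.st w ::= 1)
            (.ite (.eq (.arr (.mark w) Var.x) Var.s)
              .skip
              (.put (.mark w) Var.x Var.s ;;
                .put (.queue w) (Var.q w) Var.x ;;
                .q w ::= Var.q w + 1)))
          .skip))
    .skip

/-- The state holds the search `S`. -/
structure Holds (E : Env) (S : Search) (σ : St) : Prop where
  n : σ.reg .n = S.n
  s : σ.reg .s = S.s
  neg : ∀ l < 2 * S.n, σ.arr .neg l = negl l
  head : ∀ l < 2 * S.n, Chain S.next S.tgt S.e (σ.arr .head l) (S.adj l)
  next : σ.arr .next = S.next
  tgt : σ.arr .tgt = S.tgt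
  val : ∀ l < 2 * S.n, σ.arr .val l = 0 ∧ ¬ S.V l ∨ σ.arr .val l = 1 ∧ S.V l
  bound : E.size ≤ E.bound
  n_lt : 2 * S.n + 4 < E.size
  e_lt : S.e < E.size

theorem probe_spec {E : Env} {S : Search} (hS : S.Valid) {w : Bool} {root k t : ℕ} {σ : St}
    (hσ : Holds E S σ) (hst : σ.reg (.st w) < 2) (hP : Proc S root k w σ) {Q : ℕ → St → Prop}
    (hQ : ∀ t' σ', t' ≤ t + 100 → Proc S root (k + 1) w σ' → Frame (probe w) σ σ' → Q t' σ') :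
    WP E (probe w) Q t σ := by
  refine WP.mono (Q := fun t' σ' => (t' ≤ t + 100 ∧ Proc S root (k + 1) w σ') ∧
    Frame (probe w) σ σ') (WP.frame ?_) fun t' σ' h => hQ t' σ' h.1.1 h.1.2 h.2
  have hb := hσ.bound
  have hn := hσ.n_lt
  have he := hσ.e_lt
  have hs := hσ.s
  obtain ⟨hM, hP⟩ := hP
  rcases hP with ⟨h0, ql, rem, hR⟩ | ⟨h1, hR⟩ | ⟨h2, _⟩
  · have hql := hR.length_le
    have hhl := hR.h_le
    have hq := hR.q_eq
    rcases rem with _ | ⟨x, rem⟩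
    · have hep : σ.reg (.ep w) = 0 := hR.chain
      by_cases hlt : σ.reg (.h w) < ql.length
      · have hx := hR.lt _ (List.getElem_mem hlt)
        have hqu := hR.queue _ hlt
        have := hR.expand hlt (hσ.head _ hx)
        simp [probe, wp_set, wp_put, wp_seq, wp_ite, wp_skip, h0, hep, hq, hlt, Proc, hqu]
        exact ⟨by omega, by omega, hM, _, _, hq ▸ this⟩
      -- Queue and agenda are both exhausted. This round only detects completion and does no work,
      -- which explains `k = k' + 1` in `Proc`.
      · have : σ.reg (.h w) = ql.length := by omega
        rw [this] at hR
        simp [probe, wp_set, wp_put, wp_seq, wp_ite, wp_skip, h0, hep, hq, hlt, Proc]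
        exact ⟨by omega, hM, _, by rwa [hep, hq] at hR⟩
    · obtain ⟨hep, hep', htgt, -⟩ := id hR.chain
      obtain ⟨l₀, hl₀, hxl₀⟩ := hR.rem_adj x (by simp)
      have hx : x < 2 * S.n := hS.graph.lt l₀ (hR.lt _ hl₀) x hxl₀
      have hnx := negl_lt hx
      have hqlt : ql.length < E.size := by omega
      simp only [probe, wp_set, wp_put, wp_seq, wp_ite, wp_skip]
      simp [h0, hep, hq, hs, hσ.tgt, hσ.next, htgt, Proc, hσ.neg _ hx,
        hR.mark _ hx, hR.mark _ hnx]
      rcases hσ.val x hx with ⟨hv, hV⟩ | ⟨hv, hV⟩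
      · by_cases h₁ : negl x ∈ ql
        · simp [hv, h₁]
          exact ⟨by omega, by omega, by omega, by omega, hM, hR.refuted hS h₁⟩
        · by_cases h₂ : x ∈ ql
          · simp [hv, h₁, h₂]
            exact ⟨by omega, by omega, by omega, by omega, hM, _, _, hq ▸ hR.skip (.inr h₂)⟩
          · simp [hv, h₁, h₂]
            exact ⟨by omega, by omega, by omega, by omega, by omega, by omega,
              fun l hl => by
                rw [Function.update_apply]
                split_ifs
                exacts [le_rfl, hM l hl], _, _, hq ▸ hR.push hS hV h₁ h₂⟩
      · simp [hv]
        exact ⟨by omega, by omega, hM, _, _, hq ▸ hR.skip (.inl hV)⟩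
  · simp [probe, wp_set, wp_put, wp_seq, wp_ite, wp_skip, h1, Proc]
    exact ⟨hM, hR⟩
  · omega

theorem Proc.congr {S : Search} {root k : ℕ} {w : Bool} {σ σ' : St} (h : Proc S root k w σ)
    (h₁ : σ'.reg (.st w) = σ.reg (.st w)) (h₂ : σ'.reg (.h w) = σ.reg (.h w))
    (h₃ : σ'.reg (.q w) = σ.reg (.q w)) (h₄ : σ'.reg (.ep w) = σ.reg (.ep w))
    (h₅ : σ'.arr (.mark w) = σ.arr (.mark w)) (h₆ : σ'.arr (.queue w) = σ.arr (.queue w)) :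
    Proc S root k w σ' := by
  unfold Proc at *
  rwa [h₁, h₂, h₃, h₄, h₅, h₆]

theorem Holds.congr {E : Env} {S : Search} {σ σ' : St} (h : Holds E S σ)
    (h₁ : σ'.reg .n = σ.reg .n) (h₂ : σ'.reg .s = σ.reg .s) (h₃ : σ'.arr .neg = σ.arr .neg)
    (h₄ : σ'.arr .head = σ.arr .head) (h₅ : σ'.arr .next = σ.arr .next)
    (h₆ : σ'.arr .tgt = σ.arr .tgt) (h₇ : σ'.arr .val = σ.arr .val) : Holds E S σ' := by
  obtain ⟨a1, a2, a3, a4, a5, a6, a7, a8, a9, a10⟩ := h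
  constructor <;> first | assumption | simpa only [h₁, h₂, h₃, h₄, h₅, h₆, h₇]

/-! ### Two propagations in lockstep -/

/-- The propagations from the two literals of a variable in lockstep, until one of them is complete
or both have failed. -/
def race : Cmd :=
  .loop (.lt (Var.st false + Var.st true) 2) (probe false ;; probe true)

open Classical in
/-- The total weight of the literals outside `V`. -/
noncomputable def Search.weight (S : Search) : ℕ :=
  ∑ l ∈ Finset.range (2 * S.n) with ¬ S.V l, S.wt l

theorem Running.sum_le {S : Search} {root k : ℕ} {ql rem : List ℕ} {h q ep : ℕ} {mk qu : ℕ → ℕ}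
    (hR : Running S root k ql rem h q ep mk qu) : (ql.map S.wt).sum ≤ S.weight := by
  classical
  rw [← List.sum_toFinset _ hR.nodup]
  refine Finset.sum_le_sum_of_subset fun l hl => ?_
  rw [List.mem_toFinset] at hl
  simp [hR.lt l hl, (hR.new l hl).1]

/-- Every round is charged to the weight of an expanded literal, and the expanded literals are
distinct and unassigned. -/
theorem Running.round_le {S : Search} {root k : ℕ} {ql rem : List ℕ} {h q ep : ℕ} {mk qu : ℕ → ℕ}
    (hR : Running S root k ql rem h q ep mk qu) : k ≤ S.weight := by
  have h1 := hR.work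
  have h2 := hR.sum_le
  have h3 : ((ql.take h).map S.wt).sum ≤ (ql.map S.wt).sum :=
    ((List.take_sublist h ql).map _).sum_le_sum (by simp)
  omega

theorem race_spec {E : Env} {S : Search} (hS : S.Valid) {root : Bool → ℕ} {t : ℕ} {σ : St}
    (hσ : Holds E S σ) (hP : ∀ w, Proc S (root w) 0 w σ)
    {Q : ℕ → St → Prop}
    (hQ : ∀ k t' σ', t' ≤ t + 210 * k + 10 → k ≤ S.weight + 1 → (∀ w, Proc S (root w) k w σ') →
      2 ≤ σ'.reg (.st false) + σ'.reg (.st true) → Frame race σ σ' → Q t' σ') :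
    WP E race Q t σ := by
  refine WP.mono (Q := fun t' σ' => (∃ k, t' ≤ t + 210 * k + 10 ∧ k ≤ S.weight + 1 ∧
    (∀ w, Proc S (root w) k w σ') ∧ 2 ≤ σ'.reg (.st false) + σ'.reg (.st true)) ∧
    Frame race σ σ') (WP.frame ?_)
    fun t' σ' ⟨⟨k, h1, h2, h3, h4⟩, h5⟩ => hQ k t' σ' h1 h2 h3 h4 h5
  refine wp_loop (fun f t' σ' => ∃ k, f + k = S.weight + 1 ∧ t' ≤ t + 210 * k ∧
    ∀ w, Proc S (root w) k w σ') (S.weight + 1) ⟨0, rfl, le_rfl, hP⟩ ?_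
  rintro f t' σ' hf ⟨k, hk, ht', hP'⟩
  have hb := hσ.bound
  have hn := hσ.n_lt
  have hσ' : Holds E S σ' := hσ.congr (hf.reg _ rfl) (hf.reg _ rfl) (hf.arr _ rfl) (hf.arr _ rfl)
    (hf.arr _ rfl) (hf.arr _ rfl) (hf.arr _ rfl)
  have hst : ∀ w, σ'.reg (.st w) ≤ 2 := fun w => by
    rcases (hP' w).2 with h | h | h <;> omega
  have h1 := hst false
  have h2 := hst true
  simp only [Cond.ok_lt, Ex.ok_add, Ex.ok_var, Ex.ok_lit, Ex.eval_var, Cond.holds_lt, Ex.eval_add,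
    Ex.eval_lit, Cond.cost_lt, Ex.cost_add, Ex.cost_var, Ex.cost_lit, true_and]
  refine ⟨⟨by omega, by omega⟩, fun hlt => ?_, fun hge => ⟨k, by omega, by omega, hP', by omega⟩⟩
  rw [wp_seq]
  -- As the two states sum to less than 2, at least one propagation is still running, and its work
  -- equation bounds the number of rounds.
  have hkw : k ≤ S.weight := by
    rcases (hP' false).2 with ⟨-, ql, rem, h⟩ | h | h
    · exact h.round_le
    · rcases (hP' true).2 with ⟨-, ql, rem, h'⟩ | h' | h'
      · exact h'.round_le
      all_goals omega
    · omega
  refine probe_spec hS hσ' (by omega) (hP' false) fun t₁ σ₁ ht₁ hP₁ hf₁ => ?_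
  have hσ₁ : Holds E S σ₁ := hσ'.congr (hf₁.reg _ rfl) (hf₁.reg _ rfl) (hf₁.arr _ rfl)
    (hf₁.arr _ rfl) (hf₁.arr _ rfl) (hf₁.arr _ rfl) (hf₁.arr _ rfl)
  have hP₁' : Proc S (root true) k true σ₁ := (hP' true).congr (hf₁.reg _ rfl) (hf₁.reg _ rfl)
    (hf₁.reg _ rfl) (hf₁.reg _ rfl) (hf₁.arr _ rfl) (hf₁.arr _ rfl)
  refine probe_spec hS hσ₁ (by rw [hf₁.reg _ rfl]; omega) hP₁' fun t₂ σ₂ ht₂ hP₂ hf₂ => ?_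
  refine ⟨f - 1, by omega, k + 1, by omega, by omega, ?_⟩
  rintro (_ | _)
  · exact hP₁.congr (hf₂.reg _ rfl) (hf₂.reg _ rfl) (hf₂.reg _ rfl) (hf₂.reg _ rfl)
      (hf₂.arr _ rfl) (hf₂.arr _ rfl)
  · exact hP₂

/-! ### Partial assignments that never need to be revised -/

/-- `V` is a partial assignment, closed under implication, that can be extended to a total one
unless there is none at all. -/
structure Search.Partial (S : Search) : Prop extends S.Valid where
  consistent : ∀ l < 2 * S.n, S.V l → ¬ S.V (negl l)
  ext : ∀ f, Respects S.n S.adj f → ∃ f', Respects S.n S.adj f' ∧ ∀ l < 2 * S.n, S.V l → f' l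

/-- Make the literals in `ql` true. -/
def Search.extend (S : Search) (ql : List ℕ) : Search :=
  { S with V := fun l => S.V l ∨ l ∈ ql }

section
variable {S : Search} {root k : ℕ} {ql : List ℕ} {q ep : ℕ} {mk qu : ℕ → ℕ}

/-- No backtracking over completed propagations is needed: the reached set is consistent and closed
under implication, so overwriting a solution by it yields a solution. -/
theorem Running.partial_extend (hS : S.Partial)
    (hR : Running S root k ql [] ql.length q ep mk qu) : (S.extend ql).Partial := by
  have hcl : ∀ l ∈ ql, ∀ x ∈ S.adj l, S.V x ∨ x ∈ ql := by
    intro l hl x hx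
    simpa using hR.closed l (by simpa using hl) x hx
  have hnn : ∀ l, S.V l → l ∉ ql ∧ negl l ∉ ql := fun l hV =>
    ⟨fun h => (hR.new l h).1 hV, fun h => (hR.new _ h).2 (by rwa [negl_negl])⟩
  refine ⟨⟨hS.graph, ?_⟩, ?_, ?_⟩
  · rintro l hl (hV | hq) x hx
    · exact .inl (hS.closed l hl hV x hx)
    · exact hcl l hq x hx
  · rintro l hl (hV | hq) (hV' | hq')
    · exact hS.consistent l hl hV hV'
    · exact (hnn l hV).2 hq'
    · exact (hR.new l hq).2 hV'
    · exact hR.consistent l hq hq'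
  · intro f₀ hf₀
    obtain ⟨f, hf, hfV⟩ := hS.ext f₀ hf₀
    -- The solution `f` overwritten by the literals in `ql`.
    refine ⟨fun l => l ∈ ql ∨ negl l ∉ ql ∧ f l, ⟨?_, ?_⟩, ?_⟩
    · intro l hl
      have := hf.neg l hl
      have h2 := hR.consistent l
      rw [negl_negl]
      tauto
    · rintro l hl (hq | ⟨hn, hfl⟩) x hx
      · rcases hcl l hq x hx with hV | hq'
        · exact .inr ⟨(hnn x hV).2, hfV x (hS.graph.lt l hl x hx) hV⟩
        · exact .inl hq'
      -- An edge from an untouched literal cannot end in a literal falsified by `ql`: its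
      -- contrapositive would start in `ql` and lead to the negation of `l`.
      · refine .inr ⟨fun hnx => ?_, hf.adj l hl hfl x hx⟩
        rcases hcl _ hnx _ (hS.graph.symm l hl x hx) with hV | hq'
        · exact (hf.neg l hl).1 (hfV _ (negl_lt hl) hV) hfl
        · exact hn hq'
    · rintro l hl (hV | hq)
      · exact .inr ⟨(hnn l hV).2, hfV l hl hV⟩
      · exact .inl hq

/-- For a completed propagation the work equation has no pending part, so the number of rounds
equals the weight of the literals that stop being free. This is the amortization behind linear time.
-/
theorem Running.weight_extend (hR : Running S root k ql [] ql.length q ep mk qu) :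
    (S.extend ql).weight + k ≤ S.weight := by
  classical
  have hw : k = (ql.map S.wt).sum := by simpa using hR.work
  rw [hw, ← List.sum_toFinset _ hR.nodup]
  unfold Search.weight
  rw [show (S.extend ql).n = S.n from rfl, show (S.extend ql).wt = S.wt from rfl,
    ← Finset.sum_union]
  · refine Finset.sum_le_sum_of_subset fun l hl => ?_
    simp only [Finset.mem_union, Finset.mem_filter, Finset.mem_range, List.mem_toFinset,
      Search.extend, not_or] at hl ⊢
    rcases hl with hl | hl
    · exact ⟨hl.1, hl.2.1⟩
    · exact ⟨hR.lt l hl, (hR.new l hl).1⟩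
  · rw [Finset.disjoint_left]
    intro l hl
    simp only [Finset.mem_filter, Search.extend, not_or, List.mem_toFinset] at hl ⊢
    exact hl.2.2

/-- Refutation is relative to `V`, but by `ext` any solution gives one extending `V`, and that one
makes `l` or its negation true. -/
theorem Search.Partial.not_respects (hS : S.Partial) {l : ℕ} (hl : l < 2 * S.n)
    (h₁ : S.Refuted l) (h₂ : S.Refuted (negl l)) : ¬ ∃ f, Respects S.n S.adj f := by
  rintro ⟨f₀, hf₀⟩
  obtain ⟨f, hf, hfV⟩ := hS.ext f₀ hf₀
  exact h₂ f hf hfV ((hf.neg l hl).2 (h₁ f hf hfV))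

theorem Search.Partial.respects (hS : S.Partial) (h : ∀ u < S.n, S.V (2 * u) ∨ S.V (2 * u + 1)) :
    Respects S.n S.adj S.V := by
  refine ⟨fun l hl => ⟨fun h1 h2 => hS.consistent l hl h2 h1, fun h1 => ?_⟩, hS.closed⟩
  have hu := h (l / 2) (by omega)
  rcases Nat.mod_two_eq_zero_or_one l with h2 | h2
  · rw [show 2 * (l / 2) = l by omega] at hu
    rw [show negl l = l + 1 by unfold negl; omega]
    tauto
  · rw [show 2 * (l / 2) + 1 = l by omega] at hu
    rw [show negl l = 2 * (l / 2) by unfold negl; omega]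
    tauto

end

/-! ### The linear-time 2-SAT solver -/

/-- Make the literals that the propagation `w` has reached permanently true. -/
def commit (w : Bool) : Cmd :=
  .k ::= 0 ;;
  .loop (.lt Var.k (Var.q w)) (.put .val (.arr (.queue w) Var.k) 1 ;; .k ::= Var.k + 1)

theorem commit_spec {E : Env} {w : Bool} {ql : List ℕ} {t : ℕ} {σ : St}
    (hq : σ.reg (.q w) = ql.length) (hqu : ∀ i (hi : i < ql.length), σ.arr (.queue w) i = ql[i])
    (hlt : ∀ l ∈ ql, l < E.size) (hlen : ql.length < E.size) (hb : E.size ≤ E.bound)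
    {Q : ℕ → St → Prop}
    (hQ : ∀ t' σ', t' ≤ t + 30 * ql.length + 10 →
      σ'.arr .val = (fun l => if l ∈ ql then 1 else σ.arr .val l) →
      Frame (commit w) σ σ' → Q t' σ') : WP E (commit w) Q t σ := by
  refine WP.mono (Q := fun t' σ' => (t' ≤ t + 30 * ql.length + 10 ∧
    σ'.arr .val = (fun l => if l ∈ ql then 1 else σ.arr .val l)) ∧
    Frame (commit w) σ σ') (WP.frame ?_) fun t' σ' ⟨⟨h1, h2⟩, h3⟩ => hQ t' σ' h1 h2 h3
  simp only [commit, wp_seq, wp_set]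
  refine ⟨by simp, wp_loop (fun f t' σ' => f + σ'.reg .k = ql.length ∧
    t' ≤ t + 30 * σ'.reg .k + 2 ∧
    σ'.arr .val = (fun l => if l ∈ ql.take (σ'.reg .k) then 1 else σ.arr .val l))
    ql.length ?_ ?_⟩
  · simp
  · rintro f t' σ' hf ⟨h1, h2, h3⟩
    have hq' : σ'.reg (.q w) = ql.length := (hf.reg _ rfl).trans hq
    have hqu' : σ'.arr (.queue w) = σ.arr (.queue w) := hf.arr _ rfl
    simp [wp_seq, wp_put, wp_set, hq', hqu']
    refine ⟨fun hlt' => ?_, fun hge => ?_⟩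
    · rw [hqu _ hlt']
      have h4 := hlt _ (List.getElem_mem hlt')
      refine ⟨⟨by omega, by omega, h4⟩, ⟨by omega, by omega⟩, f - 1, by omega, by omega, by omega,
        ?_⟩
      rw [h3]
      funext l
      have hm : l ∈ ql.take (σ'.reg .k + 1) ↔ l ∈ ql.take (σ'.reg .k) ∨ l = ql[σ'.reg .k] := by
        rw [List.take_add_one, List.getElem?_eq_getElem hlt']
        simp only [Option.toList_some, List.mem_append, List.mem_singleton]
      simp only [hm, Function.update_apply]
      by_cases hl : l = ql[σ'.reg .k] <;> simp [hl]
    · refine ⟨by omega, ?_⟩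
      rw [h3, List.take_of_length_le hge]

/-- Start the propagation `w` from one of the literals of variable `v`. -/
def start (w : Bool) : Cmd :=
  .x ::= 2 * (Var.v : Ex) + .lit w.toNat ;;
  .put (.mark w) Var.x Var.s ;;
  .put (.queue w) 0 Var.x ;;
  .q w ::= 1 ;;
  .h w ::= 0 ;;
  .ep w ::= 0 ;;
  .st w ::= 0

theorem Running.init {S : Search} {root : ℕ} {mk qu : ℕ → ℕ} (hr : root < 2 * S.n)
    (h₁ : ¬ S.V root) (h₂ : ¬ S.V (negl root)) (hmk : ∀ l < 2 * S.n, mk l ≠ S.s) :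
    Running S root 0 [root] [] 0 1 0 (Function.update mk root S.s) (Function.update qu 0 root) where
  q_eq := rfl
  h_le := by simp
  queue := by simp
  nodup := by simp
  lt := by simpa
  new := by simpa using ⟨h₁, h₂⟩
  mark l hl := by
    by_cases h : l = root
    · simp [h]
    · simp [h, hmk l hl]
  consistent := by simpa using negl_ne root
  chain := rfl
  rem_adj := by simp
  closed := by simp
  forced := by simp
  work := by simp
  root_mem := by simp

/-- Decide the satisfiability of a 2-CNF formula that is given by its implication graph. -/
def solve : Cmd :=
  .sat ::= 1 ;;
  .v ::= 0 ;;
  .loop (.lt Var.v Var.n)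
    (.ite (.eq (.arr .val (2 * (Var.v : Ex)) + .arr .val (2 * (Var.v : Ex) + 1)) 0)
      (.s ::= Var.v + 1 ;;
        start false ;;
        start true ;;
        race ;;
        .ite (.eq (Var.st false) 2) (commit false)
          (.ite (.eq (Var.st true) 2) (commit true) (.sat ::= 0 ;; .v ::= Var.n)))
      .skip ;;
    .v ::= Var.v + 1)

theorem start_spec {E : Env} {w : Bool} {t : ℕ} {σ : St} (hv : 2 * σ.reg .v + 1 < E.size)
    (hb : E.size ≤ E.bound) (h2 : 2 ≤ E.bound) {Q : ℕ → St → Prop}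
    (hQ : ∀ t' σ', t' ≤ t + 60 → σ'.reg (.q w) = 1 → σ'.reg (.h w) = 0 → σ'.reg (.ep w) = 0 →
      σ'.reg (.st w) = 0 →
      σ'.arr (.mark w) =
        Function.update (σ.arr (.mark w)) (2 * σ.reg .v + w.toNat) (σ.reg .s) →
      σ'.arr (.queue w) = Function.update (σ.arr (.queue w)) 0 (2 * σ.reg .v + w.toNat) →
      Frame (start w) σ σ' → Q t' σ') : WP E (start w) Q t σ := by
  refine WP.mono (Q := fun t' σ' => (t' ≤ t + 60 ∧ σ'.reg (.q w) = 1 ∧ σ'.reg (.h w) = 0 ∧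
    σ'.reg (.ep w) = 0 ∧ σ'.reg (.st w) = 0 ∧ σ'.arr (.mark w) =
        Function.update (σ.arr (.mark w)) (2 * σ.reg .v + w.toNat) (σ.reg .s) ∧
      σ'.arr (.queue w) = Function.update (σ.arr (.queue w)) 0 (2 * σ.reg .v + w.toNat)) ∧
    Frame (start w) σ σ') (WP.frame ?_)
    fun t' σ' ⟨⟨h1, h2, h3, h4, h5, h6, h7⟩, h8⟩ => hQ t' σ' h1 h2 h3 h4 h5 h6 h7 h8
  have hw : w.toNat ≤ 1 := Bool.toNat_le w
  have e1 : (Ex.lit w.toNat).eval E σ = w.toNat := rfl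
  have e2 : (Ex.lit w.toNat).Ok E σ ↔ w.toNat ≤ E.bound := Iff.rfl
  have e3 : (Ex.lit w.toNat).cost = 1 := rfl
  simp [start, wp_seq, wp_set, wp_put, e1, e2, e3]
  omega

/-- The search that the state represents. -/
def Search.at (S : Search) (σ : St) : Search :=
  { S with V := fun l => σ.arr .val l = 1, s := σ.reg .s }

theorem Search.at_set_v (S : Search) (σ : St) (x : ℕ) : S.at (σ.set .v x) = S.at σ := by
  simp [Search.at]

theorem Search.Partial.set_s {S : Search} (h : S.Partial) (s : ℕ) : { S with s := s }.Partial :=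
  ⟨⟨h.graph, h.closed⟩, h.consistent, h.ext⟩

/-- The invariant of the main loop of `solve`, started at time `t`. -/
def SolveInv (S : Search) (t W : ℕ) (t' : ℕ) (σ : St) : Prop :=
  (σ.reg .sat = 1 ∧ σ.reg .v ≤ S.n ∧ (S.at σ).Partial ∧
    (∀ l < 2 * S.n, σ.arr .val l = 0 ∨ σ.arr .val l = 1) ∧
    (∀ u < σ.reg .v, σ.arr .val (2 * u) = 1 ∨ σ.arr .val (2 * u + 1) = 1) ∧
    (∀ w, ∀ l < 2 * S.n, σ.arr (.mark w) l ≤ σ.reg .v) ∧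
    t' + 300 * (S.at σ).weight ≤ t + 10 + 900 * σ.reg .v + 300 * W) ∨
  (σ.reg .sat = 0 ∧ (¬ ∃ f, Respects S.n S.adj f) ∧ S.n ≤ σ.reg .v ∧
    t' ≤ t + 900 * S.n + 300 * W + 990)

/-- The remaining weight is a potential: 900 steps per variable pay for the fixed costs and 300 per
unit of weight for the propagations and their commitment. -/
theorem solve_spec {E : Env} {S : Search} {t : ℕ} {σ : St}
    (hG : IsImplicationGraph S.n S.adj) (hσ : Holds E S σ)
    (hval : ∀ l < 2 * S.n, σ.arr .val l = 0)
    (hmark : ∀ w, ∀ l < 2 * S.n, σ.arr (.mark w) l = 0) {Q : ℕ → St → Prop}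
    (hQ : ∀ t' σ', t' ≤ t + 1000 * S.n + 300 * ∑ l ∈ Finset.range (2 * S.n), S.wt l + 1000 →
      (σ'.reg .sat = 1 ∧ (∃ f, Respects S.n S.adj f) ∨
        σ'.reg .sat = 0 ∧ ¬ ∃ f, Respects S.n S.adj f) → Frame solve σ σ' → Q t' σ') :
    WP E solve Q t σ := by
  set W := ∑ l ∈ Finset.range (2 * S.n), S.wt l with hW
  refine WP.mono (Q := fun t' σ' => (t' ≤ t + 1000 * S.n + 300 * W + 1000 ∧
      (σ'.reg .sat = 1 ∧ (∃ f, Respects S.n S.adj f) ∨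
        σ'.reg .sat = 0 ∧ ¬ ∃ f, Respects S.n S.adj f)) ∧ Frame solve σ σ') (WP.frame ?_)
    fun t' σ' ⟨⟨h1, h2⟩, h3⟩ => hQ t' σ' h1 h2 h3
  have hb := hσ.bound
  have hn := hσ.n_lt
  simp only [solve, wp_seq, wp_set]
  refine ⟨by simp; omega, by simp, wp_loop (fun f t' σ' => f = S.n - σ'.reg .v ∧
    SolveInv S t W t' σ') S.n ⟨by simp, .inl ⟨by simp, by simp, ⟨⟨hG, ?_⟩, ?_, ?_⟩, ?_, ?_, ?_, ?_⟩⟩ ?_⟩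
  · intro l hl h
    simp [Search.at, hval l hl] at h
  · intro l hl h
    simp [Search.at, hval l hl] at h
  · intro f hf
    refine ⟨f, hf, fun l hl h => ?_⟩
    simp [Search.at, hval l hl] at h
  · intro l hl
    simp [hval l hl]
  · simp
  · intro w l hl
    simp [hmark w l hl]
  · have : (S.at ((σ.set .sat (Ex.eval E σ 1)).set .v
        (Ex.eval E (σ.set .sat (Ex.eval E σ 1)) 0))).weight ≤ W := by
      classical exact Finset.sum_le_sum_of_subset (Finset.filter_subset _ _)
    simp at this ⊢
    omega
  rintro f t' σ' hf ⟨hfuel, hI⟩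
  have hσn : σ'.reg .n = S.n := (hf.reg _ rfl).trans hσ.n
  simp only [Cond.ok_lt, Ex.ok_var, Cond.holds_lt, Ex.eval_var, Cond.cost_lt, Ex.cost_var, hσn,
    true_and, not_lt]
  refine ⟨fun hlt => ?_, fun hge => ?_⟩
  swap
  · rcases hI with ⟨hsat, hle, hP, -, hcomp, -, ht⟩ | ⟨hsat, hno, -, ht⟩
    · have hvn : σ'.reg .v = S.n := by omega
      rw [hvn] at ht hcomp
      exact ⟨by omega, .inl ⟨hsat, _, hP.respects hcomp⟩⟩
    · exact ⟨by omega, .inr ⟨hsat, hno⟩⟩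
  rcases hI with ⟨hsat, hle, hP, h01, hcomp, hmk, ht⟩ | ⟨hsat, hno, hge, ht⟩
  swap
  · omega
  have hv0 := h01 (2 * σ'.reg .v) (by omega)
  have hv1 := h01 (2 * σ'.reg .v + 1) (by omega)
  by_cases hfree : σ'.arr .val (2 * σ'.reg .v) = 0 ∧ σ'.arr .val (2 * σ'.reg .v + 1) = 0
  swap
  · have hne : ¬ (σ'.arr .val (2 * σ'.reg .v) = 0 ∧ σ'.arr .val (2 * σ'.reg .v + 1) = 0) := hfree
    simp [wp_seq, wp_ite, wp_skip, wp_set, hne]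
    refine ⟨by omega, by omega, by omega, .inl ⟨by simpa using hsat, by simpa using hlt, ?_⟩⟩
    rw [Search.at_set_v]
    refine ⟨hP, h01, fun u hu => ?_, fun w l hl => ?_, ?_⟩
    · simp only [St.reg_set, if_true] at hu
      rcases Nat.lt_succ_iff_lt_or_eq.1 hu with hu | rfl
      · exact hcomp u hu
      · simp only [St.arr_set]
        omega
    · have := hmk w l hl
      simp
      omega
    · simp
      omega
  have hfv := hfree
  simp only [wp_seq, wp_ite, wp_set]
  simp [hfree.1, hfree.2]
  refine ⟨⟨by omega, by omega, by omega⟩, by omega, ?_⟩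
  set σ₀ := σ'.set .s (σ'.reg .v + 1) with hσ₀
  refine start_spec (by simp [hσ₀]; omega) hb (by omega)
    fun t₁ σ₁ ht₁ hq₁ hh₁ hep₁ hst₁ hmk₁ hqu₁ hf₁ => ?_
  rw [wp_seq]
  refine start_spec (by rw [hf₁.reg _ rfl]; simp [hσ₀]; omega) hb (by omega)
    fun t₂ σ₂ ht₂ hq₂ hh₂ hep₂ hst₂ hmk₂ hqu₂ hf₂ => ?_
  rw [hf₁.reg _ rfl, hf₁.reg _ rfl, hf₁.arr _ rfl] at hmk₂
  rw [hf₁.reg _ rfl, hf₁.arr _ rfl] at hqu₂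
  set S₁ : Search := { S.at σ' with s := σ'.reg .v + 1 } with hS₁
  have hP₁ : S₁.Partial := hP.set_s _
  have hval₂ : σ₂.arr .val = σ'.arr .val := (hf₂.arr _ rfl).trans (hf₁.arr _ rfl)
  have hfr : ∀ w : Bool, ¬ S₁.V (2 * σ'.reg .v + w.toNat) ∧
      ¬ S₁.V (negl (2 * σ'.reg .v + w.toNat)) ∧ 2 * σ'.reg .v + w.toNat < 2 * S₁.n := by
    have e0 : negl (2 * σ'.reg .v) = 2 * σ'.reg .v + 1 := by unfold negl; omega
    have e1 : negl (2 * σ'.reg .v + 1) = 2 * σ'.reg .v := by unfold negl; omega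
    have : S₁.n = S.n := rfl
    rintro (_ | _) <;> simp [hS₁, Search.at, e0, e1, hfree.1, hfree.2] <;> omega
  -- Marks are stamps: the races for earlier variables left values of at most `v`, and the present
  -- stamp is `v + 1`. Hence marks never have to be cleared between races, not even those of a
  -- losing propagation.
  have hmk' : ∀ w, ∀ l < 2 * S₁.n, σ'.arr (.mark w) l ≠ S₁.s := by
    intro w l hl
    have h1 := hmk w l hl
    have h2 : S₁.s = σ'.reg .v + 1 := rfl
    omega
  have hH : Holds E S₁ σ₂ := by
    constructor
    · exact ((hf₂.reg _ rfl).trans (hf₁.reg _ rfl)).trans hσn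
    · exact ((hf₂.reg _ rfl).trans (hf₁.reg _ rfl))
    · rw [hf₂.arr _ rfl, hf₁.arr _ rfl]
      exact (hf.arr .neg rfl).symm ▸ hσ.neg
    · rw [hf₂.arr _ rfl, hf₁.arr _ rfl]
      exact (hf.arr .head rfl).symm ▸ hσ.head
    · exact ((hf₂.arr _ rfl).trans (hf₁.arr _ rfl)).trans ((hf.arr .next rfl).trans hσ.next)
    · exact ((hf₂.arr _ rfl).trans (hf₁.arr _ rfl)).trans ((hf.arr .tgt rfl).trans hσ.tgt)
    · intro l hl
      rw [hval₂]
      show _ ∧ ¬ (σ'.arr .val l = 1) ∨ _ ∧ σ'.arr .val l = 1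
      have := h01 l hl
      omega
    · exact hb
    · exact hn
    · exact hσ.e_lt
  have hmk₂' : ∀ w, ∀ l < 2 * S₁.n, σ₂.arr (.mark w) l ≤ S₁.s := by
    intro w l hl
    have h1 : σ'.arr (.mark w) l ≤ S₁.s := (hmk w l hl).trans (Nat.le_succ _)
    cases w
    · rw [hf₂.arr _ rfl, hmk₁, Function.update_apply]
      split_ifs
      exacts [le_rfl, h1]
    · rw [hmk₂, Function.update_apply]
      split_ifs
      exacts [le_rfl, h1]
  have hrun : ∀ w, Proc S₁ (2 * σ'.reg .v + w.toNat) 0 w σ₂ := by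
    refine fun w => ⟨hmk₂' w, ?_⟩
    revert w
    rintro (_ | _)
    · refine .inl ⟨(hf₂.reg _ rfl).trans hst₁, [2 * σ'.reg .v + false.toNat], [], ?_⟩
      rw [hf₂.reg _ rfl, hf₂.reg _ rfl, hf₂.reg _ rfl, hf₂.arr _ rfl, hf₂.arr _ rfl, hq₁, hh₁, hep₁,
        hmk₁, hqu₁]
      exact Running.init (hfr _).2.2 (hfr _).1 (hfr _).2.1 (hmk' _)
    · refine .inl ⟨hst₂, [2 * σ'.reg .v + true.toNat], [], ?_⟩
      rw [hq₂, hh₂, hep₂, hmk₂, hqu₂]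
      exact Running.init (hfr _).2.2 (hfr _).1 (hfr _).2.1 (hmk' _)
  rw [wp_seq]
  refine race_spec hP₁.toValid hH hrun fun k t₃ σ₃ ht₃ hk hproc hst hf₃ => ?_
  have hv₃ : σ₃.reg .v = σ'.reg .v :=
    (hf₃.reg _ rfl).trans ((hf₂.reg _ rfl).trans (hf₁.reg _ rfl))
  have hval₃ : σ₃.arr .val = σ'.arr .val := (hf₃.arr _ rfl).trans hval₂
  have hw₁ : S₁.weight = (S.at σ').weight := rfl
  -- A win after `k' + 1` rounds costs at most `210 (k' + 1) + 10` for the race and `30 k' + 10` for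
  -- the commitment, as `ql` has at most `k'` entries. The potential drops by at least `300 k'`, and
  -- the 900 steps for the variable cover the rest.
  have win : ∀ w t₄, σ₃.reg (.st w) = 2 → t₄ ≤ t₃ + 20 → WP E (commit w)
      (WP E (Var.v ::= Ex.var Var.v + 1) fun t'' σ'' =>
        S.n - σ''.reg Var.v < f ∧ SolveInv S t W t'' σ'') t₄ σ₃ := by
    intro w t₄ hw ht₄
    rcases (hproc w).2 with h | h | ⟨-, ql, k', hk', hR⟩
    · omega
    · omega
    have hql := hR.length_le
    have hwork : k' = (ql.map S₁.wt).sum := by simpa using hR.work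
    have hlen : ql.length ≤ k' := by
      rw [hwork]
      simpa using List.length_le_sum_of_one_le (ql.map S₁.wt) (by simp [Search.wt])
    have hwt := hR.weight_extend
    have hPe := hR.partial_extend hP₁
    have hroot := hR.root_mem
    refine commit_spec hR.q_eq hR.queue (fun l hl => ?_) ?_ hb fun t₅ σ₅ ht₅ hval₅ hf₅ => ?_
    · have h1 := hR.lt l hl
      have h2 : S₁.n = S.n := rfl
      omega
    · have h2 : S₁.n = S.n := rfl
      omega
    rw [hval₃] at hval₅
    have hv₅ : σ₅.reg .v = σ'.reg .v := (hf₅.reg _ rfl).trans hv₃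
    have hV₅ : S.at σ₅ = { S₁.extend ql with s := σ₅.reg .s } := by
      simp only [Search.at, Search.extend, hS₁, hval₅]
      congr 1
      funext l
      by_cases hl : l ∈ ql <;> simp [hl]
    have hw₅ : (S.at σ₅).weight = (S₁.extend ql).weight := by rw [hV₅]; rfl
    simp [wp_set, hv₅]
    refine ⟨by omega, by omega, .inl ⟨?_, ?_, ?_, ?_, ?_, ?_, ?_⟩⟩
    · simp
      rw [hf₅.reg _ rfl, hf₃.reg _ rfl, hf₂.reg _ rfl, hf₁.reg _ rfl]
      exact hsat
    · simp
      omega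
    · rw [Search.at_set_v, hV₅]
      exact hPe.set_s _
    · intro l hl
      simp only [St.arr_set, hval₅]
      split_ifs
      · exact .inr rfl
      · exact h01 l hl
    · intro u hu
      simp only [St.reg_set, if_true, St.arr_set, hval₅] at hu ⊢
      rcases Nat.lt_succ_iff_lt_or_eq.1 hu with hu | rfl
      · rcases hcomp u hu with h | h
        · left; rw [h]; simp
        · right; rw [h]; simp
      · cases w
        · left; rw [if_pos (by simpa using hroot)]
        · right; rw [if_pos (by simpa using hroot)]
    · intro w' l hl
      simp only [St.reg_set, if_true, St.arr_set]
      rw [hf₅.arr _ rfl]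
      exact (hproc w').1 l hl
    · rw [Search.at_set_v, hw₅]
      simp
      omega
  rw [wp_ite]
  refine ⟨by simp; omega, fun h => win _ _ (by simpa using h) (by simp), fun h0 => ?_⟩
  rw [wp_ite]
  refine ⟨by simp; omega, fun h => win _ _ (by simpa using h) (by simp), fun h1 => ?_⟩
  simp at h0 h1
  -- Neither state is 2 but their sum is at least 2, so both are 1.
  have href : ∀ w : Bool, S₁.Refuted (2 * σ'.reg .v + w.toNat) := by
    have h0 : ∀ w, σ₃.reg (.st w) ≤ 1 := by
      have h2 : ∀ w, σ₃.reg (.st w) ≤ 2 := fun w => by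
        rcases (hproc w).2 with h | h | h <;> omega
      have := h2 false
      have := h2 true
      rintro (_ | _) <;> omega
    intro w
    rcases (hproc w).2 with h | h | h
    · have hf := h0 false
      have ht := h0 true
      have h := h.1
      cases w <;> omega
    · exact h.2
    · have := h0 w
      omega
  have hno : ¬ ∃ f, Respects S.n S.adj f := by
    refine hP₁.not_respects (hfr false).2.2 (href false) ?_
    have e0 : negl (2 * σ'.reg .v + false.toNat) = 2 * σ'.reg .v + true.toNat := by
      unfold negl; simp
    rw [e0]
    exact href true
  have hn₃ : σ₃.reg .n = S.n := (hf₃.reg _ rfl).trans hH.n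
  rw [wp_seq]
  simp [wp_set, hn₃]
  exact ⟨by omega, by omega, .inr ⟨by simp, hno, by simp, by omega⟩⟩

/-! ### Construction of the implication graph -/

/-- A multistage instance with literals as numbers. -/
structure Raw where
  n : ℕ
  d : ℕ
  fs : List (List (List ℕ))

/-- All clauses are nonempty, of width at most two, and over the variables below `n`. -/
structure Raw.Ok (I : Raw) : Prop where
  n_pos : 1 ≤ I.n
  pos : ∀ φ ∈ I.fs, ∀ C ∈ φ, C ≠ []
  width : ∀ φ ∈ I.fs, ∀ C ∈ φ, C.length ≤ 2
  lt : ∀ φ ∈ I.fs, ∀ C ∈ φ, ∀ l ∈ C, l < 2 * I.n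

/-- The length of a clause, followed by its literals. -/
def clauseCode (C : List ℕ) : List ℕ := C.length :: C

/-- The length of a formula, followed by its clauses. -/
def formulaCode (φ : List (List ℕ)) : List ℕ := φ.length :: φ.flatMap clauseCode

/-- The input that describes an instance. -/
def Raw.input (I : Raw) : List ℕ := [I.n, I.fs.length, I.d] ++ I.fs.flatMap formulaCode

/-- The total number of clauses. -/
def Raw.clauses (I : Raw) : ℕ := (I.fs.map List.length).sum

/-- The memory holds the instance and is large enough for the data structures. -/
structure Raw.InEnv (I : Raw) (E : Env) : Prop where
  inp : E.inp = fun a => I.input.getD a 0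
  len : E.len = I.input.length
  bound : E.size ≤ E.bound
  n_lt : 2 * I.n + 4 < E.size
  clauses_lt : 2 * I.clauses + 1 < E.size
  digits_lt : I.fs.length * I.n + 1 < E.size
  len_lt : I.input.length + 3 < E.size

/-- Whether `v` occurs an odd number of times among the first `k` entries of `g`. -/
def par (g : ℕ → ℕ) : ℕ → ℕ → Bool
  | 0, _ => false
  | k + 1, v => xor (par g k v) (decide (g k = v))

/-- Negate a literal if its variable is in `p`. -/
def flipl (p : ℕ → Bool) (l : ℕ) : ℕ := if p (l / 2) then negl l else l

theorem flipl_lt {p : ℕ → Bool} {l n : ℕ} (h : l < 2 * n) : flipl p l < 2 * n := by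
  unfold flipl
  split_ifs
  exacts [negl_lt h, h]

/-- The first and the last literal of a clause, with the variables in `p` negated. -/
def clausePair (p : ℕ → Bool) (C : List ℕ) : ℕ × ℕ :=
  (flipl p (C.getD 0 0), flipl p (C.getD (C.length - 1) 0))

/-- The pairs of literals that come from the clauses of the first `i` stages, if the variables
that change in each stage are given by `g`, in blocks of `d` entries. -/
def Raw.pairs (I : Raw) (g : ℕ → ℕ) (d : ℕ) : ℕ → List (ℕ × ℕ)
  | 0 => []
  | i + 1 => ((I.fs.getD i []).map (clausePair (par g ((i + 1) * d)))).reverse ++ I.pairs g d i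

/-- The implications of a list of binary clauses. -/
def adjOf : List (ℕ × ℕ) → ℕ → List ℕ
  | [], _ => []
  | (a, b) :: Cl, l =>
    if l = negl b then a :: (if l = negl a then b :: adjOf Cl l else adjOf Cl l)
    else if l = negl a then b :: adjOf Cl l else adjOf Cl l

theorem mem_adjOf {Cl : List (ℕ × ℕ)} {l x : ℕ} : x ∈ adjOf Cl l ↔
    ∃ c ∈ Cl, l = negl c.2 ∧ x = c.1 ∨ l = negl c.1 ∧ x = c.2 := by
  induction Cl with
  | nil => simp [adjOf]
  | cons c Cl ih =>
    obtain ⟨a, b⟩ := c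
    simp only [adjOf, List.mem_cons, exists_eq_or_imp, ← ih]
    split_ifs <;> (try simp only [List.mem_cons]) <;> tauto

theorem isImplicationGraph_adjOf {n : ℕ} {Cl : List (ℕ × ℕ)}
    (h : ∀ c ∈ Cl, c.1 < 2 * n ∧ c.2 < 2 * n) : IsImplicationGraph n (adjOf Cl) := by
  constructor
  · intro l _ x hx
    obtain ⟨c, hc, ⟨-, rfl⟩ | ⟨-, rfl⟩⟩ := mem_adjOf.1 hx
    exacts [(h c hc).1, (h c hc).2]
  · intro l _ x hx
    obtain ⟨c, hc, ⟨rfl, rfl⟩ | ⟨rfl, rfl⟩⟩ := mem_adjOf.1 hx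
    · exact mem_adjOf.2 ⟨c, hc, .inr ⟨rfl, negl_negl _⟩⟩
    · exact mem_adjOf.2 ⟨c, hc, .inl ⟨rfl, negl_negl _⟩⟩

/-- A clause is equivalent to either of its two implications. A unit clause is stored as a pair of
equal literals and becomes the implication from its negation to itself. -/
theorem respects_adjOf {n : ℕ} {Cl : List (ℕ × ℕ)}
    (h : ∀ c ∈ Cl, c.1 < 2 * n ∧ c.2 < 2 * n) {f : ℕ → Prop} : Respects n (adjOf Cl) f ↔
      (∀ l < 2 * n, (f (negl l) ↔ ¬ f l)) ∧ ∀ c ∈ Cl, f c.1 ∨ f c.2 := by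
  constructor
  · rintro ⟨hn, ha⟩
    refine ⟨hn, fun c hc => ?_⟩
    by_contra! hcon
    exact hcon.2 (ha _ (negl_lt (h c hc).1) ((hn _ (h c hc).1).2 hcon.1) _
      (mem_adjOf.2 ⟨c, hc, .inr ⟨rfl, rfl⟩⟩))
  · rintro ⟨hn, hc⟩
    refine ⟨hn, fun l hl hfl x hx => ?_⟩
    obtain ⟨c, hcm, ⟨rfl, rfl⟩ | ⟨rfl, rfl⟩⟩ := mem_adjOf.1 hx
    · exact (hc c hcm).resolve_right ((hn _ (h c hcm).2).1 hfl)
    · exact (hc c hcm).resolve_left ((hn _ (h c hcm).1).1 hfl)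

theorem sum_length_adjOf {n : ℕ} (Cl : List (ℕ × ℕ)) :
    ∑ l ∈ Finset.range n, (adjOf Cl l).length ≤ 2 * Cl.length := by
  induction Cl with
  | nil => simp [adjOf]
  | cons c Cl ih =>
    obtain ⟨a, b⟩ := c
    have key : ∀ l, (adjOf ((a, b) :: Cl) l).length =
        (adjOf Cl l).length + (if l = negl b then 1 else 0) + if l = negl a then 1 else 0 := by
      intro l
      simp only [adjOf]
      split_ifs <;> simp
    have one : ∀ a, ∑ l ∈ Finset.range n, (if l = a then 1 else 0) ≤ 1 := by
      intro a
      rw [Finset.sum_ite_eq']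
      split_ifs <;> simp
    simp only [key, Finset.sum_add_distrib, List.length_cons]
    have := one (negl a)
    have := one (negl b)
    omega

/-- An existing list uses only cells up to `e`, so writing the fresh cell `e + 1` does not affect
it. -/
theorem Chain.mono {next tgt : ℕ → ℕ} {e y z : ℕ} {l : List ℕ} : ∀ {p : ℕ}, Chain next tgt e p l →
    Chain (Function.update next (e + 1) y) (Function.update tgt (e + 1) z) (e + 1) p l := by
  induction l with
  | nil => exact id
  | cons x l ih =>
    rintro p ⟨h0, hle, ht, hc⟩
    refine ⟨h0, by omega, ?_, ?_⟩
    · rw [Function.update_of_ne (by omega), ht]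
    · rw [Function.update_of_ne (by omega)]
      exact ih hc

theorem Chain.push {next tgt head : ℕ → ℕ} {e n a b : ℕ} {adj : ℕ → List ℕ}
    (h : ∀ l < n, Chain next tgt e (head l) (adj l)) :
    ∀ l < n, Chain (Function.update next (e + 1) (head a)) (Function.update tgt (e + 1) b) (e + 1)
      (Function.update head a (e + 1) l) (if l = a then b :: adj l else adj l) := by
  intro l hl
  by_cases hla : l = a
  · subst hla
    simp only [Function.update_self, if_true]
    refine ⟨by omega, le_rfl, by simp, ?_⟩
    rw [Function.update_self]
    exact (h l hl).mono
  · rw [Function.update_of_ne hla, if_neg hla]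
    exact (h l hl).mono

/-! ### Filling the arrays: translation table and linked lists -/

/-- Initialize the arrays that are indexed by literals. -/
def reset : Cmd :=
  .i ::= 0 ;;
  .loop (.lt Var.i (Var.n + 1 : Ex))
    (.x ::= 2 * (Var.i : Ex) ;;
      .y ::= Var.x + 1 ;;
      .put .tr Var.x Var.x ;; .put .tr Var.y Var.y ;;
      .put .neg Var.x Var.y ;; .put .neg Var.y Var.x ;;
      .put .head Var.x 0 ;; .put .head Var.y 0 ;;
      .put .val Var.x 0 ;; .put .val Var.y 0 ;;
      .put (.mark false) Var.x 0 ;; .put (.mark false) Var.y 0 ;;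
      .put (.mark true) Var.x 0 ;; .put (.mark true) Var.y 0 ;;
      .i ::= Var.i + 1)

/-- The arrays indexed by literals have their initial values below `m`. -/
structure IsReset (m : ℕ) (σ : St) : Prop where
  tr : ∀ l < m, σ.arr .tr l = l
  neg : ∀ l < m, σ.arr .neg l = negl l
  head : ∀ l < m, σ.arr .head l = 0
  val : ∀ l < m, σ.arr .val l = 0
  mark : ∀ w, ∀ l < m, σ.arr (.mark w) l = 0

/-- The range `2 * n + 2` includes the two literals of the dummy variable `n`, which the digit for
"no change" toggles harmlessly. -/
theorem reset_spec {E : Env} {n t : ℕ} {σ : St} (hn : σ.reg .n = n) (hlt : 2 * n + 4 < E.size)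
    (hb : E.size ≤ E.bound) {Q : ℕ → St → Prop}
    (hQ : ∀ t' σ', t' ≤ t + 300 * n + 400 → IsReset (2 * n + 2) σ' → Frame reset σ σ' → Q t' σ') :
    WP E reset Q t σ := by
  refine WP.mono (Q := fun t' σ' => (t' ≤ t + 300 * n + 400 ∧ IsReset (2 * n + 2) σ') ∧
    Frame reset σ σ') (WP.frame ?_) fun t' σ' ⟨⟨h1, h2⟩, h3⟩ => hQ t' σ' h1 h2 h3
  simp only [reset, wp_seq, wp_set]
  refine ⟨by simp, wp_loop (fun f t' σ' => f + σ'.reg .i = n + 1 ∧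
    t' ≤ t + 300 * σ'.reg .i + 5 ∧ IsReset (2 * σ'.reg .i) σ') (n + 1) ?_ ?_⟩
  · simp
    constructor <;> simp
  · rintro f t' σ' hf ⟨h1, h2, h3⟩
    have hn' : σ'.reg .n = n := (hf.reg _ rfl).trans hn
    simp [hn']
    refine ⟨⟨by omega, by omega⟩, fun hi => ?_, fun hi => ?_⟩
    · have b1 : 2 * σ'.reg .i < E.size := by omega
      have b2 : 2 * σ'.reg .i + 1 < E.size := by omega
      have b3 : 2 * σ'.reg .i ≤ E.bound := by omega
      have b4 : 2 * σ'.reg .i < E.bound := by omega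
      have b5 : σ'.reg .i < E.bound := by omega
      have b6 : 1 ≤ E.bound := by omega
      have b7 : 2 ≤ E.bound := by omega
      simp only [wp_seq, wp_set, wp_put]
      simp [b1, b2, b3, b4, b5, b6, b7]
      refine ⟨f - 1, by omega, by omega, by omega, ?_⟩
      constructor
      all_goals simp only [St.arr_set, St.arr_put, St.reg_set, St.reg_put, reduceCtorEq, if_true,
        if_false, Function.update_apply, Arr.mark.injEq]
      · intro l hl
        have := h3.tr l
        split_ifs <;> omega
      · intro l hl
        have := h3.neg l
        have e0 : negl (2 * σ'.reg .i) = 2 * σ'.reg .i + 1 := by unfold negl; omega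
        have e1 : negl (2 * σ'.reg .i + 1) = 2 * σ'.reg .i := by unfold negl; omega
        split_ifs with h h'
        · rw [h, e1]
        · rw [h', e0]
        · exact this (by omega)
      · intro l hl
        have := h3.head l
        split_ifs <;> omega
      · intro l hl
        have := h3.val l
        split_ifs <;> omega
      · intro w l hl
        have := h3.mark w l
        cases w <;> simp [Function.update_apply] <;> omega
    · have hi' : σ'.reg .i = n + 1 := by omega
      rw [hi'] at h3
      refine ⟨by omega, ?_⟩
      rwa [mul_add] at h3

/-- Negate the literals of the next `d` variables of the array `dig`. -/
def toggle : Cmd :=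
  .k ::= 0 ;;
  .loop (.lt Var.k Var.d)
    (.x ::= 2 * Ex.arr .dig Var.dp ;;
      .a ::= .arr .tr Var.x ;;
      .put .tr Var.x (.arr .tr (Var.x + 1 : Ex)) ;;
      .put .tr (Var.x + 1 : Ex) Var.a ;;
      .dp ::= Var.dp + 1 ;;
      .k ::= Var.k + 1)

/-- One more occurrence of a variable changes its parity, which in the translation table is a swap
of two entries. Thus each digit costs constant time. -/
theorem flipl_par_succ (g : ℕ → ℕ) (k : ℕ) (tr : ℕ → ℕ) {m : ℕ}
    (h : ∀ l < m, tr l = flipl (par g k) l) (hg : 2 * g k + 1 < m) :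
    ∀ l < m, Function.update (Function.update tr (2 * g k) (tr (2 * g k + 1))) (2 * g k + 1)
      (tr (2 * g k)) l = flipl (par g (k + 1)) l := by
  intro l hl
  have e0 : negl (2 * g k) = 2 * g k + 1 := by unfold negl; omega
  have e1 : negl (2 * g k + 1) = 2 * g k := by unfold negl; omega
  have d0 : 2 * g k / 2 = g k := by omega
  have d1 : (2 * g k + 1) / 2 = g k := by omega
  simp only [Function.update_apply]
  split_ifs with h1 h2
  · rw [h _ (by omega), h1]
    simp only [flipl, par, d0, d1, e0, e1]
    cases par g k (g k) <;> simp
  · rw [h _ (by omega), h2]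
    simp only [flipl, par, d0, d1, e0, e1]
    cases par g k (g k) <;> simp
  · rw [h _ hl]
    have : g k ≠ l / 2 := by omega
    simp [flipl, par, this]

theorem toggle_spec {E : Env} {n d k₀ K t : ℕ} {σ : St} (hd : σ.reg .d = d) (hk : σ.reg .dp = k₀)
    (hlt : 2 * n + 4 < E.size) (hb : E.size ≤ E.bound) (hK : k₀ + d ≤ K) (hKE : K < E.size)
    (hg : ∀ k < K, σ.arr .dig k ≤ n)
    (htr : ∀ l < 2 * n + 2, σ.arr .tr l = flipl (par (σ.arr .dig) k₀) l) {Q : ℕ → St → Prop}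
    (hQ : ∀ t' σ', t' ≤ t + 100 * d + 20 → σ'.reg .dp = k₀ + d →
      (∀ l < 2 * n + 2, σ'.arr .tr l = flipl (par (σ.arr .dig) (k₀ + d)) l) →
      Frame toggle σ σ' → Q t' σ') :
    WP E toggle Q t σ := by
  refine WP.mono (Q := fun t' σ' => (t' ≤ t + 100 * d + 20 ∧ σ'.reg .dp = k₀ + d ∧
    ∀ l < 2 * n + 2, σ'.arr .tr l = flipl (par (σ.arr .dig) (k₀ + d)) l) ∧
    Frame toggle σ σ') (WP.frame ?_) fun t' σ' ⟨⟨h1, h2, h3⟩, h4⟩ => hQ t' σ' h1 h2 h3 h4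
  simp only [toggle, wp_seq, wp_set]
  refine ⟨by simp, wp_loop (fun f t' σ' => f + σ'.reg .k = d ∧ t' ≤ t + 100 * σ'.reg .k + 5 ∧
    σ'.reg .dp = k₀ + σ'.reg .k ∧
    ∀ l < 2 * n + 2, σ'.arr .tr l = flipl (par (σ.arr .dig) (k₀ + σ'.reg .k)) l) d ?_ ?_⟩
  · simpa [hk] using htr
  · rintro f t' σ' hf ⟨h1, h2, h3, h4⟩
    have hd' : σ'.reg .d = d := (hf.reg _ rfl).trans hd
    have hdig : σ'.arr .dig = σ.arr .dig := hf.arr _ rfl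
    simp [hd']
    refine ⟨fun hi => ?_, fun hi => ?_⟩
    · have hgk := hg (k₀ + σ'.reg .k) (by omega)
      simp only [wp_seq, wp_set, wp_put]
      simp [hdig, h3]
      have := flipl_par_succ _ _ _ h4 (m := 2 * n + 2) (by omega)
      and_intros
      any_goals omega
      refine ⟨f - 1, by omega, by omega, by omega, by omega, ?_⟩
      simpa [add_assoc] using this
    · have hi' : σ'.reg .k = d := by omega
      rw [hi'] at h2 h3 h4
      exact ⟨by omega, h3, h4⟩

/-- The reading position is described by the unread suffix of the input; this turns that description
into values of cells. -/
theorem getD_of_drop_eq {inp l r : List ℕ} {c : ℕ} (h : inp.drop c = l ++ r) {k : ℕ}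
    (hk : k < l.length) : inp.getD (c + k) 0 = l.getD k 0 ∧ c + k < inp.length := by
  have h1 : inp[c + k]? = some l[k] := by
    rw [← List.getElem?_drop, h, List.getElem?_append_left hk, List.getElem?_eq_getElem hk]
  refine ⟨?_, (List.getElem?_eq_some_iff.1 h1).1⟩
  rw [List.getD_eq_getElem?_getD, h1, List.getD_eq_getElem _ _ hk]
  rfl

theorem drop_of_drop_eq {inp l r : List ℕ} {c : ℕ} (h : inp.drop c = l ++ r) :
    inp.drop (c + l.length) = r := by
  rw [← List.drop_drop, h, List.drop_left]

/-- The linked lists represent the implications of the clauses `Cl`. -/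
structure Built (n : ℕ) (Cl : List (ℕ × ℕ)) (σ : St) : Prop where
  neg : ∀ l < 2 * n, σ.arr .neg l = negl l
  chain : ∀ l < 2 * n, Chain (σ.arr .next) (σ.arr .tgt) (σ.reg .e) (σ.arr .head l) (adjOf Cl l)
  e : σ.reg .e = 2 * Cl.length

/-- Add an implication from the negation of the literal in `r` to the literal in `r'`. -/
def link (r r' : Var) : Cmd :=
  .e ::= Var.e + 1 ;;
  .put .tgt Var.e r' ;;
  .put .next Var.e (.arr .head (.arr .neg r)) ;;
  .put .head (.arr .neg r) Var.e

theorem link_spec {E : Env} {n a b t : ℕ} {r r' : Var} {σ : St} {adj : ℕ → List ℕ}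
    (hr : r ≠ .e) (hr' : r' ≠ .e)
    (ha : σ.reg r = a) (hb : σ.reg r' = b) (han : a < 2 * n)
    (hneg : ∀ l < 2 * n, σ.arr .neg l = negl l)
    (hch : ∀ l < 2 * n, Chain (σ.arr .next) (σ.arr .tgt) (σ.reg .e) (σ.arr .head l) (adj l))
    (hn : 2 * n + 4 < E.size) (hbd : E.size ≤ E.bound) (he : σ.reg .e + 1 < E.size)
    {Q : ℕ → St → Prop}
    (hQ : ∀ t' σ', t' ≤ t + 100 → σ'.reg .e = σ.reg .e + 1 →
      (∀ l < 2 * n, Chain (σ'.arr .next) (σ'.arr .tgt) (σ'.reg .e) (σ'.arr .head l)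
        (if l = negl a then b :: adj l else adj l)) → Frame (link r r') σ σ' → Q t' σ') :
    WP E (link r r') Q t σ := by
  refine WP.mono (Q := fun t' σ' => (t' ≤ t + 100 ∧ σ'.reg .e = σ.reg .e + 1 ∧
      ∀ l < 2 * n, Chain (σ'.arr .next) (σ'.arr .tgt) (σ'.reg .e) (σ'.arr .head l)
        (if l = negl a then b :: adj l else adj l)) ∧ Frame (link r r') σ σ') (WP.frame ?_)
    fun t' σ' ⟨⟨h1, h2, h3⟩, h4⟩ => hQ t' σ' h1 h2 h3 h4
  have hna := negl_lt han
  simp only [link, wp_seq, wp_set, wp_put]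
  simp [hr, hr', ha, hb, hneg a han]
  have := Chain.push (a := negl a) (b := b) hch
  and_intros <;> omega

/-- Read a clause and add its implications. -/
def addClause : Cmd :=
  .len ::= .inp Var.cur ;;
  .a ::= .arr .tr (.inp (Var.cur + 1 : Ex)) ;;
  .b ::= .arr .tr (.inp (Var.cur + Var.len : Ex)) ;;
  link .a .b ;;
  link .b .a ;;
  .cur ::= Var.cur + Var.len + 1 ;;
  .cnt ::= Var.cnt - 1

theorem addClause_spec {E : Env} {n t : ℕ} {σ : St} {inp rest C : List ℕ} {Cl : List (ℕ × ℕ)}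
    {p : ℕ → Bool}
    (hinp : E.inp = fun a => inp.getD a 0) (hlen : E.len = inp.length)
    (hsize : inp.length + 3 < E.size)
    (hn : 2 * n + 4 < E.size) (hbd : E.size ≤ E.bound) (hCl : 2 * Cl.length + 2 < E.size)
    (hcur : inp.drop (σ.reg .cur) = clauseCode C ++ rest) (hC : C ≠ []) (hlt : ∀ l ∈ C, l < 2 * n)
    (htr : ∀ l < 2 * n, σ.arr .tr l = flipl p l) (hB : Built n Cl σ) {Q : ℕ → St → Prop}
    (hQ : ∀ t' σ', t' ≤ t + 300 → inp.drop (σ'.reg .cur) = rest →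
      Built n (clausePair p C :: Cl) σ' → σ'.reg .cnt = σ.reg .cnt - 1 →
      Frame addClause σ σ' → Q t' σ') :
    WP E addClause Q t σ := by
  refine WP.mono (Q := fun t' σ' => (t' ≤ t + 300 ∧ inp.drop (σ'.reg .cur) = rest ∧
      Built n (clausePair p C :: Cl) σ' ∧ σ'.reg .cnt = σ.reg .cnt - 1) ∧
      Frame addClause σ σ') (WP.frame ?_)
    fun t' σ' ⟨⟨h1, h2, h3, h4⟩, h5⟩ => hQ t' σ' h1 h2 h3 h4 h5
  have hCl' : 1 ≤ C.length := List.length_pos_iff.2 hC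
  obtain ⟨k0, l0⟩ := getD_of_drop_eq hcur (k := 0) (by simp [clauseCode])
  obtain ⟨k1, l1⟩ := getD_of_drop_eq hcur (k := 1) (by simp [clauseCode]; omega)
  obtain ⟨k2, l2⟩ := getD_of_drop_eq hcur (k := C.length) (by simp [clauseCode])
  have m1 : C.getD 0 0 < 2 * n := by
    rw [List.getD_eq_getElem _ _ hCl']
    exact hlt _ (List.getElem_mem _)
  have m2 : C.getD (C.length - 1) 0 < 2 * n := by
    rw [List.getD_eq_getElem _ _ (by omega)]
    exact hlt _ (List.getElem_mem _)
  replace k0 : E.inp (σ.reg .cur) = C.length := by rw [hinp]; simpa [clauseCode] using k0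
  replace k1 : E.inp (σ.reg .cur + 1) = C.getD 0 0 := by
    rw [hinp]; simpa only [clauseCode, List.getD_cons_succ] using k1
  replace k2 : E.inp (σ.reg .cur + C.length) = C.getD (C.length - 1) 0 := by
    rw [hinp]
    rw [← List.getD_cons_succ (x := C.length), Nat.sub_add_cancel hCl']
    exact k2
  have f1 := flipl_lt (p := p) m1
  have f2 := flipl_lt (p := p) m2
  simp only [addClause]
  rw [wp_seq, wp_set]
  simp only [Ex.ok_inp, Ex.ok_var, Ex.eval_var, Ex.eval_inp, true_and, k0]
  refine ⟨by omega, ?_⟩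
  rw [wp_seq, wp_set]
  simp [-List.getD_eq_getElem?_getD, k1, htr _ m1]
  refine ⟨by and_intros <;> omega, ?_⟩
  rw [wp_seq, wp_set]
  simp [-List.getD_eq_getElem?_getD, k2, htr _ m2]
  refine ⟨by and_intros <;> omega, ?_⟩
  rw [wp_seq]
  refine link_spec (r := .a) (r' := .b) (adj := adjOf Cl)
    (a := flipl p (C.getD 0 0)) (b := flipl p (C.getD (C.length - 1) 0)) (by simp) (by simp)
    (by simp) (by simp) f1 (by exact hB.neg) (by exact hB.chain) hn hbd
    (by have := hB.e; simp; omega) fun t₁ σ₁ ht₁ he₁ hc₁ hf₁ => ?_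
  rw [wp_seq]
  refine link_spec (r := .b) (r' := .a) (by simp) (by simp) (hf₁.reg _ rfl) (hf₁.reg _ rfl) f2
    (by rw [hf₁.arr _ rfl]; exact hB.neg) hc₁ hn hbd
    (by have := hB.e; rw [he₁]; simp; omega) fun t₂ σ₂ ht₂ he₂ hc₂ hf₂ => ?_
  have hcur₂ : σ₂.reg .cur = σ.reg .cur := (hf₂.reg _ rfl).trans (hf₁.reg _ rfl)
  have hlen₂ : σ₂.reg .len = C.length := (hf₂.reg _ rfl).trans (hf₁.reg _ rfl)
  have hcnt₂ : σ₂.reg .cnt = σ.reg .cnt := (hf₂.reg _ rfl).trans (hf₁.reg _ rfl)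
  have hneg₂ : σ₂.arr .neg = σ.arr .neg := (hf₂.arr _ rfl).trans (hf₁.arr _ rfl)
  simp only [wp_seq, wp_set]
  simp [hcur₂, hlen₂, hcnt₂]
  refine ⟨⟨by omega, by omega, by omega⟩, by omega, by omega, ?_, ⟨?_, ?_, ?_⟩⟩
  · simpa [clauseCode, add_assoc] using drop_of_drop_eq hcur
  · simpa [hneg₂] using hB.neg
  -- The outer conditional comes from the second `link` and the inner one from the first; `adjOf` is
  -- nested in the same way, so that even the order within the lists agrees.
  · exact hc₂
  · have := hB.e
    simp at he₁ ⊢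
    omega

/-- Read a formula and add its implications. -/
def addFormula : Cmd :=
  .cnt ::= .inp Var.cur ;;
  .cur ::= Var.cur + 1 ;;
  .loop (.lt 0 Var.cnt) addClause

theorem addFormula_spec {E : Env} {n t : ℕ} {σ : St} {inp rest : List ℕ} {φ : List (List ℕ)}
    {Cl : List (ℕ × ℕ)} {p : ℕ → Bool}
    (hinp : E.inp = fun a => inp.getD a 0) (hlen : E.len = inp.length)
    (hsize : inp.length + 3 < E.size)
    (hn : 2 * n + 4 < E.size) (hbd : E.size ≤ E.bound)
    (hCl : 2 * (φ.length + Cl.length) < E.size)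
    (hcur : inp.drop (σ.reg .cur) = formulaCode φ ++ rest) (hφ : ∀ C ∈ φ, C ≠ [])
    (hlt : ∀ C ∈ φ, ∀ l ∈ C, l < 2 * n)
    (htr : ∀ l < 2 * n, σ.arr .tr l = flipl p l) (hB : Built n Cl σ) {Q : ℕ → St → Prop}
    (hQ : ∀ t' σ', t' ≤ t + 310 * φ.length + 20 → inp.drop (σ'.reg .cur) = rest →
      Built n ((φ.map (clausePair p)).reverse ++ Cl) σ' →
      Frame addFormula σ σ' → Q t' σ') :
    WP E addFormula Q t σ := by
  refine WP.mono (Q := fun t' σ' => (t' ≤ t + 310 * φ.length + 20 ∧ inp.drop (σ'.reg .cur) = rest ∧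
      Built n ((φ.map (clausePair p)).reverse ++ Cl) σ') ∧
      Frame addFormula σ σ') (WP.frame ?_)
    fun t' σ' ⟨⟨h1, h2, h3⟩, h4⟩ => hQ t' σ' h1 h2 h3 h4
  obtain ⟨k0, l0⟩ := getD_of_drop_eq hcur (k := 0) (by simp [formulaCode])
  replace k0 : E.inp (σ.reg .cur) = φ.length := by rw [hinp]; simpa [formulaCode] using k0
  simp only [addFormula, wp_seq, wp_set]
  simp [k0]
  refine ⟨by omega, ⟨by omega, by omega⟩, ?_⟩
  refine wp_loop (fun f t' σ' => ∃ done rest', φ = done ++ rest' ∧ f = rest'.length ∧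
    σ'.reg .cnt = f ∧ inp.drop (σ'.reg .cur) = rest'.flatMap clauseCode ++ rest ∧
    t' ≤ t + 310 * done.length + 10 ∧
    Built n ((done.map (clausePair p)).reverse ++ Cl) σ') φ.length
    ⟨[], φ, by simp, rfl, by simp, ?_, by simp, ?_⟩ ?_
  · have h1 : inp.drop (σ.reg .cur) = [φ.length] ++ (φ.flatMap clauseCode ++ rest) := by
      simpa [formulaCode] using hcur
    simpa using drop_of_drop_eq h1
  · exact ⟨hB.neg, by simpa using hB.chain, by simpa using hB.e⟩
  · rintro f t' σ' hf ⟨done, rest', rfl, rfl, hcnt, hcur', ht', hB'⟩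
    have htr' : ∀ l < 2 * n, σ'.arr .tr l = flipl p l := by
      rw [hf.arr _ rfl]
      exact htr
    simp only [Cond.ok_lt, Ex.ok_var, Ex.ok_lit, Cond.holds_lt, Ex.eval_var, Ex.eval_lit,
      Cond.cost_lt, Ex.cost_var, Ex.cost_lit, hcnt]
    refine ⟨⟨by omega, trivial⟩, fun hpos => ?_, fun hneg => ?_⟩
    swap
    · have hnil : rest' = [] := List.eq_nil_of_length_eq_zero (by omega)
      subst hnil
      simp at hcur' ht' ⊢
      exact ⟨by omega, hcur', hB'⟩
    rcases rest' with _ | ⟨C, rest'⟩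
    · simp at hpos
    · simp only [List.length_append, List.length_cons] at hCl
      refine addClause_spec (C := C) (rest := rest'.flatMap clauseCode ++ rest) hinp hlen hsize hn hbd
        ?_ (by simpa using hcur') (hφ _ (by simp)) (hlt _ (by simp)) htr' hB'
        fun t₁ σ₁ ht₁ hc₁ hB₁ hcnt₁ _ => ?_
      · simp
        omega
      · refine ⟨rest'.length, by simp, done ++ [C], rest', by simp, rfl, ?_, hc₁, ?_, ?_⟩
        · rw [hcnt₁, hcnt]; simp
        · simp only [List.length_append, List.length_singleton, mul_add, mul_one]
          linarith
        · simpa using hB₁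

/-- Build the implication graph for the current choice of the changes. -/
def build : Cmd :=
  reset ;;
  .cur ::= 3 ;;
  .e ::= 0 ;;
  .dp ::= 0 ;;
  .i ::= 0 ;;
  .loop (.lt Var.i Var.tau) (toggle ;; addFormula ;; .i ::= Var.i + 1)

theorem Raw.length_pairs (I : Raw) (g : ℕ → ℕ) (d : ℕ) : ∀ i ≤ I.fs.length,
    (I.pairs g d i).length + ((I.fs.drop i).map List.length).sum = I.clauses
  | 0, _ => by simp [pairs, clauses]
  | i + 1, h => by
    have ih := I.length_pairs g d i (by omega)
    rw [List.drop_eq_getElem_cons (by omega)] at ih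
    rw [← ih]
    simp only [List.map_cons, List.sum_cons]
    simp [pairs, List.getElem?_eq_getElem (show i < I.fs.length by omega)]
    omega

theorem build_spec {E : Env} {I : Raw} {d t : ℕ} {σ : St} (hI : I.Ok) (hE : I.InEnv E)
    (hd : d ≤ I.n) (hσn : σ.reg .n = I.n) (hσd : σ.reg .d = d) (hστ : σ.reg .tau = I.fs.length)
    (hg : ∀ k < I.fs.length * d, σ.arr .dig k ≤ I.n) {Q : ℕ → St → Prop}
    (hQ : ∀ t' σ', t' ≤ t + 500 * (I.n + 1 + I.fs.length * (d + 1) + I.clauses) →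
      Built I.n (I.pairs (σ.arr .dig) d I.fs.length) σ' →
      (∀ l < 2 * I.n, σ'.arr .val l = 0) → (∀ w, ∀ l < 2 * I.n, σ'.arr (.mark w) l = 0) →
      Frame build σ σ' → Q t' σ') :
    WP E build Q t σ := by
  set T := 500 * (I.n + 1 + I.fs.length * (d + 1) + I.clauses) with hT
  refine WP.mono (Q := fun t' σ' => (t' ≤ t + T ∧
      Built I.n (I.pairs (σ.arr .dig) d I.fs.length) σ' ∧
      (∀ l < 2 * I.n, σ'.arr .val l = 0) ∧ (∀ w, ∀ l < 2 * I.n, σ'.arr (.mark w) l = 0)) ∧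
      Frame build σ σ') (WP.frame ?_)
    fun t' σ' ⟨⟨h1, h2, h3, h4⟩, h5⟩ => hQ t' σ' h1 h2 h3 h4 h5
  have hb := hE.bound
  have hn := hE.n_lt
  have hcl := hE.clauses_lt
  have hdl := hE.digits_lt
  have hll := hE.len_lt
  have hKn : I.fs.length * d ≤ I.fs.length * I.n := Nat.mul_le_mul_left _ hd
  have hτn : I.fs.length ≤ I.fs.length * I.n := Nat.le_mul_of_pos_right _ hI.n_pos
  simp only [build]
  rw [wp_seq]
  refine reset_spec hσn hn hb fun t₁ σ₁ ht₁ hr₁ hf₁ => ?_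
  have hdig₁ : σ₁.arr .dig = σ.arr .dig := hf₁.arr _ rfl
  simp only [wp_seq, wp_set]
  simp
  refine ⟨by omega, ?_⟩
  -- The clauses still unread enter the time bound as a potential, so the total depends on their sum
  -- over all stages.
  refine wp_loop (fun f t' σ' => ∃ i, σ'.reg .i = i ∧ f + i = I.fs.length ∧
    σ'.reg .dp = i * d ∧ (∀ l < 2 * I.n + 2, σ'.arr .tr l = flipl (par (σ.arr .dig) (i * d)) l) ∧
    I.input.drop (σ'.reg .cur) = (I.fs.drop i).flatMap formulaCode ∧
    Built I.n (I.pairs (σ.arr .dig) d i) σ' ∧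
    t' + 310 * ((I.fs.drop i).map List.length).sum ≤
      t₁ + 20 + 100 * (i * d) + 60 * i + 310 * I.clauses) I.fs.length
    ⟨0, by simp, rfl, by simp, ?_, ?_, ⟨?_, ?_, ?_⟩, ?_⟩ ?_
  · simpa [flipl, par] using hr₁.tr
  · simp [Raw.input]
  · intro l hl
    exact hr₁.neg l (by omega)
  · intro l hl
    have := hr₁.head l (by omega)
    simpa [Raw.pairs, adjOf, Chain] using this
  · simp [Raw.pairs]
  · simp [Raw.clauses]
  rintro f t' σ' hf ⟨i, hi, hfi, hdp, htr, hcur, hB, ht⟩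
  have hτ' : σ'.reg .tau = I.fs.length := by
    rw [hf.reg _ rfl]
    simpa [hf₁.reg .tau rfl] using hστ
  have hd' : σ'.reg .d = d := by
    rw [hf.reg _ rfl]
    simpa [hf₁.reg .d rfl] using hσd
  have hdig' : σ'.arr .dig = σ.arr .dig := (hf.arr _ rfl).trans hdig₁
  simp only [Cond.ok_lt, Ex.ok_var, Cond.holds_lt, Ex.eval_var, Cond.cost_lt, Ex.cost_var, hi, hτ',
    true_and]
  refine ⟨fun hlt => ?_, fun hge => ?_⟩
  · have hid : (i + 1) * d ≤ I.fs.length * d := Nat.mul_le_mul_right _ hlt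
    have hsum := I.length_pairs (σ.arr .dig) d i hlt.le
    have hid' : (i + 1) * d = i * d + d := by ring
    rw [List.drop_eq_getElem_cons hlt] at hcur hsum ht
    simp only [List.flatMap_cons, List.map_cons, List.sum_cons] at hcur hsum ht
    have hmem : I.fs[i] ∈ I.fs := List.getElem_mem _
    rw [wp_seq]
    refine toggle_spec (n := I.n) (K := I.fs.length * d) hd' hdp hn hb (by omega) (by omega)
      (by rw [hdig']; exact hg) (by rw [hdig']; exact htr) fun t₂ σ₂ ht₂ hdp₂ htr₂ hf₂ => ?_
    rw [hdig', ← hid'] at htr₂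
    rw [wp_seq]
    refine addFormula_spec (φ := I.fs[i]) (rest := (I.fs.drop (i + 1)).flatMap formulaCode)
      (Cl := I.pairs (σ.arr .dig) d i) (p := par (σ.arr .dig) ((i + 1) * d)) hE.inp hE.len hll hn hb
      (by simp only [mul_add, mul_one] at *; omega)
      (by rw [hf₂.reg _ rfl]; exact hcur) (hI.pos _ hmem) (hI.lt _ hmem)
      (fun l hl => htr₂ l (by omega)) ⟨?_, ?_, ?_⟩ fun t₃ σ₃ ht₃ hcur₃ hB₃ hf₃ => ?_
    · rw [hf₂.arr _ rfl]; exact hB.neg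
    · rw [hf₂.arr _ rfl, hf₂.arr _ rfl, hf₂.reg _ rfl, hf₂.arr _ rfl]; exact hB.chain
    · rw [hf₂.reg _ rfl]; exact hB.e
    have hi₃ : σ₃.reg .i = i := ((hf₃.reg _ rfl).trans (hf₂.reg _ rfl)).trans hi
    simp only [wp_set]
    simp only [Ex.ok_add, Ex.ok_var, Ex.ok_lit, Ex.eval_add, Ex.eval_var, Ex.eval_lit, Ex.cost_add,
      Ex.cost_var, Ex.cost_lit, hi₃]
    refine ⟨by simp; omega, f - 1, by omega, i + 1, by simp, by omega, ?_, ?_, hcur₃, ⟨?_, ?_, ?_⟩, ?_⟩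
    · rw [St.reg_set, if_neg (by simp), hf₃.reg _ rfl, hdp₂, hid']
    · intro l hl
      rw [St.arr_set, hf₃.arr _ rfl]
      exact htr₂ l hl
    · exact hB₃.neg
    · simpa [Raw.pairs, List.getElem?_eq_getElem hlt] using hB₃.chain
    · simpa [Raw.pairs, List.getElem?_eq_getElem hlt] using hB₃.e
    · rw [hid']
      simp only [mul_add] at *
      omega
  · have hi' : i = I.fs.length := by omega
    subst hi'
    have e1 : I.fs.length * (d + 1) = I.fs.length * d + I.fs.length := by ring
    rw [e1] at hT
    have hval : σ'.arr .val = σ₁.arr .val := hf.arr _ rfl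
    have hmk : ∀ w, σ'.arr (.mark w) = σ₁.arr (.mark w) := fun w => hf.arr _ rfl
    refine ⟨by omega, hB, fun l hl => ?_, fun l hl => ?_, fun l hl => ?_⟩
    · rw [hval]; exact hr₁.val l (by omega)
    · rw [hmk]; exact hr₁.mark _ l (by omega)
    · rw [hmk]; exact hr₁.mark _ l (by omega)

/-! ### Enumeration of the changes -/

/-- The number with the digits `D 0, …, D (K - 1)` in base `n + 1`. -/
def numeral (n : ℕ) (D : ℕ → ℕ) (K : ℕ) : ℕ := ∑ k ∈ Finset.range K, D k * (n + 1) ^ k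

theorem numeral_succ (n : ℕ) (D : ℕ → ℕ) (K : ℕ) :
    numeral n D (K + 1) = numeral n D K + D K * (n + 1) ^ K := Finset.sum_range_succ _ _

theorem numeral_lt {n : ℕ} {D : ℕ → ℕ} : ∀ {K : ℕ}, (∀ k < K, D k ≤ n) →
    numeral n D K < (n + 1) ^ K
  | 0, _ => by simp [numeral]
  | K + 1, h => by
    have h1 := numeral_lt (K := K) fun k hk => h k (by omega)
    have h2 : D K * (n + 1) ^ K ≤ n * (n + 1) ^ K := Nat.mul_le_mul_right _ (h K (by omega))
    rw [numeral_succ, pow_succ]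
    linarith

theorem numeral_max {n : ℕ} {D : ℕ → ℕ} : ∀ {K : ℕ}, (∀ k < K, D k = n) →
    numeral n D K + 1 = (n + 1) ^ K
  | 0, _ => by simp [numeral]
  | K + 1, h => by
    have h1 := numeral_max (K := K) fun k hk => h k (by omega)
    rw [numeral_succ, pow_succ, h K (by omega)]
    linarith

/-- Digits `n` below position `k` amount to `(n + 1)^k - 1`, so clearing them and raising digit `k`
adds exactly one. -/
theorem numeral_carry {n : ℕ} {D D' : ℕ → ℕ} {k : ℕ} (h : ∀ j < k, D j = n)
    (h' : ∀ j < k, D' j = 0) (hk : D' k = D k + 1) (hgt : ∀ j, k < j → D' j = D j) :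
    ∀ {K : ℕ}, k < K → numeral n D' K = numeral n D K + 1
  | 0, hK => by omega
  | K + 1, hK => by
    rw [numeral_succ, numeral_succ]
    rcases Nat.lt_succ_iff_lt_or_eq.1 hK with hK' | rfl
    · rw [numeral_carry h h' hk hgt hK', hgt K hK']
      ring
    · have h1 : numeral n D' k = 0 :=
        Finset.sum_eq_zero fun j hj => by rw [h' j (Finset.mem_range.1 hj), zero_mul]
      have h2 := numeral_max h
      rw [h1, hk]
      linarith

/-- Uniqueness of the expansion ensures that counting through the numerals meets every guess. -/
theorem eq_of_numeral_eq {n : ℕ} {D D' : ℕ → ℕ} : ∀ {K : ℕ}, (∀ k < K, D k ≤ n) →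
    (∀ k < K, D' k ≤ n) → numeral n D K = numeral n D' K → ∀ k < K, D k = D' k
  | 0, _, _, _ => by simp
  | K + 1, h, h', he => by
    have h1 := numeral_lt (K := K) fun k hk => h k (by omega)
    have h2 := numeral_lt (K := K) fun k hk => h' k (by omega)
    rw [numeral_succ, numeral_succ] at he
    have hpos : 0 < (n + 1) ^ K := by positivity
    have e1 := congrArg (· / (n + 1) ^ K) he
    have e2 := congrArg (· % (n + 1) ^ K) he
    simp only [Nat.add_mul_div_right _ _ hpos, Nat.add_mul_mod_self_right, Nat.div_eq_of_lt h1,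
      Nat.div_eq_of_lt h2, Nat.mod_eq_of_lt h1, Nat.mod_eq_of_lt h2, zero_add] at e1 e2
    have ih := eq_of_numeral_eq (fun k hk => h k (by omega)) (fun k hk => h' k (by omega)) e2
    intro k hk
    rcases Nat.lt_succ_iff_lt_or_eq.1 hk with hk | rfl
    exacts [ih k hk, e1]

/-- Add one to the number in the array `dig`; clear `go` on overflow. -/
def odometer : Cmd :=
  .k ::= 0 ;;
  .loop (.eq (.arr .dig Var.k) Var.n) (.put .dig Var.k 0 ;; .k ::= Var.k + 1) ;;
  .ite (.lt Var.k Var.K) (.put .dig Var.k (.arr .dig Var.k + 1)) (.go ::= 0)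

theorem odometer_spec {E : Env} {n K t : ℕ} {σ : St} (hn : 1 ≤ n) (hσn : σ.reg .n = n)
    (hσK : σ.reg .K = K) (hD : ∀ k < K, σ.arr .dig k ≤ n) (hD0 : σ.arr .dig K = 0)
    (hb : E.size ≤ E.bound) (hK : K < E.size) (hnE : n < E.size) {Q : ℕ → St → Prop}
    (hQ : ∀ t' σ', t' ≤ t + 100 * (K + 1) →
      (σ'.reg .go = σ.reg .go ∧ (∀ k < K, σ'.arr .dig k ≤ n) ∧ σ'.arr .dig K = 0 ∧
        numeral n (σ'.arr .dig) K = numeral n (σ.arr .dig) K + 1 ∨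
      σ'.reg .go = 0 ∧ numeral n (σ.arr .dig) K + 1 = (n + 1) ^ K) →
      Frame odometer σ σ' → Q t' σ') : WP E odometer Q t σ := by
  refine WP.mono (Q := fun t' σ' => (t' ≤ t + 100 * (K + 1) ∧
      (σ'.reg .go = σ.reg .go ∧ (∀ k < K, σ'.arr .dig k ≤ n) ∧ σ'.arr .dig K = 0 ∧
        numeral n (σ'.arr .dig) K = numeral n (σ.arr .dig) K + 1 ∨
      σ'.reg .go = 0 ∧ numeral n (σ.arr .dig) K + 1 = (n + 1) ^ K)) ∧ Frame odometer σ σ')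
      (WP.frame ?_) fun t' σ' ⟨⟨h1, h2⟩, h3⟩ => hQ t' σ' h1 h2 h3
  simp only [odometer, wp_seq, wp_set]
  refine ⟨by simp, wp_loop (fun f t' σ' => f + σ'.reg .k = K ∧ t' ≤ t + 40 * σ'.reg .k + 5 ∧
    (∀ j < σ'.reg .k, σ'.arr .dig j = 0 ∧ σ.arr .dig j = n) ∧
    ∀ j, σ'.reg .k ≤ j → σ'.arr .dig j = σ.arr .dig j) K ?_ ?_⟩
  · simp
  rintro f t' σ' hf ⟨h1, h2, h3, h4⟩
  have hn' : σ'.reg .n = n := (hf.reg _ rfl).trans hσn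
  have hK' : σ'.reg .K = K := (hf.reg _ rfl).trans hσK
  have hgo' : σ'.reg .go = σ.reg .go := hf.reg _ rfl
  simp [hn', h4 _ le_rfl]
  refine ⟨by omega, fun heq => ?_, fun hne => ?_⟩
  -- Cell `K` is a sentinel: it holds 0, which differs from `n` because `1 ≤ n`, so the carry stops
  -- there at the latest.
  · have hkK : σ'.reg .k ≠ K := by
      intro h
      rw [h, hD0] at heq
      omega
    simp only [wp_seq, wp_put, wp_set]
    simp
    refine ⟨by omega, by omega, f - 1, by omega, by omega, by omega, ?_, ?_⟩
    · intro j hj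
      rcases Nat.lt_or_eq_of_le hj with hj | rfl
      · rw [Function.update_of_ne (by omega)]
        exact h3 j hj
      · simpa using heq
    · intro j hj
      rw [Function.update_of_ne (by omega), h4 j (by omega)]
  · simp only [wp_ite, wp_put, wp_set]
    simp [hK', h4 _ le_rfl]
    refine ⟨fun hlt => ?_, fun hge => ?_⟩
    · have hk := hD _ hlt
      refine ⟨by and_intros <;> omega, by omega, .inl ⟨hgo', ?_, ?_, ?_⟩⟩
      · intro j hj
        rw [Function.update_apply]
        split_ifs with h
        · omega
        · rcases lt_or_ge j (σ'.reg .k) with hj' | hj'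
          · rw [(h3 j hj').1]; omega
          · rw [h4 j hj']; exact hD j hj
      · rw [Function.update_of_ne (by omega), h4 _ (by omega), hD0]
      · refine numeral_carry (k := σ'.reg .k) (fun j hj => (h3 j hj).2) (fun j hj => ?_) ?_
          (fun j hj => ?_) hlt
        · rw [Function.update_of_ne (by omega), (h3 j hj).1]
        · simp
        · rw [Function.update_of_ne (by omega), h4 j (by omega)]
    · have hkK : σ'.reg .k = K := by omega
      refine ⟨by omega, .inr (numeral_max fun j hj => (h3 j (by omega)).2)⟩

/-! ### Exhaustive search over the changes -/

/-- Choosing the changes as in `g` works. -/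
def Raw.Good (I : Raw) (d : ℕ) (g : ℕ → ℕ) : Prop :=
  ∃ f, Respects I.n (adjOf (I.pairs g d I.fs.length)) f

theorem par_congr {g g' : ℕ → ℕ} : ∀ {k : ℕ}, (∀ j < k, g j = g' j) → par g k = par g' k
  | 0, _ => rfl
  | k + 1, h => by
    funext v
    simp [par, par_congr fun j hj => h j (Nat.lt_succ_of_lt hj), h k (Nat.lt_succ_self k)]

theorem Raw.pairs_congr (I : Raw) {g g' : ℕ → ℕ} {d : ℕ} : ∀ {i : ℕ}, (∀ j < i * d, g j = g' j) →
    I.pairs g d i = I.pairs g' d i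
  | 0, _ => rfl
  | i + 1, h => by
    have hle : i * d ≤ (i + 1) * d := Nat.mul_le_mul_right _ (Nat.le_succ i)
    rw [pairs, pairs, par_congr h, I.pairs_congr fun j hj => h j (by omega)]

theorem Raw.mem_pairs {I : Raw} {g : ℕ → ℕ} {d : ℕ} {c : ℕ × ℕ} : ∀ {i : ℕ}, c ∈ I.pairs g d i ↔
    ∃ j < i, ∃ C ∈ I.fs.getD j [], c = clausePair (par g ((j + 1) * d)) C
  | 0 => by simp [pairs]
  | i + 1 => by
    simp only [pairs, List.mem_append, List.mem_reverse, List.mem_map, mem_pairs,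
      Nat.lt_succ_iff_lt_or_eq, or_and_right, exists_or, exists_eq_left]
    rw [or_comm]
    simp only [eq_comm]

theorem Raw.Ok.pairs_lt {I : Raw} (hI : I.Ok) {g : ℕ → ℕ} {d i : ℕ} (hi : i ≤ I.fs.length) :
    ∀ c ∈ I.pairs g d i, c.1 < 2 * I.n ∧ c.2 < 2 * I.n := by
  intro c hc
  obtain ⟨j, hj, C, hC, rfl⟩ := Raw.mem_pairs.1 hc
  rw [List.getD_eq_getElem _ _ (by omega)] at hC
  have hmem : I.fs[j] ∈ I.fs := List.getElem_mem _
  have hpos := List.length_pos_iff.2 (hI.pos _ hmem _ hC)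
  have hlt := hI.lt _ hmem _ hC
  constructor
  all_goals
    refine flipl_lt ?_
    rw [List.getD_eq_getElem _ _ (by omega)]
    exact hlt _ (List.getElem_mem _)

/-- Try all choices of the changes. -/
def search : Cmd :=
  .ans ::= 0 ;;
  .loop (.lt 0 Var.go)
    (build ;; solve ;; .ite (.eq Var.sat 1) (.ans ::= 1 ;; .go ::= 0) odometer)

/-- The invariant is that all guesses with a smaller numeral fail. Building, solving and counting
each take time linear in the size of the combined formula plus the number of digits, together at
most `5000 * U` per guess. -/
theorem search_spec {E : Env} {I : Raw} {d t : ℕ} {σ : St} (hI : I.Ok) (hE : I.InEnv E)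
    (hd : d ≤ I.n) (hσn : σ.reg .n = I.n) (hσd : σ.reg .d = d) (hστ : σ.reg .tau = I.fs.length)
    (hσK : σ.reg .K = I.fs.length * d) (hσg : σ.reg .go = 1) (hdig : ∀ k, σ.arr .dig k = 0)
    {Q : ℕ → St → Prop}
    (hQ : ∀ t' σ', t' ≤ t + 5000 * (I.n + 1 + I.fs.length * (d + 1) + I.clauses) *
        (I.n + 1) ^ (I.fs.length * d) + 20 →
      (σ'.reg .ans = 1 ∧ (∃ g, (∀ k < I.fs.length * d, g k ≤ I.n) ∧ I.Good d g) ∨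
      σ'.reg .ans = 0 ∧ ¬ ∃ g, (∀ k < I.fs.length * d, g k ≤ I.n) ∧ I.Good d g) → Q t' σ') :
    WP E search Q t σ := by
  set K := I.fs.length * d with hK
  set U := I.n + 1 + I.fs.length * (d + 1) + I.clauses with hU
  set N := (I.n + 1) ^ K with hN
  refine WP.mono (Q := fun t' σ' => t' ≤ t + 5000 * U * N + 20 ∧
      (σ'.reg .ans = 1 ∧ (∃ g, (∀ k < K, g k ≤ I.n) ∧ I.Good d g) ∨
      σ'.reg .ans = 0 ∧ ¬ ∃ g, (∀ k < K, g k ≤ I.n) ∧ I.Good d g))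
      ?_ fun t' σ' ⟨h1, h2⟩ => hQ t' σ' h1 h2
  have hb := hE.bound
  have hn := hE.n_lt
  have hcl := hE.clauses_lt
  have hdl := hE.digits_lt
  have hKn : K ≤ I.fs.length * I.n := Nat.mul_le_mul_left _ hd
  have hN0 : 0 < N := by positivity
  simp only [search, wp_seq, wp_set]
  refine ⟨by simp, wp_loop (fun f t' σ' =>
    (σ'.reg .go = 1 ∧ σ'.reg .ans = 0 ∧ (∀ k < K, σ'.arr .dig k ≤ I.n) ∧ σ'.arr .dig K = 0 ∧
      f + numeral I.n (σ'.arr .dig) K = N ∧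
      t' ≤ t + 5000 * U * numeral I.n (σ'.arr .dig) K + 5 ∧
      ∀ g, (∀ k < K, g k ≤ I.n) → numeral I.n g K < numeral I.n (σ'.arr .dig) K → ¬ I.Good d g) ∨
    (σ'.reg .go = 0 ∧ f = 0 ∧ t' ≤ t + 5000 * U * N + 10 ∧
      (σ'.reg .ans = 1 ∧ (∃ g, (∀ k < K, g k ≤ I.n) ∧ I.Good d g) ∨
      σ'.reg .ans = 0 ∧ ¬ ∃ g, (∀ k < K, g k ≤ I.n) ∧ I.Good d g))) N ?_ ?_⟩
  · left
    have h0 : numeral I.n (fun _ => 0) K = 0 := by simp [numeral]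
    have h1 : σ.arr .dig = fun _ => 0 := funext hdig
    simp [hσg, h1, h0]
  rintro f t' σ' hf hinv
  simp only [Cond.ok_lt, Ex.ok_var, Ex.ok_lit, Cond.holds_lt, Ex.eval_var, Ex.eval_lit,
    Cond.cost_lt, Ex.cost_var, Ex.cost_lit]
  rcases hinv with ⟨hgo, hans, hD, hD0, hfu, ht, hno⟩ | ⟨hgo, hf0, ht, hres⟩
  swap
  · refine ⟨⟨by omega, trivial⟩, fun h => by omega, fun _ => ⟨by omega, hres⟩⟩
  refine ⟨⟨by omega, trivial⟩, fun _ => ?_, fun h => by omega⟩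
  have hn' : σ'.reg .n = I.n := (hf.reg _ rfl).trans hσn
  have hd' : σ'.reg .d = d := (hf.reg _ rfl).trans hσd
  have hτ' : σ'.reg .tau = I.fs.length := (hf.reg _ rfl).trans hστ
  have hK' : σ'.reg .K = K := (hf.reg _ rfl).trans hσK
  have hval := numeral_lt hD
  have hUN : 5000 * U * (numeral I.n (σ'.arr .dig) K + 1) ≤ 5000 * U * N :=
    Nat.mul_le_mul_left _ hval
  have hUs : 5000 * U * (numeral I.n (σ'.arr .dig) K + 1) =
    5000 * U * numeral I.n (σ'.arr .dig) K + 5000 * U := by ring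
  have hKU : I.fs.length * (d + 1) = K + I.fs.length := by rw [hK]; ring
  rw [wp_seq]
  refine build_spec hI hE hd hn' hd' hτ' hD fun t₁ σ₁ ht₁ hB₁ hv₁ hm₁ hf₁ => ?_
  rw [← hU] at ht₁
  set Cl := I.pairs (σ'.arr .dig) d I.fs.length with hCl
  have hlen : Cl.length = I.clauses := by
    simpa using I.length_pairs (σ'.arr .dig) d I.fs.length le_rfl
  rw [wp_seq]
  refine solve_spec (S := ⟨I.n, adjOf Cl, σ₁.arr .next, σ₁.arr .tgt, σ₁.reg .e, fun _ => False,
    σ₁.reg .s⟩) (isImplicationGraph_adjOf (hI.pairs_lt le_rfl))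
    ⟨(hf₁.reg _ rfl).trans hn', rfl, hB₁.neg, hB₁.chain, rfl, rfl,
      fun l hl => .inl ⟨hv₁ l hl, id⟩, hb, hn, ?_⟩ hv₁ hm₁ fun t₂ σ₂ ht₂ hs₂ hf₂ => ?_
  · have := hB₁.e
    show σ₁.reg .e < _
    omega
  have hsum := sum_length_adjOf (n := 2 * I.n) Cl
  simp only [Search.wt, Finset.sum_add_distrib, Finset.sum_const, Finset.card_range, smul_eq_mul,
    mul_one] at ht₂
  rw [wp_ite]
  simp only [Cond.ok_eq, Ex.ok_var, Ex.ok_lit, Cond.holds_eq, Ex.eval_var, Ex.eval_lit,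
    Cond.cost_eq, Ex.cost_var, Ex.cost_lit]
  refine ⟨⟨trivial, by omega⟩, fun hsat => ?_, fun hsat => ?_⟩
  · simp only [wp_seq, wp_set]
    simp
    refine ⟨by omega, by omega, by omega, ?_⟩
    rcases hs₂ with ⟨-, hs⟩ | ⟨hs, -⟩
    · exact ⟨σ'.arr .dig, hD, hs⟩
    · omega
  · have hbad : ¬ I.Good d (σ'.arr .dig) := by
      rcases hs₂ with ⟨hs, -⟩ | ⟨-, hs⟩
      · exact (hsat hs).elim
      · exact hs
    have hdig₂ : σ₂.arr .dig = σ'.arr .dig := (hf₂.arr _ rfl).trans (hf₁.arr _ rfl)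
    have hno' : ∀ g, (∀ k < K, g k ≤ I.n) →
        numeral I.n g K < numeral I.n (σ'.arr .dig) K + 1 → ¬ I.Good d g := by
      intro g hg hlt
      rcases Nat.lt_succ_iff_lt_or_eq.1 hlt with hlt | heq
      · exact hno g hg hlt
      -- A guess with the current numeral has the same first `K` digits, and the formula depends on
      -- no others.
      · unfold Raw.Good
        rwa [I.pairs_congr (eq_of_numeral_eq hg hD heq)]
    refine odometer_spec hI.n_pos (K := K) ((hf₂.reg _ rfl).trans ((hf₁.reg _ rfl).trans hn'))
      ((hf₂.reg _ rfl).trans ((hf₁.reg _ rfl).trans hK')) (by rwa [hdig₂]) (by rwa [hdig₂]) hb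
      (by omega) (by omega) fun t₃ σ₃ ht₃ hres hf₃ => ?_
    have hgo₂ : σ₂.reg .go = 1 := ((hf₂.reg _ rfl).trans (hf₁.reg _ rfl)).trans hgo
    have hans₃ : σ₃.reg .ans = 0 :=
      ((hf₃.reg _ rfl).trans ((hf₂.reg _ rfl).trans (hf₁.reg _ rfl))).trans hans
    rw [hdig₂] at hres
    have htime : t₃ ≤ t' + 5000 * U := by
      simp only [mul_add, mul_one] at *
      omega
    rcases hres with ⟨hgo₃, hD₃, hD0₃, hnum⟩ | ⟨hgo₃, hmax⟩
    · refine ⟨f - 1, by omega, .inl ⟨hgo₃.trans hgo₂, hans₃, hD₃, hD0₃, by omega, ?_, ?_⟩⟩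
      · rw [hnum]
        omega
      · rwa [hnum]
    · refine ⟨0, by omega, .inr ⟨hgo₃, rfl, by omega, .inr ⟨hans₃, ?_⟩⟩⟩
      rintro ⟨g, hg, hgood⟩
      refine hno' g hg ?_ hgood
      have := numeral_lt hg
      omega

/-! ### Reading the input -/

/-- No clause of the formula is empty. -/
def NoEmptyClause (φ : List (List ℕ)) : Prop := ∀ C ∈ φ, C ≠ []

theorem noEmptyClause_nil : NoEmptyClause [] := fun _ h => by simp at h

theorem noEmptyClause_append_singleton {φ : List (List ℕ)} {C : List ℕ} :
    NoEmptyClause (φ ++ [C]) ↔ NoEmptyClause φ ∧ C ≠ [] := by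
  simp only [NoEmptyClause, List.forall_mem_append, List.forall_mem_singleton]

/-- Read the clauses of one formula; clear `go` if one of them is empty. -/
def scanFormula : Cmd :=
  .cnt ::= .inp Var.cur ;;
  .cur ::= Var.cur + 1 ;;
  .loop (.lt 0 Var.cnt)
    (.len ::= .inp Var.cur ;;
      .ite (.eq Var.len 0) (.go ::= 0) .skip ;;
      .cur ::= Var.cur + Var.len + 1 ;;
      .cnt ::= Var.cnt - 1)

theorem scanFormula_spec {E : Env} {t : ℕ} {σ : St} {inp rest : List ℕ} {φ : List (List ℕ)}
    (hinp : E.inp = fun a => inp.getD a 0) (hlen : E.len = inp.length)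
    (hsize : inp.length + 3 < E.bound)
    (hcur : inp.drop (σ.reg .cur) = formulaCode φ ++ rest) {Q : ℕ → St → Prop}
    (hQ : ∀ t' σ', t' ≤ t + 50 * φ.length + 20 → inp.drop (σ'.reg .cur) = rest →
      σ'.reg .cur = σ.reg .cur + (formulaCode φ).length →
      (σ'.reg .go = σ.reg .go ∧ NoEmptyClause φ ∨ σ'.reg .go = 0 ∧ ¬ NoEmptyClause φ) →
      Frame scanFormula σ σ' → Q t' σ') :
    WP E scanFormula Q t σ := by
  refine WP.mono (Q := fun t' σ' => (t' ≤ t + 50 * φ.length + 20 ∧ inp.drop (σ'.reg .cur) = rest ∧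
      σ'.reg .cur = σ.reg .cur + (formulaCode φ).length ∧
      (σ'.reg .go = σ.reg .go ∧ NoEmptyClause φ ∨ σ'.reg .go = 0 ∧ ¬ NoEmptyClause φ)) ∧
      Frame scanFormula σ σ') (WP.frame ?_)
    fun t' σ' ⟨⟨h1, h2, h3, h4⟩, h5⟩ => hQ t' σ' h1 h2 h3 h4 h5
  obtain ⟨k0, l0⟩ := getD_of_drop_eq hcur (k := 0) (by simp [formulaCode])
  replace k0 : E.inp (σ.reg .cur) = φ.length := by rw [hinp]; simpa [formulaCode] using k0
  simp only [scanFormula, wp_seq, wp_set]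
  simp [k0]
  refine ⟨by omega, by and_intros <;> omega, ?_⟩
  refine wp_loop (fun f t' σ' => ∃ done rest', φ = done ++ rest' ∧ f = rest'.length ∧
    σ'.reg .cnt = f ∧ inp.drop (σ'.reg .cur) = rest'.flatMap clauseCode ++ rest ∧
    σ'.reg .cur = σ.reg .cur + (formulaCode done).length ∧
    t' ≤ t + 50 * done.length + 10 ∧
    (σ'.reg .go = σ.reg .go ∧ NoEmptyClause done ∨ σ'.reg .go = 0 ∧ ¬ NoEmptyClause done))
    φ.length ⟨[], φ, by simp, rfl, by simp, ?_, by simp [formulaCode], by simp, by simp [noEmptyClause_nil]⟩ ?_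
  · have h1 : inp.drop (σ.reg .cur) = [φ.length] ++ (φ.flatMap clauseCode ++ rest) := by
      simpa [formulaCode] using hcur
    simpa using drop_of_drop_eq h1
  · rintro f t' σ' hf ⟨done, rest', rfl, rfl, hcnt, hcur', hcl, ht', hgo⟩
    simp only [Cond.ok_lt, Ex.ok_var, Ex.ok_lit, Cond.holds_lt, Ex.eval_var, Ex.eval_lit,
      Cond.cost_lt, Ex.cost_var, Ex.cost_lit, hcnt]
    refine ⟨⟨by omega, trivial⟩, fun hpos => ?_, fun hneg => ?_⟩
    swap
    · have hnil : rest' = [] := List.eq_nil_of_length_eq_zero (by omega)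
      subst hnil
      simp only [List.append_nil] at *
      simp at hcur'
      exact ⟨by omega, hcur', hcl, hgo⟩
    rcases rest' with _ | ⟨C, rest'⟩
    · simp at hpos
    · have hc : inp.drop (σ'.reg .cur) = clauseCode C ++ (rest'.flatMap clauseCode ++ rest) := by
        simpa using hcur'
      obtain ⟨k0, l0⟩ := getD_of_drop_eq hc (k := 0) (by simp [clauseCode])
      obtain ⟨-, l1⟩ := getD_of_drop_eq hc (k := C.length) (by simp [clauseCode])
      replace k0 : E.inp (σ'.reg .cur) = C.length := by rw [hinp]; simpa [clauseCode] using k0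
      have hdrop : inp.drop (σ'.reg .cur + C.length + 1) = rest'.flatMap clauseCode ++ rest := by
        simpa [clauseCode, add_assoc] using drop_of_drop_eq hc
      have hcl' : σ'.reg .cur + C.length + 1 =
          σ.reg .cur + (formulaCode (done ++ [C])).length := by
        rw [hcl]
        simp [formulaCode, clauseCode]
        omega
      simp only [wp_seq, wp_set, wp_ite, wp_skip]
      by_cases hC : C = []
      · subst hC
        simp only [List.length_nil, Nat.add_zero] at k0 hdrop hcl' l1
        simp [-List.flatMap_append, k0, hcnt]
        refine ⟨by omega, by and_intros <;> omega, by omega, done ++ [[]], rest',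
          le_rfl, by simp, rfl, by simpa using hdrop, hcl', ?_, .inr ?_⟩
        · simp only [List.length_append, List.length_singleton, mul_add, mul_one]
          linarith
        · simp [noEmptyClause_append_singleton]
      · simp [-List.flatMap_append, k0, hcnt, hC]
        refine ⟨by omega, by and_intros <;> omega, by omega, done ++ [C], rest',
          le_rfl, by simp, rfl, by simpa using hdrop, hcl', ?_, ?_⟩
        · simp only [List.length_append, List.length_singleton, mul_add, mul_one]
          linarith
        · simpa [noEmptyClause_append_singleton, hC] using hgo

/-- Read the instance up to its end; `go` tells whether all clauses are nonempty. -/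
def scan : Cmd :=
  .n ::= .inp 0 ;;
  .tau ::= .inp 1 ;;
  .d ::= .inp 2 ;;
  .cur ::= 3 ;;
  .go ::= 1 ;;
  .i ::= 0 ;;
  .loop (.lt Var.i Var.tau) (scanFormula ;; .i ::= Var.i + 1)

/-- The scan has two purposes: it finds the end of the input, where free memory begins, and it
detects empty clauses, which the pair encoding of clauses cannot represent. -/
theorem scan_spec {E : Env} {I : Raw} {t : ℕ} {σ : St} (hinp : E.inp = fun a => I.input.getD a 0)
    (hlen : E.len = I.input.length) (hsize : I.input.length + 3 < E.bound)
    (hτ : I.fs.length < E.bound)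
    {Q : ℕ → St → Prop}
    (hQ : ∀ t' σ', t' ≤ t + 60 * (I.clauses + I.fs.length) + 50 →
      σ'.reg .n = I.n → σ'.reg .tau = I.fs.length → σ'.reg .d = I.d →
      σ'.reg .cur = I.input.length →
      (σ'.reg .go = 1 ∧ (∀ φ ∈ I.fs, NoEmptyClause φ) ∨
        σ'.reg .go = 0 ∧ ¬ ∀ φ ∈ I.fs, NoEmptyClause φ) →
      Frame scan σ σ' → Q t' σ') :
    WP E scan Q t σ := by
  refine WP.mono (Q := fun t' σ' => (t' ≤ t + 60 * (I.clauses + I.fs.length) + 50 ∧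
      σ'.reg .n = I.n ∧ σ'.reg .tau = I.fs.length ∧ σ'.reg .d = I.d ∧
      σ'.reg .cur = I.input.length ∧
      (σ'.reg .go = 1 ∧ (∀ φ ∈ I.fs, NoEmptyClause φ) ∨
        σ'.reg .go = 0 ∧ ¬ ∀ φ ∈ I.fs, NoEmptyClause φ)) ∧ Frame scan σ σ') (WP.frame ?_)
    fun t' σ' ⟨⟨h1, h2, h3, h4, h5, h6⟩, h7⟩ => hQ t' σ' h1 h2 h3 h4 h5 h6 h7
  have e0 : E.inp 0 = I.n := by rw [hinp]; rfl
  have e1 : E.inp 1 = I.fs.length := by rw [hinp]; rfl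
  have e2 : E.inp 2 = I.d := by rw [hinp]; rfl
  have hlen3 : I.input.length = 3 + (I.fs.flatMap formulaCode).length := by
    simp only [Raw.input, List.length_append]
    rfl
  simp only [scan, wp_seq, wp_set]
  simp [e0, e1, e2]
  refine ⟨by omega, by omega, by omega, by omega, by omega, ?_⟩
  refine wp_loop (fun f t' σ' => ∃ i, σ'.reg .i = i ∧ f + i = I.fs.length ∧
    I.input.drop (σ'.reg .cur) = (I.fs.drop i).flatMap formulaCode ∧
    σ'.reg .cur = 3 + ((I.fs.take i).flatMap formulaCode).length ∧
    t' ≤ t + 30 + 50 * ((I.fs.take i).map List.length).sum + 50 * i ∧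
    (σ'.reg .go = 1 ∧ (∀ φ ∈ I.fs.take i, NoEmptyClause φ) ∨
        σ'.reg .go = 0 ∧ ¬ ∀ φ ∈ I.fs.take i, NoEmptyClause φ)) I.fs.length
    ⟨0, by simp, rfl, by simp [Raw.input], by simp, by simp, by simp⟩ ?_
  rintro f t' σ' hf ⟨i, hi, hfi, hcur, hcl, ht, hgo⟩
  have hτ' : σ'.reg .tau = I.fs.length := by
    rw [hf.reg _ rfl]
    simp
  have hn' : σ'.reg .n = I.n := by
    rw [hf.reg _ rfl]
    simp
  have hd' : σ'.reg .d = I.d := by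
    rw [hf.reg _ rfl]
    simp
  simp only [Cond.ok_lt, Ex.ok_var, Cond.holds_lt, Ex.eval_var, Cond.cost_lt, Ex.cost_var, hi, hτ',
    true_and]
  refine ⟨fun hlt => ?_, fun hge => ?_⟩
  · rw [List.drop_eq_getElem_cons hlt] at hcur
    rw [wp_seq]
    refine scanFormula_spec (φ := I.fs[i]) (rest := (I.fs.drop (i + 1)).flatMap formulaCode)
      hinp hlen hsize (by simpa only [List.flatMap_cons] using hcur) fun t₁ σ₁ ht₁ hcur₁ hcl₁ hgo₁ hf₁ => ?_
    have htake : I.fs.take (i + 1) = I.fs.take i ++ [I.fs[i]] := by simp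
    have hi₁ : σ₁.reg .i = i := (hf₁.reg _ rfl).trans hi
    simp only [wp_set]
    simp only [Ex.ok_add, Ex.ok_var, Ex.ok_lit, Ex.eval_add, Ex.eval_var, Ex.eval_lit, Ex.cost_add,
      Ex.cost_var, Ex.cost_lit, hi₁]
    refine ⟨by simp; omega, f - 1, by omega, i + 1, by simp, by omega, hcur₁, ?_, ?_, ?_⟩
    · rw [htake]
      simp only [St.reg_set]
      simp only [List.flatMap_append, List.length_append, List.flatMap_singleton]
      simp
      rw [hcl₁, hcl]
      simp
      omega
    · rw [htake]
      simp only [List.map_append, List.sum_append, List.map_cons, List.map_nil, List.sum_cons,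
        List.sum_nil, mul_add, mul_one]
      linarith
    · rw [htake]
      simp only [List.forall_mem_append, List.forall_mem_singleton]
      simp only [St.reg_set]
      simp only [reduceCtorEq, if_false]
      rcases hgo with ⟨a1, a2⟩ | ⟨a1, a2⟩ <;> rcases hgo₁ with ⟨b1, b2⟩ | ⟨b1, b2⟩
      · exact .inl ⟨b1.trans a1, a2, b2⟩
      · exact .inr ⟨b1, fun h => b2 h.2⟩
      · exact .inr ⟨b1.trans a1, fun h => a2 h.1⟩
      · exact .inr ⟨b1, fun h => b2 h.2⟩
  · have hi' : i = I.fs.length := by omega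
    subst hi'
    rw [List.take_length] at hcl ht hgo
    have e3 : (I.fs.map List.length).sum = I.clauses := rfl
    exact ⟨by omega, hn', hd', by omega, by simpa using hgo⟩

/-! ### Correctness of the search -/

/-- The assignment `h` satisfies the literal `l`. -/
def LitTrue (h : ℕ → Bool) (l : ℕ) : Prop := h (l / 2) = decide (l % 2 = 1)

theorem litTrue_negl {h : ℕ → Bool} {l : ℕ} : LitTrue h (negl l) ↔ ¬ LitTrue h l := by
  have h1 : negl l / 2 = l / 2 := by unfold negl; omega
  have h2 : negl l % 2 = 1 - l % 2 := by unfold negl; omega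
  unfold LitTrue
  rw [h1, h2]
  rcases Nat.mod_two_eq_zero_or_one l with h | h <;> simp [h]

/-- Negating literals along `p` is the same as changing the assignment along `p`. This merges all
stages into one formula. -/
theorem litTrue_flipl {h p : ℕ → Bool} {l : ℕ} :
    LitTrue h (flipl p l) ↔ LitTrue (fun v => xor (h v) (p v)) l := by
  unfold flipl
  split_ifs with hp
  · rw [litTrue_negl]
    unfold LitTrue
    simp only [hp, Bool.xor_true]
    cases h (l / 2) <;> cases decide (l % 2 = 1) <;> simp
  · unfold LitTrue
    simp [hp]

/-- First and last entry exhaust a nonempty clause of width at most two. This is where the width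
matters. -/
theorem exists_mem_iff_getD {P : ℕ → Prop} : ∀ {C : List ℕ}, C ≠ [] → C.length ≤ 2 →
    ((∃ l ∈ C, P l) ↔ P (C.getD 0 0) ∨ P (C.getD (C.length - 1) 0))
  | [], h, _ => (h rfl).elim
  | [a], _, _ => by simp
  | [a, b], _, _ => by simp
  | _ :: _ :: _ :: _, _, h => by simp at h

theorem Raw.Ok.good_iff {I : Raw} (hI : I.Ok) {d : ℕ} {g : ℕ → ℕ} : I.Good d g ↔
    ∃ h : ℕ → Bool, ∀ j < I.fs.length, ∀ C ∈ I.fs.getD j [], ∃ l ∈ C,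
      LitTrue (fun v => xor (h v) (par g ((j + 1) * d) v)) l := by
  have key : ∀ (h : ℕ → Bool) (j : ℕ), j < I.fs.length → ∀ C ∈ I.fs.getD j [],
      ((∃ l ∈ C, LitTrue (fun v => xor (h v) (par g ((j + 1) * d) v)) l) ↔
        LitTrue h (clausePair (par g ((j + 1) * d)) C).1 ∨
        LitTrue h (clausePair (par g ((j + 1) * d)) C).2) := by
    intro h j hj C hC
    rw [List.getD_eq_getElem _ _ hj] at hC
    have hmem : I.fs[j] ∈ I.fs := List.getElem_mem _
    rw [exists_mem_iff_getD (hI.pos _ hmem _ hC) (hI.width _ hmem _ hC)]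
    simp only [clausePair, litTrue_flipl]
  constructor
  · rintro ⟨f, hf⟩
    classical
    obtain ⟨hneg, hcl⟩ := (respects_adjOf (hI.pairs_lt le_rfl)).1 hf
    -- The positive literal of `v` has the number `2 * v + 1`.
    refine ⟨fun v => decide (f (2 * v + 1)), fun j hj C hC => ?_⟩
    have hlit : ∀ l < 2 * I.n, (LitTrue (fun v => decide (f (2 * v + 1))) l ↔ f l) := by
      intro l hl
      rcases Nat.mod_two_eq_zero_or_one l with h | h
      · have e : 2 * (l / 2) + 1 = negl l := by unfold negl; omega
        simp [LitTrue, h, e, hneg l hl]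
      · have e : 2 * (l / 2) + 1 = l := by omega
        simp [LitTrue, h, e]
    rw [key _ j hj C hC]
    have hm := (Raw.mem_pairs (g := g) (d := d)).2 ⟨j, hj, C, hC, rfl⟩
    have hlt := hI.pairs_lt le_rfl _ hm
    rw [hlit _ hlt.1, hlit _ hlt.2]
    exact hcl _ hm
  · rintro ⟨h, hh⟩
    refine ⟨LitTrue h, (respects_adjOf (hI.pairs_lt le_rfl)).2 ⟨fun l _ => litTrue_negl, ?_⟩⟩
    intro c hc
    obtain ⟨j, hj, C, hC, rfl⟩ := Raw.mem_pairs.1 hc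
    exact (key h j hj C hC).1 (hh j hj C hC)

theorem par_add_of_ne {g : ℕ → ℕ} {a v : ℕ} : ∀ {r : ℕ}, (∀ k < r, g (a + k) ≠ v) →
    par g (a + r) v = par g a v
  | 0, _ => rfl
  | r + 1, h => by
    rw [← add_assoc]
    simp [par, par_add_of_ne fun k hk => h k (Nat.lt_succ_of_lt hk), h r (Nat.lt_succ_self r)]

/-- A block that lists distinct variables and is padded with `n` flips precisely the listed ones;
the padding never equals `v`, since `v < n`. -/
theorem par_add_of_list {g : ℕ → ℕ} {a v n : ℕ} {L : List ℕ} (hv : v < n) (hL : L.Nodup) :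
    ∀ {r : ℕ}, (∀ k < r, g (a + k) = L.getD k n) →
      par g (a + r) v = xor (par g a v) (decide (v ∈ L.take r))
  | 0, _ => by simp
  | r + 1, h => by
    rw [← add_assoc]
    simp only [par, par_add_of_list hv hL fun k hk => h k (Nat.lt_succ_of_lt hk),
      h r (Nat.lt_succ_self r)]
    by_cases hr : r < L.length
    · rw [List.getD_eq_getElem _ _ hr]
      have hnot : L[r] ∉ L.take r := by
        intro hm
        obtain ⟨i, hi, he⟩ := List.getElem_of_mem hm
        rw [List.getElem_take] at he
        have := (hL.getElem_inj_iff).1 he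
        simp at hi
        omega
      have hm : v ∈ L.take (r + 1) ↔ v ∈ L.take r ∨ L[r] = v := by
        rw [List.take_succ_eq_append_getElem hr, List.mem_append,
          List.mem_singleton, eq_comm (a := v)]
      simp only [hm]
      by_cases hv' : L[r] = v
      · subst hv'
        simp only [hnot]
        simp
      · simp only [hv']
        simp
    · rw [List.take_of_length_le (by omega), List.take_of_length_le (by omega)]
      have : n ≠ v := by omega
      rw [List.getD_eq_default _ _ (Nat.le_of_not_lt hr)]
      simp only [this]
      simp

/-- The instance has satisfying assignments that change slowly. -/
def Raw.Yes (I : Raw) : Prop :=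
  ∃ F : ℕ → ℕ → Bool,
    (∀ j < I.fs.length, ∀ C ∈ I.fs.getD j [], ∃ l ∈ C, LitTrue (F j) l) ∧
    ∀ j, j + 1 < I.fs.length → ((Finset.range I.n).filter fun v => F j v ≠ F (j + 1) v).card ≤ I.d

/-- From slowly changing assignments, list the changes before each stage; conversely, a block of `d`
digits alters at most `d` variables. Capping by `n` loses nothing, as only `n` variables exist. -/
theorem Raw.Ok.yes_iff {I : Raw} (hI : I.Ok) : I.Yes ↔
    ∃ g, (∀ k < I.fs.length * min I.d I.n, g k ≤ I.n) ∧ I.Good (min I.d I.n) g := by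
  set d := min I.d I.n with hd
  simp only [hI.good_iff]
  constructor
  · rintro ⟨F, hsat, hF⟩
    -- The first stage also owns a block of digits. It stays empty here, so that the unknown
    -- assignment is `F 0`.
    set L : ℕ → List ℕ := fun j => if j = 0 then [] else
      ((Finset.range I.n).filter fun v => F (j - 1) v ≠ F j v).toList with hLdef
    have hLn : ∀ j, (L j).Nodup := by
      intro j
      simp only [hLdef]
      split_ifs
      exacts [List.nodup_nil, Finset.nodup_toList _]
    have hLlt : ∀ j, ∀ v ∈ L j, v < I.n := by
      intro j v hv
      simp only [hLdef] at hv
      split_ifs at hv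
      · simp at hv
      · rw [Finset.mem_toList, Finset.mem_filter, Finset.mem_range] at hv
        exact hv.1
    have hLlen : ∀ j < I.fs.length, (L j).length ≤ d := by
      intro j hj
      simp only [hLdef]
      split_ifs with h0
      · simp
      · rw [Finset.length_toList, hd]
        refine le_min ?_ ((Finset.card_filter_le _ _).trans (by simp))
        have := hF (j - 1) (by omega)
        rwa [show j - 1 + 1 = j by omega] at this
    set g : ℕ → ℕ := fun k => (L (k / d)).getD (k % d) I.n with hg
    have hblock : ∀ j, ∀ r < d, g (j * d + r) = (L j).getD r I.n := by
      intro j r hr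
      simp only [hg]
      rw [mul_comm, Nat.mul_add_div (by omega), Nat.mul_add_mod, Nat.div_eq_of_lt hr,
        Nat.mod_eq_of_lt hr, add_zero]
    -- The changes telescope: the accumulated parity is the difference between the first stage and
    -- stage `j`.
    have hpar : ∀ j < I.fs.length, ∀ v < I.n, par g ((j + 1) * d) v = xor (F 0 v) (F j v) := by
      intro j
      induction j with
      | zero =>
        intro hj v hv
        rw [add_mul, one_mul, par_add_of_list hv (hLn 0) (hblock 0)]
        simp [par, hLdef]
      | succ j ih =>
        intro hj v hv
        rw [add_mul, one_mul, par_add_of_list hv (hLn (j + 1)) (hblock (j + 1)),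
          List.take_of_length_le (hLlen _ hj), ih (by omega) v hv]
        have hm : v ∈ L (j + 1) ↔ F j v ≠ F (j + 1) v := by
          simp [hLdef, hv]
        simp only [hm]
        cases F 0 v <;> cases F j v <;> cases F (j + 1) v <;> rfl
    refine ⟨g, fun k _ => ?_, F 0, fun j hj C hC => ?_⟩
    · simp only [hg]
      by_cases hk : k % d < (L (k / d)).length
      · rw [List.getD_eq_getElem _ _ hk]
        exact (hLlt _ _ (List.getElem_mem _)).le
      · rw [List.getD_eq_default _ _ (Nat.le_of_not_lt hk)]
    · obtain ⟨l, hl, ht⟩ := hsat j hj C hC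
      refine ⟨l, hl, ?_⟩
      rw [List.getD_eq_getElem _ _ hj] at hC
      have hlt := hI.lt _ (List.getElem_mem _) _ hC _ hl
      unfold LitTrue at ht ⊢
      beta_reduce
      rw [hpar j hj _ (by omega), ← ht]
      cases F 0 (l / 2) <;> simp
  · rintro ⟨g, -, h, hsat⟩
    refine ⟨fun j v => xor (h v) (par g ((j + 1) * d) v), hsat, fun j _ => ?_⟩
    refine le_trans ?_ (min_le_left I.d I.n)
    rw [← hd]
    -- Consecutive parities can differ only at values occurring in the block of `d` digits between
    -- them.
    have hsub : ((Finset.range I.n).filter fun v => xor (h v) (par g ((j + 1) * d) v) ≠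
        xor (h v) (par g ((j + 1 + 1) * d) v)) ⊆
        (Finset.range d).image fun k => g ((j + 1) * d + k) := by
      intro v hv
      rw [Finset.mem_filter] at hv
      by_contra hcon
      refine hv.2 ?_
      rw [add_mul (j + 1) 1 d, one_mul, par_add_of_ne fun k hk hgk => hcon ?_]
      exact Finset.mem_image.2 ⟨k, Finset.mem_range.2 hk, hgk⟩
    exact (Finset.card_le_card hsub).trans (Finset.card_image_le.trans (by simp))

/-! ### Instances as lists of numbers -/

/-- The instance with literals replaced by their numbers. -/
def raw (I : MultistageSAT 2) : Raw where
  n := I.n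
  d := I.d
  fs := (List.ofFn I.formula).map (List.map (List.map encodeLiteral))

variable (I : MultistageSAT 2)

theorem length_fs_raw : (raw I).fs.length = I.τ := by simp [raw]

theorem getD_fs_raw (j : Fin I.τ) :
    (raw I).fs.getD j [] = (I.formula j).map (List.map encodeLiteral) := by
  rw [List.getD_eq_getElem _ _ (by simp [raw])]
  simp [raw]

theorem forall_mem_fs_raw {P : List (List ℕ) → Prop} :
    (∀ φ ∈ (raw I).fs, P φ) ↔ ∀ j, P ((I.formula j).map (List.map encodeLiteral)) := by
  simp [raw, List.mem_ofFn]

theorem formulaCode_map_encodeLiteral {n : ℕ} (φ : CNF (Fin n)) :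
    formulaCode (φ.map (List.map encodeLiteral)) = encodeCNF φ := by
  simp only [formulaCode, encodeCNF, List.length_map, List.flatMap_map]
  congr 1
  refine List.flatMap_congr fun C _ => ?_
  simp [clauseCode, encodeClause]

theorem input_raw : (raw I).input = I.encode := by
  unfold Raw.input MultistageSAT.encode
  rw [length_fs_raw]
  simp only [raw, List.flatMap_map, formulaCode_map_encodeLiteral]

theorem encodeLiteral_lt {n : ℕ} (l : Literal (Fin n)) : encodeLiteral l < 2 * n := by
  have h1 := l.1.isLt
  have h2 := Bool.toNat_le l.2
  unfold encodeLiteral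
  omega

theorem ok_raw (hn : 1 ≤ I.n) (h : ∀ φ ∈ (raw I).fs, NoEmptyClause φ) : (raw I).Ok where
  n_pos := hn
  pos := h
  width := by
    rw [forall_mem_fs_raw]
    intro j C hC
    obtain ⟨C', hC', rfl⟩ := List.mem_map.1 hC
    simpa using I.width_le j C' hC'
  lt := by
    rw [forall_mem_fs_raw]
    intro j C hC l hl
    obtain ⟨C', hC', rfl⟩ := List.mem_map.1 hC
    obtain ⟨l', -, rfl⟩ := List.mem_map.1 hl
    exact encodeLiteral_lt l'

theorem litTrue_encodeLiteral {n : ℕ} {h : ℕ → Bool} (l : Literal (Fin n)) :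
    LitTrue h (encodeLiteral l) ↔ h l.1 = l.2 := by
  obtain ⟨v, b⟩ := l
  have h1 : encodeLiteral (v, b) / 2 = v := by
    have := Bool.toNat_le b
    simp only [encodeLiteral]
    omega
  have h2 : decide (encodeLiteral (v, b) % 2 = 1) = b := by
    simp only [encodeLiteral]
    cases b <;> simp
  rw [LitTrue, h1, h2]

theorem satisfies_iff {n : ℕ} {h : ℕ → Bool} {φ : CNF (Fin n)} :
    Satisfies (fun v : Fin n => h v) φ ↔
      ∀ C ∈ φ.map (List.map encodeLiteral), ∃ l ∈ C, LitTrue h l := by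
  rw [List.forall_mem_map]
  simp only [Satisfies, List.mem_map, exists_exists_and_eq_and, litTrue_encodeLiteral]

theorem card_filter_range {n : ℕ} (P : ℕ → Prop) [DecidablePred P] :
    ((Finset.range n).filter P).card = (Finset.univ.filter fun v : Fin n => P v).card := by
  refine (Finset.card_bij (fun (v : Fin n) _ => (v : ℕ)) ?_ ?_ ?_).symm
  · intro v hv
    simpa using hv
  · intro v _ w _ h
    exact Fin.ext h
  · intro v hv
    rw [Finset.mem_filter, Finset.mem_range] at hv
    exact ⟨⟨v, hv.1⟩, by simpa using hv.2, rfl⟩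

theorem isYes_iff : I.IsYes ↔ (raw I).Yes := by
  unfold Raw.Yes MultistageSAT.IsYes
  rw [length_fs_raw]
  constructor
  · rintro ⟨f, hsat, hd⟩
    set F : ℕ → ℕ → Bool := fun j v =>
      if h : j < I.τ ∧ v < I.n then f ⟨j, h.1⟩ ⟨v, h.2⟩ else false with hF
    have hFf : ∀ (j : Fin I.τ) (v : Fin I.n), F j v = f j v := fun j v => by simp [hF]
    refine ⟨F, fun j hj => ?_, fun j hj => ?_⟩
    · rw [getD_fs_raw I ⟨j, hj⟩, ← satisfies_iff]
      convert hsat ⟨j, hj⟩ using 2 with v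
      exact hFf ⟨j, hj⟩ v
    · refine le_trans (le_of_eq ?_) (hd ⟨j, by omega⟩ ⟨j + 1, hj⟩ rfl)
      rw [show (raw I).n = I.n from rfl, card_filter_range]
      congr 1
      refine Finset.filter_congr fun v _ => ?_
      rw [← hFf, ← hFf]
  · rintro ⟨F, hsat, hd⟩
    refine ⟨fun j v => F j v, fun j => ?_, fun i j hij => ?_⟩
    · rw [satisfies_iff, ← getD_fs_raw]
      exact hsat j j.isLt
    · have := hd i (by omega)
      rw [show (raw I).n = I.n from rfl, card_filter_range, ← hij] at this
      exact this

theorem not_isYes_of_empty_clause (h : ¬ ∀ φ ∈ (raw I).fs, NoEmptyClause φ) : ¬ I.IsYes := by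
  rintro ⟨f, hsat, -⟩
  refine h ((forall_mem_fs_raw I).2 fun j C hC => ?_)
  obtain ⟨C', hC', rfl⟩ := List.mem_map.1 hC
  obtain ⟨l, hl, -⟩ := hsat j C' hC'
  rintro h0
  rw [List.map_eq_nil_iff] at h0
  simp [h0] at hl

theorem sum_map_le_length_mul {α : Type*} {f : α → ℕ} {b : ℕ} : ∀ {l : List α}, (∀ x ∈ l, f x ≤ b) →
    (l.map f).sum ≤ l.length * b
  | [], _ => by simp
  | x :: l, h => by
    have h1 := h x (by simp)
    have h2 := sum_map_le_length_mul fun y hy => h y (List.mem_cons_of_mem x hy)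
    simp only [List.map_cons, List.sum_cons, List.length_cons, add_mul, one_mul]
    omega

theorem length_formula_le_m (j : Fin I.τ) : (I.formula j).length ≤ I.m :=
  Finset.le_sup (f := fun i => (I.formula i).length) (Finset.mem_univ j)

theorem clauses_raw_le : (raw I).clauses ≤ I.τ * I.m := by
  rw [← length_fs_raw I]
  refine sum_map_le_length_mul ?_
  rw [forall_mem_fs_raw]
  intro j
  simpa using length_formula_le_m I j

theorem length_input_raw_le : (raw I).input.length ≤ 3 + I.τ * (1 + I.m * 3) := by
  simp only [Raw.input, List.length_append, List.length_flatMap, List.length_cons, List.length_nil]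
  rw [← length_fs_raw I]
  refine Nat.add_le_add_left (sum_map_le_length_mul ?_) _
  rw [forall_mem_fs_raw]
  intro j
  simp only [formulaCode, List.length_cons, List.length_flatMap]
  have h1 : ((((I.formula j).map (List.map encodeLiteral)).map
      fun C => (clauseCode C).length)).sum ≤ (I.formula j).length * 3 := by
    refine (sum_map_le_length_mul (b := 3) fun C hC => ?_).trans (by simp)
    obtain ⟨C', hC', rfl⟩ := List.mem_map.1 hC
    have := I.width_le j C' hC'
    simp [clauseCode]
    omega
  have := Nat.mul_le_mul_right 3 (length_formula_le_m I j)
  omega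

theorem input_raw_le {x : ℕ} (hx : x ∈ (raw I).input) :
    x ≤ 2 * (I.n + I.m + I.τ + I.d + 2) := by
  simp only [Raw.input, List.mem_append, List.mem_flatMap, List.mem_cons, List.not_mem_nil,
    or_false, length_fs_raw] at hx
  rcases hx with (rfl | rfl | rfl) | ⟨φ, hφ, hx⟩
  · simp only [raw]; omega
  · omega
  · simp only [raw]; omega
  · revert φ
    rw [forall_mem_fs_raw]
    intro j hx
    simp only [formulaCode, clauseCode, List.mem_cons, List.mem_flatMap, List.length_map] at hx
    rcases hx with rfl | ⟨C, hC, hx⟩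
    · have := length_formula_le_m I j
      omega
    · obtain ⟨C', hC', rfl⟩ := List.mem_map.1 hC
      rcases hx with rfl | hx
      · have := I.width_le j C' hC'
        simp only [List.length_map]
        omega
      · obtain ⟨l, -, rfl⟩ := List.mem_map.1 hx
        have := encodeLiteral_lt l
        omega

/-! ### The program -/

/-- After an empty clause has been found, the loop is never entered and the answer stays 0. -/
theorem search_spec_of_go_eq_zero {E : Env} {t : ℕ} {σ : St} (hgo : σ.reg .go = 0)
    {Q : ℕ → St → Prop} (hQ : ∀ t' σ', t' ≤ t + 20 → σ'.reg .ans = 0 → Q t' σ') :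
    WP E search Q t σ := by
  simp only [search, wp_seq, wp_set]
  refine ⟨by simp, wp_loop (fun f t' σ' => f = 0 ∧ σ'.reg .go = 0 ∧ σ'.reg .ans = 0 ∧ t' ≤ t + 2)
    0 ⟨rfl, by simp [hgo], by simp, by simp⟩ ?_⟩
  rintro f t' σ' - ⟨rfl, h1, h2, ht⟩
  refine ⟨by simp, fun h => ?_, fun _ => hQ _ _ ?_ h2⟩
  · simp [h1] at h
  · simp [Cond.cost]
    omega

/-- Cap the number of changes by the number of variables and compute the number of digits. -/
def prepare : Cmd :=
  .ite (.lt Var.n Var.d) (.d ::= Var.n) .skip ;;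
  .K ::= Var.tau * Var.d

theorem prepare_spec {E : Env} {t : ℕ} {σ : St}
    (hK : σ.reg .tau * min (σ.reg .d) (σ.reg .n) ≤ E.bound) {Q : ℕ → St → Prop}
    (hQ : ∀ t' σ', t' ≤ t + 20 → σ'.reg .d = min (σ.reg .d) (σ.reg .n) →
      σ'.reg .K = σ.reg .tau * min (σ.reg .d) (σ.reg .n) → Frame prepare σ σ' → Q t' σ') :
    WP E prepare Q t σ := by
  refine WP.mono (Q := fun t' σ' => (t' ≤ t + 20 ∧ σ'.reg .d = min (σ.reg .d) (σ.reg .n) ∧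
      σ'.reg .K = σ.reg .tau * min (σ.reg .d) (σ.reg .n)) ∧ Frame prepare σ σ') (WP.frame ?_)
    fun t' σ' ⟨⟨h1, h2, h3⟩, h4⟩ => hQ t' σ' h1 h2 h3 h4
  simp only [prepare, wp_seq, wp_ite, wp_set, wp_skip]
  by_cases h : σ.reg .n < σ.reg .d
  · rw [min_eq_right h.le] at hK ⊢
    simp [Cond.Ok, Cond.Holds, Cond.cost, h, hK]
  · rw [min_eq_left (not_lt.1 h)] at hK ⊢
    simp [Cond.Ok, Cond.Holds, Cond.cost, h, hK]

/-- Read the instance and search; register `40` receives the address of the first free cell. -/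
def solver : Program :=
  .seq scan.compile (.seq (.instr (.move 40 Var.cur.idx)) (prepare ;; search).compile)

/-- The registers and arrays at the beginning. -/
def St.zero : St := ⟨fun _ => 0, fun _ _ => 0⟩

theorem rel_initial {E : Env} {B : ℕ} {l : List ℕ} (hinp : E.inp = fun a => l.getD a 0)
    (hlen : E.len = l.length) (hsize : E.size = 0) (hl : ∀ x ∈ l, x ≤ B) :
    Rel E B .zero (initial l) where
  reg_le _ := Nat.zero_le _
  mem_le a := by
    by_cases ha : a < l.length
    · simp only [initial]
      rw [List.getD_eq_getElem _ _ ha]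
      exact hl _ (List.getElem_mem ha)
    · simp only [initial]
      rw [List.getD_eq_default _ _ (not_lt.1 ha)]
      exact Nat.zero_le _
  reg _ := rfl
  base h := by omega
  inp a _ := by rw [hinp]; rfl
  arr j i := by
    simp only [initial, St.zero]
    rw [List.getD_eq_default _ _ (by omega)]

/-- Register 6 is the reading position, which ends at the length of the input. Storing it in
register 40 makes arrays addressable, so the array size may now become positive. -/
theorem Rel.setBase {E : Env} {B : ℕ} {σ : St} {s : Store} (h : Rel E B σ s) {b z : ℕ}
    (hlen : s.reg 6 = E.len) :
    Rel { E with bound := b, size := z } B σ (s.setReg 40 (s.reg 6)) where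
  reg_le r := by
    simp only [Store.setReg, Function.update_apply]
    split_ifs
    exacts [h.reg_le _, h.reg_le r]
  mem_le := h.mem_le
  reg r := by
    have := r.idx_lt
    simp only [Store.setReg]
    rw [Function.update_of_ne (by omega), h.reg]
  base _ := by simp [Store.setReg, hlen]
  inp := h.inp
  arr := h.arr

theorem decidesWithin_solver (I : MultistageSAT 2) {A B : ℕ} (hn : 1 ≤ I.n)
    (hA₁ : 2 * I.n + 4 < A) (hA₂ : 2 * (I.τ * I.m) + 1 < A) (hA₃ : I.τ * I.n + 1 < A)
    (hA₄ : 6 + I.τ * (1 + I.m * 3) < A) (hA₅ : I.τ < A)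
    (hB : 3 + I.τ * (1 + I.m * 3) + 16 * A + 16 ≤ B) (hin : ∀ x ∈ I.encode, x ≤ B) :
    DecidesWithin solver I B (5000 * (I.n + 1 + I.τ * (min I.d I.n + 1) + I.τ * I.m) *
      (I.n + 1) ^ (I.τ * min I.d I.n) + 60 * (I.τ * I.m + I.τ) + 100) := by
  set R := raw I with hR
  have hlenR : R.input.length ≤ 3 + I.τ * (1 + I.m * 3) := length_input_raw_le I
  have hcR : R.clauses ≤ I.τ * I.m := clauses_raw_le I
  have hτR : R.fs.length = I.τ := length_fs_raw I
  have hnR : R.n = I.n := rfl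
  have hdR : R.d = I.d := rfl
  -- Array size 0 during the scan: the base address is not yet known, and `Rel.base` asks nothing.
  set E₁ : Env := ⟨fun a => R.input.getD a 0, R.input.length, A, 0⟩ with hE₁
  set E₂ : Env := ⟨fun a => R.input.getD a 0, R.input.length, A, A⟩ with hE₂
  have hIn : R.InEnv E₂ := ⟨rfl, rfl, le_rfl, hA₁,
    show 2 * R.clauses + 1 < A by omega, by rw [hτR]; exact hA₃,
    show R.input.length + 3 < A by omega⟩
  have hfit₁ : E₁.Fits B := ⟨show A ≤ B by omega, show R.input.length + 16 * 0 + 16 ≤ B by omega⟩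
  have hfit₂ : E₂.Fits B := ⟨show A ≤ B by omega, show R.input.length + 16 * A + 16 ≤ B by omega⟩
  have hrel₀ : Rel E₁ B .zero (initial I.encode) := by
    rw [← input_raw] at hin ⊢
    exact rel_initial rfl rfl rfl hin
  obtain ⟨t₁, σ₁, hrun₁, ht₁, hσn, hστ, hσd, hcur, hgo, hdig⟩ : WP E₁ scan (fun t' σ' =>
      t' ≤ 60 * (R.clauses + R.fs.length) + 50 ∧ σ'.reg .n = R.n ∧ σ'.reg .tau = R.fs.length ∧
      σ'.reg .d = R.d ∧ σ'.reg .cur = R.input.length ∧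
      (σ'.reg .go = 1 ∧ (∀ φ ∈ R.fs, NoEmptyClause φ) ∨
        σ'.reg .go = 0 ∧ ¬ ∀ φ ∈ R.fs, NoEmptyClause φ) ∧ ∀ k, σ'.arr .dig k = 0) 0 .zero := by
    refine scan_spec (I := R) rfl rfl hIn.len_lt (by rw [hτR]; exact hA₅)
      fun t' σ' h1 h2 h3 h4 h5 h6 h7 => ⟨by omega, h2, h3, h4, h5, h6, fun k => ?_⟩
    rw [h7.arr .dig rfl]
    rfl
  rw [zero_add] at ht₁
  rw [hτR] at ht₁ hστ
  obtain ⟨s₁, hex₁, hrel₁⟩ := hrun₁.exec_compile hfit₁ hrel₀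
  have h6 : s₁.reg 6 = R.input.length := (hrel₁.reg .cur).trans hcur
  have hrel₂ : Rel E₂ B σ₁ (s₁.setReg 40 (s₁.reg 6)) := hrel₁.setBase h6
  set T := 5000 * (I.n + 1 + I.τ * (min I.d I.n + 1) + I.τ * I.m) *
      (I.n + 1) ^ (I.τ * min I.d I.n) with hT
  obtain ⟨t₂, σ₂, hrun₂, ht₂, hans⟩ : WP E₂ (prepare ;; search) (fun t' σ' => t' ≤ T + 40 ∧
      (I.IsYes → σ'.reg .ans = 1) ∧ (¬ I.IsYes → σ'.reg .ans = 0)) 0 σ₁ := by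
    rw [wp_seq]
    refine prepare_spec ?_ fun t' σ' ht' hd' hK' hf' => ?_
    · rw [hσn, hστ, hσd]
      have : I.τ * min R.d R.n ≤ I.τ * I.n := Nat.mul_le_mul_left _ (min_le_right _ _)
      exact this.trans (by show _ ≤ A; omega)
    · rw [hσn, hσd] at hd' hK'
      rw [hστ] at hK'
      rcases hgo with ⟨hgo, hne⟩ | ⟨hgo, hne⟩
      · have hok : R.Ok := ok_raw I hn hne
        refine search_spec (I := R) (d := min R.d R.n) hok hIn (min_le_right _ _)
          ((hf'.reg _ rfl).trans hσn) hd' ((hf'.reg _ rfl).trans (hστ.trans hτR.symm))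
          (by rw [hK', hτR]) ((hf'.reg _ rfl).trans hgo)
          (fun k => by rw [hf'.arr _ rfl]; exact hdig k) fun t'' σ'' ht'' hans => ?_
        rw [isYes_iff, hok.yes_iff]
        refine ⟨?_, ?_, ?_⟩
        · rw [hτR] at ht''
          have : 5000 * (R.n + 1 + I.τ * (min R.d R.n + 1) + R.clauses) *
              (R.n + 1) ^ (I.τ * min R.d R.n) ≤ T := by
            rw [hT, hnR, hdR]
            gcongr
          omega
        · intro hy
          exact (hans.resolve_right fun h => h.2 hy).1
        · intro hy
          exact (hans.resolve_left fun h => hy h.2).1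
      · have hno := not_isYes_of_empty_clause I hne
        refine search_spec_of_go_eq_zero ((hf'.reg _ rfl).trans hgo) fun t'' σ'' ht'' hans =>
          ⟨by omega, fun hy => (hno hy).elim, fun _ => hans⟩
  rw [zero_add] at ht₂
  obtain ⟨s₂, hex₂, hrel₃⟩ := hrun₂.exec_compile hfit₂ hrel₂
  have h0 : s₂.reg 0 = σ₂.reg .ans := hrel₃.reg .ans
  refine ⟨t₁ + (1 + t₂), s₂, by omega, .seq hex₁ (.seq (.instr (hrel₁.reg_le 6)) hex₂), ?_, ?_⟩
  · rw [h0]; exact hans.1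
  · rw [h0]; exact hans.2

/-- The cap `min d n` keeps the number of digits below `τ * n`, so the cost per guess is linear in
`τ * (n + m)` for every `d`. The constant covers `5000 * 4 + 160`. -/
theorem solver_time_le {n m τ d : ℕ} (hn : 1 ≤ n) (hτ : 1 ≤ τ) :
    5000 * (n + 1 + τ * (min d n + 1) + τ * m) * (n + 1) ^ (τ * min d n) + 60 * (τ * m + τ) + 100 ≤
      20200 * (n ^ (2 * τ * d) * 2 ^ (τ * d + 1) * τ * (n + m)) := by
  set X := n ^ (2 * τ * d) * 2 ^ (τ * d + 1) with hX
  have h1 : (n + 1) ^ (τ * min d n) ≤ X := by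
    calc (n + 1) ^ (τ * min d n) ≤ (n + 1) ^ (τ * d) :=
          Nat.pow_le_pow_right (by omega) (Nat.mul_le_mul_left _ (min_le_left _ _))
      -- `n + 1 ≤ 2 * n` needs `1 ≤ n`; the factor 2 accounts for the power of two in the bound.
      _ ≤ (n * 2) ^ (τ * d) := Nat.pow_le_pow_left (by omega) _
      _ = n ^ (τ * d) * 2 ^ (τ * d) := mul_pow _ _ _
      _ ≤ X := by
        refine Nat.mul_le_mul (Nat.pow_le_pow_right hn ?_) (Nat.pow_le_pow_right (by omega) ?_)
        · nlinarith
        · omega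
  have hX1 : 1 ≤ X := (Nat.one_le_pow _ _ (by omega)).trans h1
  have h2 : n + 1 + τ * (min d n + 1) + τ * m ≤ 4 * (τ * (n + m)) := by
    have : τ * min d n ≤ τ * n := Nat.mul_le_mul_left _ (min_le_right _ _)
    have h3 : n ≤ τ * n := Nat.le_mul_of_pos_left _ hτ
    have h4 : τ ≤ τ * n := Nat.le_mul_of_pos_right _ hn
    simp only [mul_add, mul_one]
    omega
  have h5 : 60 * (τ * m + τ) + 100 ≤ 160 * (τ * (n + m)) := by
    have h4 : τ ≤ τ * n := Nat.le_mul_of_pos_right _ hn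
    simp only [mul_add]
    omega
  have h6 : τ * (n + m) ≤ X * (τ * (n + m)) := Nat.le_mul_of_pos_left _ hX1
  calc _ ≤ 5000 * (4 * (τ * (n + m))) * X + 160 * (τ * (n + m)) := by
        rw [add_assoc]
        gcongr
    _ ≤ 20200 * (X * (τ * (n + m))) := by
        have : 5000 * (4 * (τ * (n + m))) * X = 20000 * (X * (τ * (n + m))) := by ring
        omega
    _ = _ := by ring

end ArrayRAM

/-! ### Choice of the constants -/

theorem mainTheorem5 :
    ∃ (P : WordRAM.Program) (C c : ℕ), ∀ I : MultistageSAT 2, 1 ≤ I.n →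
      DecidesWithin P I ((I.n + I.m + I.τ + I.d + 2) ^ c)
        (C * (I.n ^ (2 * I.τ * I.d) * 2 ^ (I.τ * I.d + 1) * I.τ * (I.n + I.m))) := by
  -- Arrays of length `10 * N ^ 2` suffice and occupy addresses up to a constant times `N ^ 2`. The
  -- exponent 8 is generous: as `4 ≤ N`, it absorbs a factor `4 ^ 6`.
  refine ⟨ArrayRAM.solver, 20200, 8, fun I hn => ?_⟩
  have hτ := I.τ_pos
  set N := I.n + I.m + I.τ + I.d + 2 with hN
  have hN4 : 4 ≤ N := by omega
  have hNN : 4 * N ≤ N ^ 2 := by nlinarith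
  have h1 : I.τ * I.m ≤ N ^ 2 := by nlinarith
  have h2 : I.τ * I.n ≤ N ^ 2 := by nlinarith
  have h8 : 4096 * N ^ 2 ≤ N ^ 8 :=
    calc 4096 * N ^ 2 = 4 ^ 6 * N ^ 2 := by norm_num
      _ ≤ N ^ 6 * N ^ 2 := Nat.mul_le_mul_right _ (Nat.pow_le_pow_left hN4 _)
      _ = N ^ 8 := by ring
  have h3 : I.τ * (1 + I.m * 3) = I.τ + 3 * (I.τ * I.m) := by ring
  obtain ⟨t, s, ht, hs⟩ := ArrayRAM.decidesWithin_solver I (A := 10 * N ^ 2) (B := N ^ 8) hn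
    (by omega) (by omega) (by omega) (by omega) (by omega) (by omega) fun x hx => by
      rw [← ArrayRAM.input_raw] at hx
      have := ArrayRAM.input_raw_le I hx
      omega
  exact ⟨t, s, ht.trans (ArrayRAM.solver_time_le hn hτ), hs⟩
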